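/- **Conventions.** $\mathtt{Top}$ is the category of compactly generated weak Hausdorff spaces. A *topological category* is a small category whose objects and morphisms form objects of $\mathtt{Top}$ and whose structure maps are continuous; $|\mathcal A|\in\mathtt{Top}$ is the geometric realization of the nerve of $\mathcal A$. Index sets are finite linearly ordered sets up to order isomorphism, with dependent sums and products ordered lexicographically. $\mathscr C$ is the terminal operad, and $\mathscr L$ the linear isometries operad: $\mathscr L(S)$ is the space of linear isometries $f=(f_s):\bigoplus_S\mathbb R^\infty\to\mathbb R^\infty$, with $(f\cdot\sigma)_s=f_{\sigma s}$ and $f\langle g^s\rangle=(f_sg^s_t)_{(s,t)}$. **Operad categories.** For an operad $\mathscr G$, a *$\mathscr G$-category* is a topological category $\mathcal C$ with continuous functors $\circledast:\mathscr G(S)\times\mathcal C^{S}\to\mathcal C$ ($\mathscr G(S)$ having only identity morphisms) and continuous natural isomorphisms $\tau^{\sigma}_{f,P}:\circledast_{f\cdot\sigma}(P_{\sigma s})_s\cong\circledast_f(P_t)_t$ for bijections $\sigma:S\to T$ and $f\in\mathscr G(T)$, such that $\circledast_{f\langle g^s\rangle}=\circledast_f\langle\circledast_{g^s}\rangle$,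 $\circledast_{\mathbf{id}}=\mathrm{id}$, $\tau^{\sigma\sigma'}=\tau^\sigma\tau^{\sigma'}$, $\tau^{\mathrm{id}}=\mathrm{id}$, and $\tau$ is compatible with operad composition: $\tau^{\sigma}_f$ evaluated at the objects $\circledast_{g^s}P_s$ is the $\tau$ of the induced block permutation at $f\langle g^s\rangle$, and $\circledast_f\langle\tau^{\sigma_s}_{g^s}\rangle=\tau^{\Sigma\sigma_s}_{f\langle g^s\rangle}$. **$\mathscr L$-permutative categories.** An *$\mathscr L$-permutative category* is a topological category $\mathcal C$ with a $\mathscr C$-structure $(\oplus,\tau^\oplus)$, an $\mathscr L$-structure $(\otimes,\tau^\otimes)$ and continuous natural transformations $$\delta_{f,P}:\otimes_f\Big(\bigoplus_{t\in T_s}P_{s,t}\Big)_{s\in S}\Longrightarrow\bigoplus_{x\in\prod_sT_s}\otimes_f(P_{s,x_s})_{s\in S}\qquad(f\in\mathscr L(S)),$$ such that the empty sum is strictly absorbing (the functor on the left is constant at the empty sum $\oplus_{\emptyset}$ if some $T_s=\emptyset$); $\delta$ is compatible with $\tau^\oplus$, with $\tau^\otimes$, with composition of sums (the two maps $\otimes_f\oplus\oplus\Rightarrow\oplus\oplus\otimes_f$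 agree, up to the $\tau^\oplus$ of the bijection $\prod_s\sum_tR_{s,t}\cong\sum_x\prod_sR_{s,x_s}$) and with composition of products ($\delta_{f\langle g^s\rangle}=\delta_f\circ\otimes_f\langle\delta_{g^s}\rangle$); and $\delta$ is the identity if $f=\mathbf{id}$ or if every $T_s$ has one element. **The index category.** $\hat{\mathscr L}\wr\mathscr F$ has objects $(m,\langle a^i\rangle)$ with $m\ge 0$ and $a^1,\dots,a^m\ge 0$. A morphism $(m,\langle a^i\rangle)\to(n,\langle b^j\rangle)$ consists of a based map $\psi:\{0,\dots,m\}\to\{0,\dots,n\}$ (base point $0$), operations $f^j\in\mathscr L(\psi^{-1}(j))$, and based maps $\kappa^j:\bigwedge_{i\in\psi^{-1}(j)}\underline a^i_*\to\underline b^j_*$ for $1\le j\le n$, where $\underline a_*=\{0,\dots,a\}$. Composition composes the $\psi$'s, the operations by operad composition, and the $\kappa$'s after smashing: the $k$-th component of the composite is $\kappa_2^k\circ\bigwedge_{j\in\psi_2^{-1}(k)}\kappa_1^j$. The hom-sets have their evident topology. **The lax functor.** For an $\mathscr L$-permutative category $\mathcal C$ let $\mathcal{FC}(m,\langle a^i\rangle)=\mathcal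 C^{\Sigma_ia^i}$ and $$\mathcal{FC}(\psi,f,\kappa)\langle P_{i,y}\rangle=\Big\langle\bigoplus_{x\in(\kappa^j)^{-1}(z)}\otimes_{f^j}(P_{i,x_i})_{i\in\psi^{-1}(j)}\Big\rangle_{(j,z)},$$ with identities $\mathrm{id}=\mathcal{FC}(\mathrm{id})$ and with the transformations $\omega:\mathcal{FC}(h_2)\mathcal{FC}(h_1)\Rightarrow\mathcal{FC}(h_2h_1)$ given by $\delta$ followed by the permutations $\tau^\otimes$ and $\tau^\oplus$ that identify the index sets. **Rectification.** For a lax functor $F$, Street's rectification $\overline F$ has as $\overline FX$ the category of pairs $(\varphi:Y\to X,\ P\in FY)$. A morphism $(\varphi,P)\to(\varphi',P')$ is a pair $(\psi,U)$ with $\psi:Y'\to Y$, $\varphi\psi=\varphi'$ and $U:P\to F\psi(P')$; identities are given by the unit constraints of $F$; the composite of $(\psi_1,U_1)$ followed by $(\psi_2,U_2)$ is $(\psi_1\psi_2,\ \omega\circ F\psi_1(U_2)\circ U_1)$; and $\overline F\chi(\varphi,P)=(\chi\varphi,P)$, $\overline F\chi(\psi,U)=(\psi,U)$. **Statement.** Let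 $\mathcal C$ be an $\mathscr L$-permutative category. Then $\mathcal{FC}$ is a lax functor, its rectification $\overline{\mathcal{FC}}$ takes values in topological categories, and $Z=|\overline{\mathcal{FC}}|$ is a special $\hat{\mathscr L}\wr\mathscr F$-space. That is, $Z:\hat{\mathscr L}\wr\mathscr F\to\mathtt{Top}$ is a continuous functor and, with products formed in $\mathtt{Top}$: 1. the space $Z$ of the unique object with $m=0$ is contractible; 2. for every $(m,\langle a^i\rangle)$ the map $Z(m,\langle a^i\rangle)\to\prod_{i=1}^mZ(1,a^i)$ induced by the projections $(\delta_i,\mathbf{id},\mathrm{id})$ is a homotopy equivalence, where $\delta_i^{-1}(1)=\{i\}$ and all other elements go to the base point; 3. $Z(1,0)$ is contractible; 4. for every $a\ge 0$ the map $Z(1,a)\to\prod_{x=1}^aZ(1,1)$ induced by the morphisms $(\mathrm{id},\mathbf{id},\delta_x)$ is a homotopy equivalence. -/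

import Mathlib

open CategoryTheory TopologicalSpace
open scoped Topology

universe u

noncomputable section

/-! ## Compactly generated weak Hausdorff spaces -/

/-- Continuity for the compactly generated refinement (`k`-topology) of the source.  With the
product topology on the source this is continuity on the product of compactly generated spaces. -/
def KContinuous {X : Type u} {Y : Type*} [TopologicalSpace X] [t : TopologicalSpace Y]
    (f : X → Y) : Prop :=
  Continuous[compactlyGenerated.{u} X, t] f

/-- The space `X` with its topology replaced by the compactly generated refinement. -/
def KSpace (X : Type u) : Type u := X

instance KSpace.instTopologicalSpace (X : Type u) [t : TopologicalSpace X] :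
    TopologicalSpace (KSpace X) :=
  compactlyGenerated.{u} X

/-- Images of compact Hausdorff spaces are closed. -/
class WeaklyHausdorffSpace (X : Type u) [TopologicalSpace X] : Prop where
  isClosed_range : ∀ (K : Type u) [TopologicalSpace K] [CompactSpace K] [T2Space K] (p : K → X),
    Continuous p → IsClosed (Set.range p)

/-- Being an object of the category of compactly generated weak Hausdorff spaces. -/
class CGWHSpace (X : Type u) [TopologicalSpace X] : Prop where
  compactlyGenerated : CompactlyGeneratedSpace X
  weaklyHausdorff : WeaklyHausdorffSpace X

/-- `f` is (the underlying map of) a homotopy equivalence. -/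
def IsHomotopyEquivalence {X Y : Type*} [TopologicalSpace X] [TopologicalSpace Y]
    (f : X → Y) : Prop :=
  ∃ e : ContinuousMap.HomotopyEquiv X Y, (e.toFun : X → Y) = f

/-! ## Topological categories and their classifying spaces -/

/-- A small category with a topology on its set of objects and on its set of morphisms. -/
structure TopCategory : Type (u + 1) where
  Ob : Type u
  [cat : SmallCategory Ob]
  [topOb : TopologicalSpace Ob]
  [topMor : TopologicalSpace (Arrow Ob)]

attribute [instance] TopCategory.cat TopCategory.topOb TopCategory.topMor

/-- The axioms of a topological category: a category internal to compactly generated weak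
Hausdorff spaces. -/
structure TopCategory.IsTopological (A : TopCategory.{u}) : Prop where
  cgwh_ob : CGWHSpace A.Ob
  cgwh_mor : CGWHSpace (Arrow A.Ob)
  continuous_source : Continuous fun g : Arrow A.Ob => g.left
  continuous_target : Continuous fun g : Arrow A.Ob => g.right
  continuous_id : Continuous fun a : A.Ob => Arrow.mk (𝟙 a)
  continuous_comp : KContinuous
    fun p : {p : Arrow A.Ob × Arrow A.Ob // p.1.right = p.2.left} =>
      Arrow.mk (p.1.1.hom ≫ eqToHom p.2 ≫ p.1.2.hom)

/-- The power `A ^ I` of a topological category. -/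
def TopCategory.pow (A : TopCategory.{u}) (I : Type) : TopCategory.{u} where
  Ob := I → A.Ob
  topOb := compactlyGenerated.{u} (I → A.Ob)
  topMor := @compactlyGenerated.{u} (Arrow (I → A.Ob))
    (induced (fun (g : Arrow (I → A.Ob)) (i : I) => Arrow.mk (g.hom i)) inferInstance)

/-- The space of `n`-simplices of the nerve: strings of `n` composable morphisms, topologized
through all the morphisms `x i ⟶ x j` for `i ≤ j` (identities and composites included). -/
instance TopCategory.nerveTopology (A : TopCategory.{u}) (n : SimplexCategory) :
    TopologicalSpace ((nerve A.Ob).obj (Opposite.op n)) :=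
  @compactlyGenerated.{u} (ComposableArrows A.Ob n.len)
    (induced (fun (x : ComposableArrows A.Ob n.len)
        (p : {p : Fin (n.len + 1) × Fin (n.len + 1) // p.1 ≤ p.2}) =>
      Arrow.mk (x.map (homOfLE p.2))) inferInstance)

/-- The disjoint union of the spaces `N_n A × Δ^n`. -/
abbrev TopCategory.PreRealization (A : TopCategory.{u}) : Type u :=
  Σ n : SimplexCategory, (nerve A.Ob).obj (Opposite.op n) × stdSimplex ℝ (Fin (n.len + 1))

/-- The relation `(θ^* x, t) ∼ (x, θ_* t)`, for the maps `θ` of the simplex category. -/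
inductive TopCategory.RealizationRel (A : TopCategory.{u}) :
    A.PreRealization → A.PreRealization → Prop
  | glue {m n : SimplexCategory} (θ : m ⟶ n) (x : (nerve A.Ob).obj (Opposite.op n))
      (t : stdSimplex ℝ (Fin (m.len + 1))) :
      RealizationRel A ⟨m, ((nerve A.Ob).map θ.op x, t)⟩ ⟨n, (x, stdSimplex.map θ t)⟩

/-- The geometric realization of (the nerve of) a topological category, with the quotient
topology. -/
def TopCategory.Realization (A : TopCategory.{u}) : Type u := Quot A.RealizationRel

instance (A : TopCategory.{u}) : TopologicalSpace A.Realization :=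
  inferInstanceAs (TopologicalSpace (Quot A.RealizationRel))

/-- The map of geometric realizations induced by a functor. -/
def TopCategory.realizationMap {A B : TopCategory.{u}} (G : A.Ob ⥤ B.Ob) :
    A.Realization → B.Realization :=
  Quot.map (fun p => ⟨p.1, ((nerveMap G).app (Opposite.op p.1) p.2.1, p.2.2)⟩) (by
    rintro _ _ ⟨θ, x, t⟩
    exact TopCategory.RealizationRel.glue θ ((nerveMap G).app _ x) t)

/-! ## The linear isometries operad -/

/-- The standard inner product on the space `ι →₀ ℝ` of finitely supported vectors. -/
def stdInner {ι : Type} (u v : ι →₀ ℝ) : ℝ := u.sum fun i a => a * v i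

/-- The colimit topology of the finite dimensional subspaces of a real vector space, that is, the
final topology for all linear maps out of the spaces `ℝ ^ n`. -/
@[reducible]
def finiteTopology (V : Type) [AddCommGroup V] [Module ℝ V] : TopologicalSpace V :=
  ⨆ (n : ℕ) (g : (Fin n → ℝ) →ₗ[ℝ] V), coinduced g inferInstance

/-- Linear isometries, not necessarily surjective, between the standard inner product spaces on
the bases `ι` and `κ`. -/
def LinIsom (ι κ : Type) : Type :=
  {f : (ι →₀ ℝ) →ₗ[ℝ] (κ →₀ ℝ) // ∀ u v, stdInner (f u) (f v) = stdInner u v}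

namespace LinIsom

variable {ι κ μ : Type}

/-- The compact-open topology, for the colimit topologies on source and target. -/
instance : TopologicalSpace (LinIsom ι κ) :=
  generateFrom {A | ∃ (K : Set (ι →₀ ℝ)) (U : Set (κ →₀ ℝ)),
    @IsCompact _ (finiteTopology _) K ∧ IsOpen[finiteTopology _] U ∧
      A = {f : LinIsom ι κ | Set.MapsTo f.1 K U}}

lemma stdInner_add_left (u v w : ι →₀ ℝ) : stdInner (u + v) w = stdInner u w + stdInner v w := by
  unfold stdInner
  exact Finsupp.sum_add_index' (by simp) (by intros; ring)

lemma stdInner_smul_left (c : ℝ) (u v : ι →₀ ℝ) : stdInner (c • u) v = c * stdInner u v := by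
  unfold stdInner
  rw [Finsupp.sum_smul_index (by simp), Finsupp.mul_sum]
  simp only [mul_assoc]

lemma stdInner_comm (u v : ι →₀ ℝ) : stdInner u v = stdInner v u := by
  classical
  unfold stdInner
  rw [Finsupp.sum_of_support_subset u (Finset.subset_union_left (s₂ := v.support)) _ (by simp),
    Finsupp.sum_of_support_subset v (Finset.subset_union_right (s₁ := u.support)) _ (by simp)]
  exact Finset.sum_congr rfl fun _ _ => mul_comm _ _

lemma stdInner_single_left (i : ι) (a : ℝ) (v : ι →₀ ℝ) :
    stdInner (Finsupp.single i a) v = a * v i := by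
  simp [stdInner]

/-- A linear map that preserves inner products of basis vectors is isometric. -/
lemma isometry_of_basis (f : (ι →₀ ℝ) →ₗ[ℝ] (κ →₀ ℝ))
    (h : ∀ i j, stdInner (f (Finsupp.single i 1)) (f (Finsupp.single j 1)) =
      stdInner (Finsupp.single i 1) (Finsupp.single j (1 : ℝ))) (u v : ι →₀ ℝ) :
    stdInner (f u) (f v) = stdInner u v := by
  have zl : ∀ {α : Type} (w : α →₀ ℝ), stdInner 0 w = 0 := by intros; simp [stdInner]
  have key : ∀ (i : ι) (v : ι →₀ ℝ), stdInner (f v) (f (Finsupp.single i 1)) =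
      stdInner v (Finsupp.single i 1) := by
    intro i v
    induction v using Finsupp.induction_linear with
    | zero => simp [zl]
    | add x y hx hy => rw [map_add, stdInner_add_left, stdInner_add_left, hx, hy]
    | single j b =>
      rw [← mul_one b, ← smul_eq_mul, ← Finsupp.smul_single, map_smul, stdInner_smul_left,
        stdInner_smul_left, h]
  induction u using Finsupp.induction_linear with
  | zero => simp [zl]
  | add x y hx hy => rw [map_add, stdInner_add_left, stdInner_add_left, hx, hy]
  | single j b =>
    rw [← mul_one b, ← smul_eq_mul, ← Finsupp.smul_single, map_smul, stdInner_smul_left,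
      stdInner_smul_left, stdInner_comm, key, stdInner_comm]

lemma stdInner_mapDomain {e : ι → κ} (he : Function.Injective e) (u v : ι →₀ ℝ) :
    stdInner (Finsupp.mapDomain e u) (Finsupp.mapDomain e v) = stdInner u v := by
  unfold stdInner
  rw [Finsupp.sum_mapDomain_index (by simp) (by intros; ring)]
  simp only [Finsupp.mapDomain_apply he]

lemma stdInner_mapDomain_eq_zero {e : ι → κ} {e' : μ → κ} (h : ∀ a b, e a ≠ e' b)
    (u : ι →₀ ℝ) (v : μ →₀ ℝ) :
    stdInner (Finsupp.mapDomain e u) (Finsupp.mapDomain e' v) = 0 := by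
  unfold stdInner
  rw [Finsupp.sum_mapDomain_index (by simp) (by intros; ring)]
  refine Finset.sum_eq_zero fun k _ => ?_
  dsimp only
  rw [Finsupp.mapDomain_of_notMem_range, mul_zero]
  rintro ⟨l, hl⟩
  exact h _ _ hl.symm

/-- The isometry that an injection of the bases induces. -/
def ofInjective (e : ι → κ) (he : Function.Injective e) : LinIsom ι κ :=
  ⟨Finsupp.lmapDomain ℝ ℝ e, fun u v => stdInner_mapDomain he u v⟩

/-- Composition of isometries. -/
def comp (g : LinIsom κ μ) (f : LinIsom ι κ) : LinIsom ι μ :=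
  ⟨g.1 ∘ₗ f.1, fun u v => by rw [LinearMap.comp_apply, LinearMap.comp_apply, g.2, f.2]⟩

/-- The orthogonal direct sum of isometries `g s : ⊕_{T s} ℝ^∞ → ℝ^∞`. -/
def directSum {S : Type} {T : S → Type} (g : ∀ s, LinIsom (T s × ℕ) ℕ) :
    LinIsom ((Σ s, T s) × ℕ) (S × ℕ) :=
  ⟨Finsupp.linearCombination ℝ fun x : (Σ s, T s) × ℕ =>
      Finsupp.mapDomain (fun n => (x.1.1, n)) ((g x.1.1).1 (Finsupp.single (x.1.2, x.2) 1)), by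
    refine isometry_of_basis _ ?_
    rintro ⟨⟨s, t⟩, n⟩ ⟨⟨s', t'⟩, n'⟩
    have inj : ∀ s : S, Function.Injective fun n : ℕ => (s, n) := fun s a b h => (Prod.ext_iff.1 h).2
    simp only [Finsupp.linearCombination_single, one_smul]
    by_cases hs : s = s'
    · subst hs
      rw [stdInner_mapDomain (inj s), (g s).2, stdInner_single_left, stdInner_single_left]
      classical
      simp [Finsupp.single_apply]
    · rw [stdInner_single_left, Finsupp.single_eq_of_ne (by simp; tauto)]
      rw [mul_zero]
      exact stdInner_mapDomain_eq_zero (fun a b h => hs (Prod.ext_iff.1 h).1) _ _⟩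

lemma directSum_single {S : Type} {T : S → Type} (g : ∀ s, LinIsom (T s × ℕ) ℕ) (s : S) (t : T s)
    (n : ℕ) : (directSum g).1 (Finsupp.single (⟨s, t⟩, n) 1) =
      Finsupp.mapDomain (fun n => (s, n)) ((g s).1 (Finsupp.single (t, n) 1)) :=
  (Finsupp.linearCombination_single ℝ (1 : ℝ) _).trans (one_smul _ _)

lemma comp_directSum_single {S : Type} {T : S → Type} (f : LinIsom (S × ℕ) ℕ)
    (g : ∀ s, LinIsom (T s × ℕ) ℕ) (s : S) (t : T s) (n : ℕ) :
    (f.comp ((directSum g).comp (ofInjective (Prod.map (ofLex (α := Σ s, T s)) id)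
      (ofLex.injective.prodMap fun _ _ h => h)))).1 (Finsupp.single (toLex ⟨s, t⟩, n) 1) =
    f.1 (Finsupp.mapDomain (fun n => (s, n)) ((g s).1 (Finsupp.single (t, n) 1))) := by
  have e : Finsupp.mapDomain (Prod.map (ofLex (α := Σ s, T s)) (id : ℕ → ℕ))
      (Finsupp.single (toLex ⟨s, t⟩, n) (1 : ℝ)) = Finsupp.single (⟨s, t⟩, n) 1 :=
    Finsupp.mapDomain_single
  rw [← directSum_single, ← e]
  rfl

end LinIsom

/-- The data of a (symmetric, topological) operad, with operations labelled by arbitrary finite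
sets: `Op S` is the space of operations with set of inputs `S`, `act` is the right action
`f ↦ f · σ` of bijections, and the inputs of a composite are labelled by the dependent sum, to be
ordered lexicographically. -/
structure OperadData : Type 1 where
  Op : Type → Type
  [top : ∀ S, TopologicalSpace (Op S)]
  act : ∀ {S T : Type}, S ≃ T → Op T → Op S
  one : ∀ (S : Type) [Unique S], Op S
  comp : ∀ {S : Type} {T : S → Type}, Op S → (∀ s, Op (T s)) → Op (Lex (Σ s, T s))

attribute [instance] OperadData.top

/-- The terminal operad `𝒞`. -/
def terminalOperad : OperadData where
  Op _ := PUnit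
  act _ _ := PUnit.unit
  one _ := PUnit.unit
  comp _ _ := PUnit.unit

/-- The linear isometries operad `ℒ`: an operation `f` with inputs `S` is a linear isometry
`⊕_S ℝ^∞ → ℝ^∞`; with `f_s` for its components, `(f · σ)_s = f_{σ s}` and
`(f⟨g⟩)_{(s, t)} = f_s g^s_t`. -/
def isometriesOperad : OperadData where
  Op S := LinIsom (S × ℕ) ℕ
  act σ f := f.comp (LinIsom.ofInjective (Prod.map σ id) (σ.injective.prodMap fun _ _ h => h))
  one _ := LinIsom.ofInjective Prod.snd fun _ _ h => Prod.ext (Subsingleton.elim _ _) h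
  comp f g := f.comp ((LinIsom.directSum g).comp
    (LinIsom.ofInjective (Prod.map ofLex id) (ofLex.injective.prodMap fun _ _ h => h)))

/-- The linear map that underlies an operation of `ℒ`. -/
def isometriesOperad.toLinear {S : Type} (f : isometriesOperad.Op S) :
    ((S × ℕ) →₀ ℝ) →ₗ[ℝ] (ℕ →₀ ℝ) :=
  f.1

namespace isometriesOperad

lemma toLinear_act {S T : Type} (σ : S ≃ T) (f : isometriesOperad.Op T) (s : S) (n : ℕ) :
    toLinear (isometriesOperad.act σ f) (Finsupp.single (s, n) 1) =
      toLinear f (Finsupp.single (σ s, n) 1) :=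
  congrArg (toLinear f) (Finsupp.mapDomain_single (f := Prod.map σ id) (a := (s, n)))

lemma toLinear_one {S : Type} [Unique S] (s : S) (n : ℕ) :
    toLinear (isometriesOperad.one S) (Finsupp.single (s, n) 1) = Finsupp.single n 1 :=
  Finsupp.mapDomain_single (f := Prod.snd) (a := (s, n))

lemma toLinear_comp {S : Type} {T : S → Type} (f : isometriesOperad.Op S)
    (g : ∀ s, isometriesOperad.Op (T s)) (s : S) (t : T s) (n : ℕ) :
    toLinear (isometriesOperad.comp f g) (Finsupp.single (toLex ⟨s, t⟩, n) 1) =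
      toLinear f (Finsupp.mapDomain (fun n => (s, n))
        (toLinear (g s) (Finsupp.single (t, n) 1))) := by
  exact LinIsom.comp_directSum_single f g s t n

end isometriesOperad

/-! ## The wreath product `ℒ̂ ≀ ℱ` -/

/-- Objects `(m_*, ⟨a^i_*⟩)`. -/
structure RingIndex : Type where
  m : ℕ
  a : Fin m → ℕ

/-- The fibre `ψ⁻¹(j)` of a based map `m_* → n_*` over a non-base point; a based map is written
as a map `Fin m → Option (Fin n)`, with `none` for the base point. -/
abbrev Fibre {m n : ℕ} (ψ : Fin m → Option (Fin n)) (j : Fin n) : Type :=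
  {i : Fin m // ψ i = some j}

/-- The non-base points of the smash product `⋀_{ψ⁻¹(j)} a^i_*`. -/
abbrev Smash {m n : ℕ} (a : Fin m → ℕ) (ψ : Fin m → Option (Fin n)) (j : Fin n) : Type :=
  ∀ i : Fibre ψ j, Fin (a i)

namespace RingIndex

/-- Morphisms `(f̂, ⟨κ^j⟩)`: a based map `ψ`, operations `f^j ∈ ℒ(ψ⁻¹(j))`, and based maps
`κ^j : ⋀_{ψ⁻¹(j)} a^i_* → b^j_*`. -/
structure Hom (X Y : RingIndex) : Type where
  ψ : Fin X.m → Option (Fin Y.m)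
  f : ∀ j, isometriesOperad.Op (Fibre ψ j)
  κ : ∀ j, Smash X.a ψ j → Option (Fin (Y.a j))

/-- Composition of based maps. -/
abbrev compMap {l m n : ℕ} (ψ₁ : Fin l → Option (Fin m)) (ψ₂ : Fin m → Option (Fin n)) :
    Fin l → Option (Fin n) :=
  fun i => (ψ₁ i).bind ψ₂

lemma isSome_of_fibre {l m n : ℕ} {ψ₁ : Fin l → Option (Fin m)} {ψ₂ : Fin m → Option (Fin n)}
    {k : Fin n} (i : Fibre (compMap ψ₁ ψ₂) k) : (ψ₁ i.1).isSome := by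
  obtain ⟨j, hj, -⟩ := Option.bind_eq_some_iff.1 i.2
  rw [hj, Option.isSome_some]

lemma get_mem_fibre {l m n : ℕ} {ψ₁ : Fin l → Option (Fin m)} {ψ₂ : Fin m → Option (Fin n)}
    {k : Fin n} (i : Fibre (compMap ψ₁ ψ₂) k) :
    ψ₂ ((ψ₁ i.1).get (isSome_of_fibre i)) = some k := by
  obtain ⟨j, hj, h⟩ := Option.bind_eq_some_iff.1 i.2
  rwa [Option.get_of_eq_some _ hj]

lemma sigma_fibre_ext {l m n : ℕ} {ψ₁ : Fin l → Option (Fin m)} {ψ₂ : Fin m → Option (Fin n)}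
    {k : Fin n} {p q : Σ j : Fibre ψ₂ k, Fibre ψ₁ j} (h : p.2.1 = q.2.1) : p = q := by
  obtain ⟨⟨j, hj⟩, ⟨i, hi⟩⟩ := p
  obtain ⟨⟨j', hj'⟩, ⟨i', hi'⟩⟩ := q
  obtain rfl : i = i' := h
  obtain rfl : j = j' := Option.some_injective _ (hi.symm.trans hi')
  rfl

/-- The inclusion `ψ₁⁻¹(j) ⊆ (ψ₂ψ₁)⁻¹(k)` for `j ∈ ψ₂⁻¹(k)`. -/
abbrev fibreIncl {l m n : ℕ} {ψ₁ : Fin l → Option (Fin m)} {ψ₂ : Fin m → Option (Fin n)}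
    {k : Fin n} (j : Fibre ψ₂ k) (i : Fibre ψ₁ j) : Fibre (compMap ψ₁ ψ₂) k :=
  ⟨i.1, Option.bind_eq_some_iff.2 ⟨_, i.2, j.2⟩⟩

/-- The bijection `σ : (ψ₂ψ₁)⁻¹(k) ≃ Σ_{j ∈ ψ₂⁻¹(k)} ψ₁⁻¹(j)`, `i ↦ (ψ₁ i, i)`. -/
def fibreEquiv {l m n : ℕ} (ψ₁ : Fin l → Option (Fin m)) (ψ₂ : Fin m → Option (Fin n))
    (k : Fin n) : Fibre (compMap ψ₁ ψ₂) k ≃ Lex (Σ j : Fibre ψ₂ k, Fibre ψ₁ j) where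
  toFun i := toLex ⟨⟨(ψ₁ i.1).get (isSome_of_fibre i), get_mem_fibre i⟩, ⟨i.1, by simp⟩⟩
  invFun p := fibreIncl (ofLex p).1 (ofLex p).2
  left_inv _ := rfl
  right_inv _ := ofLex.injective (sigma_fibre_ext rfl)

/-- The composite `κ₂ ∘ (⋀ κ₁) ∘ σ` of based maps of smash products: a point is sent to the base
point as soon as one of its components is. -/
def compSmash {X Y Z : RingIndex} (h₁ : Hom X Y) (h₂ : Hom Y Z) (k : Fin Z.m)
    (x : Smash X.a (compMap h₁.ψ h₂.ψ) k) : Option (Fin (Z.a k)) :=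
  let y (j : Fibre h₂.ψ k) : Option (Fin (Y.a j)) :=
    h₁.κ j fun i => x (fibreIncl j i)
  if h : ∀ j, (y j).isSome then h₂.κ k fun j => (y j).get (h j) else none

/-- The identity morphism. -/
abbrev Hom.id (X : RingIndex) : Hom X X where
  ψ := some
  f j :=
    haveI : Unique (Fibre some j) := ⟨⟨⟨j, rfl⟩⟩, fun i => Subtype.ext (Option.some_injective _ i.2)⟩
    isometriesOperad.one _
  κ j x := some (x ⟨j, rfl⟩)

/-- Composition of morphisms (in diagrammatic order). -/
abbrev Hom.comp {X Y Z : RingIndex} (h₁ : Hom X Y) (h₂ : Hom Y Z) : Hom X Z where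
  ψ := compMap h₁.ψ h₂.ψ
  f k := isometriesOperad.act (fibreEquiv h₁.ψ h₂.ψ k)
    (isometriesOperad.comp (h₂.f k) fun j => h₁.f j)
  κ k := compSmash h₁ h₂ k

lemma compSmash_eq_some {X Y Z : RingIndex} (h₁ : Hom X Y) (h₂ : Hom Y Z) (k : Fin Z.m)
    (x : Smash X.a (compMap h₁.ψ h₂.ψ) k) (z : Fin (Z.a k)) :
    compSmash h₁ h₂ k x = some z ↔ ∃ y : Smash Y.a h₂.ψ k,
      (∀ j : Fibre h₂.ψ k, h₁.κ j (fun i => x (fibreIncl j i)) = some (y j)) ∧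
        h₂.κ k y = some z := by
  unfold compSmash
  dsimp only
  split_ifs with h
  · constructor
    · intro hz
      exact ⟨_, fun j => (Option.some_get (h j)).symm, hz⟩
    · rintro ⟨y, hy, hz⟩
      rw [← hz]
      congr 1
      funext j
      exact Option.get_of_eq_some _ (hy j)
  · refine ⟨fun hz => by simp at hz, ?_⟩
    rintro ⟨y, hy, -⟩
    exact (h fun j => by rw [hy j, Option.isSome_some]).elim

lemma comp_κ_eq_some {X Y Z : RingIndex} (h₁ : Hom X Y) (h₂ : Hom Y Z) (k : Fin Z.m)
    (x : Smash X.a (h₁.comp h₂).ψ k) (z : Fin (Z.a k)) :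
    (h₁.comp h₂).κ k x = some z ↔ ∃ y : Smash Y.a h₂.ψ k,
      (∀ j : Fibre h₂.ψ k, h₁.κ j (fun i =>
        x (fibreIncl j i)) = some (y j)) ∧ h₂.κ k y = some z :=
  compSmash_eq_some h₁ h₂ k x z

lemma Hom.ext' {X Y : RingIndex} {h h' : Hom X Y} (hψ : h.ψ = h'.ψ)
    (hf : ∀ j i (hi : h.ψ i = some j) (hi' : h'.ψ i = some j) (n : ℕ),
      isometriesOperad.toLinear (h.f j) (Finsupp.single (⟨i, hi⟩, n) 1) =
        isometriesOperad.toLinear (h'.f j) (Finsupp.single (⟨i, hi'⟩, n) 1))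
    (hκ : ∀ j (x : Smash X.a h.ψ j) (x' : Smash X.a h'.ψ j),
      (∀ i hi hi', x ⟨i, hi⟩ = x' ⟨i, hi'⟩) → h.κ j x = h'.κ j x') : h = h' := by
  obtain ⟨ψ, f, κ⟩ := h
  obtain ⟨ψ', f', κ'⟩ := h'
  obtain rfl : ψ = ψ' := hψ
  congr 1
  · funext j
    refine Subtype.ext (Finsupp.lhom_ext' fun ⟨⟨i, hi⟩, n⟩ => LinearMap.ext_ring ?_)
    exact hf j i hi hi n
  · funext j x
    exact hκ j x x fun _ _ _ => rfl

lemma comp_f_single {X Y Z : RingIndex} (h₁ : Hom X Y) (h₂ : Hom Y Z) {k : Fin Z.m} {j : Fin Y.m}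
    {i : Fin X.m} (hi : h₁.ψ i = some j) (hj : h₂.ψ j = some k) (hik) (n : ℕ) :
    isometriesOperad.toLinear ((h₁.comp h₂).f k) (Finsupp.single (⟨i, hik⟩, n) 1) =
      isometriesOperad.toLinear (h₂.f k) (Finsupp.mapDomain (fun n => (⟨j, hj⟩, n))
        (isometriesOperad.toLinear (h₁.f j) (Finsupp.single (⟨i, hi⟩, n) 1))) := by
  have e : fibreEquiv h₁.ψ h₂.ψ k ⟨i, hik⟩ = toLex ⟨⟨j, hj⟩, ⟨i, hi⟩⟩ :=
    ofLex.injective (sigma_fibre_ext rfl)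
  refine (isometriesOperad.toLinear_act _ _ _ _).trans ?_
  rw [e]
  exact isometriesOperad.toLinear_comp _ _ _ _ _

lemma comp_f_mapDomain {X Y Z : RingIndex} (h₂ : Hom X Y) (h₃ : Hom Y Z)
    {l : Fin Z.m} {k : Fin Y.m} (hk : h₃.ψ k = some l) {j : Fin X.m} (hj : h₂.ψ j = some k) (hjl)
    (v : ℕ →₀ ℝ) :
    isometriesOperad.toLinear ((h₂.comp h₃).f l) (Finsupp.mapDomain (fun n => (⟨j, hjl⟩, n)) v) =
      isometriesOperad.toLinear (h₃.f l) (Finsupp.mapDomain (fun n => (⟨k, hk⟩, n))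
        (isometriesOperad.toLinear (h₂.f k) (Finsupp.mapDomain (fun n => (⟨j, hj⟩, n)) v))) := by
  induction v using Finsupp.induction_linear with
  | zero => simp
  | add x y hx hy => simp only [Finsupp.mapDomain_add, map_add, hx, hy]
  | single n b =>
    rw [← mul_one b, ← smul_eq_mul, ← Finsupp.smul_single]
    simp only [Finsupp.mapDomain_smul, map_smul, Finsupp.mapDomain_single]
    rw [comp_f_single h₂ h₃ hj hk]

lemma id_f_single {X : RingIndex} (j i : Fin X.m) (hi : (Hom.id X).ψ i = some j) (n : ℕ) :
    isometriesOperad.toLinear ((Hom.id X).f j) (Finsupp.single (⟨i, hi⟩, n) 1) =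
      Finsupp.single n 1 :=
  haveI : Unique (Fibre (some : Fin X.m → _) j) :=
    ⟨⟨⟨j, rfl⟩⟩, fun i => Subtype.ext (Option.some_injective _ i.2)⟩
  isometriesOperad.toLinear_one _ _

lemma id_f_mapDomain {X : RingIndex} (j i : Fin X.m) (hi : (Hom.id X).ψ i = some j)
    (v : ℕ →₀ ℝ) :
    isometriesOperad.toLinear ((Hom.id X).f j) (Finsupp.mapDomain (fun n => (⟨i, hi⟩, n)) v) =
      v := by
  induction v using Finsupp.induction_linear with
  | zero => simp
  | add x y hx hy => simp only [Finsupp.mapDomain_add, map_add, hx, hy]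
  | single n b =>
    rw [← mul_one b, ← smul_eq_mul, ← Finsupp.smul_single]
    simp only [Finsupp.mapDomain_smul, map_smul, Finsupp.mapDomain_single]
    rw [id_f_single]

instance : Category RingIndex where
  Hom := Hom
  id := Hom.id
  comp := Hom.comp
  id_comp := by
    intro X Y h
    refine Hom.ext' ?_ ?_ ?_
    · funext i
      rfl
    · intro j i hi hi' n
      rw [comp_f_single (Hom.id X) h (j := i) rfl hi', id_f_single, Finsupp.mapDomain_single]
    · intro j x x' hx
      refine Option.ext fun z => (compSmash_eq_some _ _ _ _ _).trans ?_
      constructor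
      · rintro ⟨y, hy, hz⟩
        rw [← hz]
        congr 1
        funext i
        rw [← Option.some_injective _ (hy i)]
        exact (hx _ _ _).symm
      · intro hz
        exact ⟨x', fun i => congrArg some (hx _ _ _), hz⟩
  comp_id := by
    intro X Y h
    have hψ : (h.comp (Hom.id Y)).ψ = h.ψ := by
      funext i
      exact Option.bind_fun_some (h.ψ i)
    refine Hom.ext' hψ ?_ ?_
    · intro j i hi hi' n
      rw [comp_f_single h (Hom.id Y) hi' rfl, id_f_mapDomain]
    · intro j x x' hx
      refine Option.ext fun z => (compSmash_eq_some _ _ _ _ _).trans ?_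
      have key : (h.κ j fun i => x (fibreIncl ⟨j, rfl⟩ i)) =
          h.κ j x' := by
        congr 1
        funext i
        exact hx _ _ _
      constructor
      · rintro ⟨y, hy, hz⟩
        rw [← hz, ← key]
        exact hy ⟨j, rfl⟩
      · intro hz
        have e : ∀ j' : Fibre (some : Fin Y.m → _) j, j = j'.1 :=
          fun j' => (Option.some_injective _ j'.2).symm
        refine ⟨fun j' => Fin.cast (congrArg Y.a (e j')) z, ?_, rfl⟩
        rintro ⟨j', hj'⟩
        obtain rfl : j = j' := e ⟨j', hj'⟩
        exact key.trans hz
  assoc := by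
    intro W X Y Z h₁ h₂ h₃
    have hψ : ((h₁.comp h₂).comp h₃).ψ = (h₁.comp (h₂.comp h₃)).ψ := by
      funext i
      exact Option.bind_assoc _ _ _
    refine Hom.ext' hψ ?_ ?_
    · intro l i hi hi' n
      obtain ⟨k, hk, hl⟩ := Option.bind_eq_some_iff.1 hi
      obtain ⟨j, hj, hjk⟩ := Option.bind_eq_some_iff.1 hk
      have hjl : (h₂.comp h₃).ψ j = some l := Option.bind_eq_some_iff.2 ⟨k, hjk, hl⟩
      rw [comp_f_single (h₁.comp h₂) h₃ hk hl, comp_f_single h₁ h₂ hj hjk,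
        comp_f_single h₁ (h₂.comp h₃) hj hjl, comp_f_mapDomain h₂ h₃ hl hjk]
    · intro l x x' hx
      refine Option.ext fun z => (compSmash_eq_some _ _ _ _ _).trans
        (Iff.trans ?_ (compSmash_eq_some _ _ _ _ _).symm)
      constructor
      · rintro ⟨y, hy, hz⟩
        have hy' := fun k => (comp_κ_eq_some h₁ h₂ k.1 (fun i => x (fibreIncl k i)) (y k)).1 (hy k)
        choose w hw hw' using hy'
        have hget : ∀ j : Fibre (h₂.comp h₃).ψ l, ∃ k, h₂.ψ j = some k ∧ h₃.ψ k = some l :=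
          fun j => Option.bind_eq_some_iff.1 j.2
        choose k hk hkl using hget
        refine ⟨fun j => w ⟨k j, hkl j⟩ ⟨j, hk j⟩, fun j => ?_,
          (comp_κ_eq_some h₂ h₃ l (fun j => w ⟨k j, hkl j⟩ ⟨j, hk j⟩) z).2 ⟨y, fun k' => ?_, hz⟩⟩
        · rw [← hw ⟨k j, hkl j⟩ ⟨j, hk j⟩]
          congr 1
          funext i
          exact (hx _ _ _).symm
        · rw [← hw' k']
          congr 1
          funext j
          have : ∀ (k₁ k₂ : Fibre h₃.ψ l) (h₁' : h₂.ψ j = some k₁.1) (h₂' : h₂.ψ j = some k₂.1),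
              w k₁ ⟨j, h₁'⟩ = w k₂ ⟨j, h₂'⟩ := by
            intro k₁ k₂ h₁' h₂'
            obtain rfl : k₁ = k₂ := Subtype.ext (Option.some_injective _ (h₁'.symm.trans h₂'))
            rfl
          exact this _ _ _ _
      · rintro ⟨w, hw, hz⟩
        obtain ⟨y, hy, hz⟩ := (compSmash_eq_some _ _ _ _ _).1 hz
        refine ⟨y, fun k => (comp_κ_eq_some h₁ h₂ k.1 (fun i => x (fibreIncl k i)) (y k)).2
          ⟨fun j => w (fibreIncl k j), fun j => ?_, hy k⟩, hz⟩
        refine Eq.trans ?_ (hw (fibreIncl k j))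
        congr 1
        funext i
        exact hx _ _ _

/-- The hom-spaces: a disjoint union over `(ψ, κ)` of products of spaces of operations. -/
instance Hom.instTopologicalSpace (X Y : RingIndex) : TopologicalSpace (Hom X Y) :=
  induced (fun h : Hom X Y =>
    (⟨⟨h.ψ, h.κ⟩, h.f⟩ : Σ p : (Σ ψ : Fin X.m → Option (Fin Y.m),
      ∀ j, Smash X.a ψ j → Option (Fin (Y.a j))), ∀ j, isometriesOperad.Op (Fibre p.1 j)))
    inferInstance

instance (X Y : RingIndex) : TopologicalSpace (X ⟶ Y) := Hom.instTopologicalSpace X Y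

end RingIndex

/-! ## Categories over an operad and `ℒ`-permutative categories -/

instance Lex.instFinite (α : Type) [h : Finite α] : Finite (Lex α) := h

/-- Reindexing a dependent sum along a bijection of the base. -/
def lexSigmaCongrLeft {S S' : Type} (σ : S ≃ S') (T : S' → Type) :
    Lex (Σ s, T (σ s)) ≃ Lex (Σ s', T s') :=
  ofLex.trans ((Equiv.sigmaCongrLeft σ).trans toLex)

/-- The dependent sum of a family of bijections. -/
def lexSigmaCongrRight {S : Type} {T T' : S → Type} (σ : ∀ s, T s ≃ T' s) :
    Lex (Σ s, T s) ≃ Lex (Σ s, T' s) :=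
  ofLex.trans ((Equiv.sigmaCongrRight σ).trans toLex)

/-- The dependent product of a family of bijections. -/
def lexPiCongrRight {S : Type} {T T' : S → Type} (σ : ∀ s, T s ≃ T' s) :
    Lex (∀ s, T s) ≃ Lex (∀ s, T' s) :=
  ofLex.trans ((Equiv.piCongrRight σ).trans toLex)

/-- Reindexing a dependent product along a bijection `σ` of the base, `x ↦ x ∘ σ`. -/
def lexPiComp {S S' : Type} (σ : S ≃ S') (T : S' → Type) :
    Lex (∀ s', T s') ≃ Lex (∀ s, T (σ s)) :=
  ofLex.trans ((Equiv.piCongrLeft T σ).symm.trans toLex)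

/-- The (in general not monotone) distributivity bijection
`Π_s Σ_{t ∈ T s} R s t ≃ Σ_{x ∈ Π_s T s} Π_s R s (x s)`. -/
def lexDistrib {S : Type} {T : S → Type} (R : ∀ s, T s → Type) :
    Lex (∀ s, Lex (Σ t, R s t)) ≃ Lex (Σ x : Lex (∀ s, T s), Lex (∀ s, R s (ofLex x s))) where
  toFun y := toLex ⟨toLex fun s => (ofLex (ofLex y s)).1, toLex fun s => (ofLex (ofLex y s)).2⟩
  invFun p := toLex fun s => toLex ⟨ofLex (ofLex p).1 s, ofLex (ofLex p).2 s⟩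
  left_inv _ := rfl
  right_inv _ := rfl

/-- The structure of a category over the operad `G` on the topological category `A`.  Operations
are indexed by finite linearly ordered sets; everything is invariant under order isomorphisms, by
`τ_orderIso`, hence depends only on isomorphism classes of finite linearly ordered sets.  Strict
equalities are stated as equalities in the space of all morphisms of `A`. -/
structure OperadCategory (G : OperadData) (A : TopCategory.{u}) where
  /-- The functor `⊛_f : A ^ S ⥤ A`. -/
  op : ∀ {S : Type} [LinearOrder S] [Finite S], G.Op S → (S → A.Ob) ⥤ A.Ob
  /-- The equivariance isomorphism `⊛_{f·σ} (P_{σ s})_s ≅ ⊛_f (P_t)_t`. -/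
  τ : ∀ {S T : Type} [LinearOrder S] [Finite S] [LinearOrder T] [Finite T] (σ : S ≃ T)
    (f : G.Op T) (P : T → A.Ob), (op (G.act σ f)).obj (fun s => P (σ s)) ≅ (op f).obj P
  τ_naturality : ∀ {S T : Type} [LinearOrder S] [Finite S] [LinearOrder T] [Finite T] (σ : S ≃ T)
    (f : G.Op T) {P Q : T → A.Ob} (U : P ⟶ Q),
    (op (G.act σ f)).map (X := fun s => P (σ s)) (Y := fun s => Q (σ s)) (fun s => U (σ s)) ≫
      (τ σ f Q).hom = (τ σ f P).hom ≫ (op f).map U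
  /-- `⊛_{f⟨g⟩} = ⊛_f ⟨⊛_{g s}⟩` -/
  op_comp : ∀ {S : Type} {T : S → Type} [LinearOrder S] [Finite S] [∀ s, LinearOrder (T s)]
    [∀ s, Finite (T s)] (f : G.Op S) (g : ∀ s, G.Op (T s)) {P Q : ∀ s, T s → A.Ob} (U : P ⟶ Q),
    Arrow.mk ((op (G.comp f g)).map (X := fun x => P (ofLex x).1 (ofLex x).2)
        (Y := fun x => Q (ofLex x).1 (ofLex x).2) fun x => U (ofLex x).1 (ofLex x).2) =
      Arrow.mk ((op f).map (X := fun s => (op (g s)).obj (P s)) (Y := fun s => (op (g s)).obj (Q s))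
        fun s => (op (g s)).map (U s))
  /-- `⊛_id = id` -/
  op_one : ∀ {S : Type} [LinearOrder S] [Unique S] {P Q : S → A.Ob} (U : P ⟶ Q),
    Arrow.mk ((op (G.one S)).map U) = Arrow.mk (U default)
  /-- `τ^{σσ'} = τ^σ τ^{σ'}` -/
  τ_trans : ∀ {R S T : Type} [LinearOrder R] [Finite R] [LinearOrder S] [Finite S] [LinearOrder T]
    [Finite T] (σ' : R ≃ S) (σ : S ≃ T) (f : G.Op T) (P : T → A.Ob),
    Arrow.mk (τ (σ'.trans σ) f P).hom =
      Arrow.mk ((τ σ' (G.act σ f) fun s => P (σ s)).hom ≫ (τ σ f P).hom)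
  τ_orderIso : ∀ {S T : Type} [LinearOrder S] [Finite S] [LinearOrder T] [Finite T] (e : S ≃o T)
    (f : G.Op T) (P : T → A.Ob),
    Arrow.mk (τ e.toEquiv f P).hom = Arrow.mk (𝟙 ((op f).obj P))
  /-- Coherence of `τ` with `(f·σ)⟨g_{σ s}⟩ = f⟨g⟩·σ(T)`, a block permutation. -/
  τ_comp_left : ∀ {S S' : Type} {T : S' → Type} [LinearOrder S] [Finite S] [LinearOrder S']
    [Finite S'] [∀ s, LinearOrder (T s)] [∀ s, Finite (T s)] (σ : S ≃ S') (f : G.Op S')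
    (g : ∀ s, G.Op (T s)) (P : ∀ s, T s → A.Ob),
    Arrow.mk (τ (lexSigmaCongrLeft σ T) (G.comp f g) fun x => P (ofLex x).1 (ofLex x).2).hom =
      Arrow.mk (τ σ f fun s => (op (g s)).obj (P s)).hom
  /-- Coherence of `τ` with `f⟨g_s·σ_s⟩ = f⟨g⟩·Σσ_s`. -/
  τ_comp_right : ∀ {S : Type} {T T' : S → Type} [LinearOrder S] [Finite S]
    [∀ s, LinearOrder (T s)] [∀ s, Finite (T s)] [∀ s, LinearOrder (T' s)] [∀ s, Finite (T' s)]
    (σ : ∀ s, T s ≃ T' s) (f : G.Op S) (g : ∀ s, G.Op (T' s)) (P : ∀ s, T' s → A.Ob),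
    Arrow.mk (τ (lexSigmaCongrRight σ) (G.comp f g) fun x => P (ofLex x).1 (ofLex x).2).hom =
      Arrow.mk ((op f).map (X := fun s => (op (G.act (σ s) (g s))).obj fun t => P s (σ s t))
        (Y := fun s => (op (g s)).obj (P s)) fun s => (τ (σ s) (g s) (P s)).hom)
  continuous_obj : ∀ (S : Type) [LinearOrder S] [Finite S],
    KContinuous fun p : G.Op S × (S → A.Ob) => (op p.1).obj p.2
  continuous_map : ∀ (S : Type) [LinearOrder S] [Finite S],
    KContinuous fun p : G.Op S × (S → Arrow A.Ob) =>
      Arrow.mk ((op p.1).map (X := fun s => (p.2 s).left) (Y := fun s => (p.2 s).right)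
        fun s => (p.2 s).hom)
  continuous_τ : ∀ {S T : Type} [LinearOrder S] [Finite S] [LinearOrder T] [Finite T] (σ : S ≃ T),
    KContinuous fun p : G.Op T × (T → A.Ob) => Arrow.mk (τ σ p.1 p.2).hom

namespace OperadCategory

variable {A : TopCategory.{u}} (M : OperadCategory terminalOperad A)

/-- The sum functors `⊕_S : A ^ S ⥤ A` of a category over the terminal operad. -/
abbrev sum (S : Type) [LinearOrder S] [Finite S] : (S → A.Ob) ⥤ A.Ob :=
  M.op (PUnit.unit : terminalOperad.Op S)

/-- The symmetries `⊕_S (P_{σ s})_s ≅ ⊕_T (P_t)_t` of a category over the terminal operad. -/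
abbrev perm {S T : Type} [LinearOrder S] [Finite S] [LinearOrder T] [Finite T] (σ : S ≃ T)
    (P : T → A.Ob) : (M.sum S).obj (fun s => P (σ s)) ≅ (M.sum T).obj P :=
  M.τ σ (PUnit.unit : terminalOperad.Op T) P

lemma op_comp_obj {G : OperadData} (M : OperadCategory G A) {S : Type} {T : S → Type}
    [LinearOrder S] [Finite S] [∀ s, LinearOrder (T s)] [∀ s, Finite (T s)] (f : G.Op S)
    (g : ∀ s, G.Op (T s)) (P : ∀ s, T s → A.Ob) :
    (M.op (G.comp f g)).obj (fun x => P (ofLex x).1 (ofLex x).2) =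
      (M.op f).obj fun s => (M.op (g s)).obj (P s) :=
  congrArg (fun a : Arrow A.Ob => a.left) (M.op_comp f g (𝟙 P))

lemma op_one_obj {G : OperadData} (M : OperadCategory G A) {S : Type} [LinearOrder S] [Unique S]
    (P : S → A.Ob) : (M.op (G.one S)).obj P = P default :=
  congrArg (fun a : Arrow A.Ob => a.left) (M.op_one (𝟙 P))

end OperadCategory

/-- An `ℒ`-permutative category: a `(𝒞, ℒ)`-category for the terminal operad `𝒞` and the linear
isometries operad `ℒ`. -/
structure LPermutativeCategory : Type (u + 1) where
  A : TopCategory.{u}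
  isTopological : A.IsTopological
  add : OperadCategory terminalOperad A
  mul : OperadCategory isometriesOperad A
  /-- The distributivity transformation
  `⊗_f ⊕_{t ∈ T s} P s t ⟶ ⊕_{x ∈ Π_s T s} ⊗_f P s (x s)`. -/
  δ : ∀ {S : Type} {T : S → Type} [LinearOrder S] [Finite S] [∀ s, LinearOrder (T s)]
    [∀ s, Finite (T s)] (f : isometriesOperad.Op S) (P : ∀ s, T s → A.Ob),
    (mul.op f).obj (fun s => (add.sum (T s)).obj (P s)) ⟶
      (add.sum (Lex (∀ s, T s))).obj fun x => (mul.op f).obj fun s => P s (ofLex x s)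
  δ_naturality : ∀ {S : Type} {T : S → Type} [LinearOrder S] [Finite S] [∀ s, LinearOrder (T s)]
    [∀ s, Finite (T s)] (f : isometriesOperad.Op S) {P Q : ∀ s, T s → A.Ob}
    (U : ∀ s t, P s t ⟶ Q s t),
    (mul.op f).map (X := fun s => (add.sum (T s)).obj (P s))
        (Y := fun s => (add.sum (T s)).obj (Q s)) (fun s => (add.sum (T s)).map (U s)) ≫ δ f Q =
      δ f P ≫ (add.sum (Lex (∀ s, T s))).map
        (X := fun x => (mul.op f).obj fun s => P s (ofLex x s))
        (Y := fun x => (mul.op f).obj fun s => Q s (ofLex x s))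
        fun x => (mul.op f).map (X := fun s => P s (ofLex x s)) (Y := fun s => Q s (ofLex x s))
          fun s => U s (ofLex x s)
  continuous_δ : ∀ {S : Type} {T : S → Type} [LinearOrder S] [Finite S] [∀ s, LinearOrder (T s)]
    [∀ s, Finite (T s)],
    KContinuous fun p : isometriesOperad.Op S × (∀ s, T s → A.Ob) => Arrow.mk (δ p.1 p.2)
  /-- The empty sum is absorbing. -/
  absorbing : ∀ {S : Type} {T : S → Type} [LinearOrder S] [Finite S] [∀ s, LinearOrder (T s)]
    [∀ s, Finite (T s)] (f : isometriesOperad.Op S) {P Q : ∀ s, T s → A.Ob}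
    (U : ∀ s t, P s t ⟶ Q s t), (∃ s, IsEmpty (T s)) →
    Arrow.mk ((mul.op f).map (X := fun s => (add.sum (T s)).obj (P s))
        (Y := fun s => (add.sum (T s)).obj (Q s)) fun s => (add.sum (T s)).map (U s)) =
      Arrow.mk (𝟙 ((add.sum (Fin 0)).obj Fin.elim0))
  /-- Compatibility with permutations of the summands. -/
  δ_add_equivariant : ∀ {S : Type} {T T' : S → Type} [LinearOrder S] [Finite S]
    [∀ s, LinearOrder (T s)] [∀ s, Finite (T s)] [∀ s, LinearOrder (T' s)] [∀ s, Finite (T' s)]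
    (σ : ∀ s, T s ≃ T' s) (f : isometriesOperad.Op S) (P : ∀ s, T' s → A.Ob),
    (mul.op f).map (X := fun s => (add.sum (T s)).obj fun t => P s (σ s t))
        (Y := fun s => (add.sum (T' s)).obj (P s)) (fun s => (add.perm (σ s) (P s)).hom) ≫ δ f P =
      δ f (fun s t => P s (σ s t)) ≫
        (add.perm (lexPiCongrRight σ) fun x => (mul.op f).obj fun s => P s (ofLex x s)).hom
  /-- Compatibility with permutations of the factors. -/
  δ_mul_equivariant : ∀ {S S' : Type} {T : S' → Type} [LinearOrder S] [Finite S] [LinearOrder S']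
    [Finite S'] [∀ s, LinearOrder (T s)] [∀ s, Finite (T s)] (σ : S ≃ S')
    (f : isometriesOperad.Op S') (P : ∀ s, T s → A.Ob),
    (mul.τ σ f fun s => (add.sum (T s)).obj (P s)).hom ≫ δ f P =
      δ (isometriesOperad.act σ f) (fun s => P (σ s)) ≫
        (add.perm (lexPiComp σ T) fun x =>
          (mul.op (isometriesOperad.act σ f)).obj fun s => P (σ s) (ofLex x s)).inv ≫
        (add.sum (Lex (∀ s, T s))).map
          (X := fun x => (mul.op (isometriesOperad.act σ f)).obj fun s => P (σ s) (ofLex x (σ s)))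
          (Y := fun x => (mul.op f).obj fun s => P s (ofLex x s))
          fun x => (mul.τ σ f fun s => P s (ofLex x s)).hom
  /-- Compatibility with composition of the sums. -/
  δ_add_comp : ∀ {S : Type} {T : S → Type} {R : ∀ s, T s → Type} [LinearOrder S] [Finite S]
    [∀ s, LinearOrder (T s)] [∀ s, Finite (T s)] [∀ s t, LinearOrder (R s t)]
    [∀ s t, Finite (R s t)] (f : isometriesOperad.Op S) (P : ∀ s t, R s t → A.Ob),
    Arrow.mk (δ f (fun s (x : Lex (Σ t, R s t)) => P s (ofLex x).1 (ofLex x).2) ≫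
        (add.perm (lexDistrib R) fun y => (mul.op f).obj fun s =>
          P s (ofLex (ofLex y).1 s) (ofLex (ofLex y).2 s)).hom) =
      Arrow.mk (δ f (fun s t => (add.sum (R s t)).obj (P s t)) ≫
        (add.sum (Lex (∀ s, T s))).map
          (X := fun x => (mul.op f).obj fun s => (add.sum (R s (ofLex x s))).obj (P s (ofLex x s)))
          (Y := fun x => (add.sum (Lex (∀ s, R s (ofLex x s)))).obj fun y =>
            (mul.op f).obj fun s => P s (ofLex x s) (ofLex y s))
          fun x => δ f fun s => P s (ofLex x s))
  /-- Compatibility with composition of the products. -/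
  δ_mul_comp : ∀ {S : Type} {T : S → Type} {R : ∀ s, T s → Type} [LinearOrder S] [Finite S]
    [∀ s, LinearOrder (T s)] [∀ s, Finite (T s)] [∀ s t, LinearOrder (R s t)]
    [∀ s t, Finite (R s t)] (f : isometriesOperad.Op S) (g : ∀ s, isometriesOperad.Op (T s))
    (P : ∀ s t, R s t → A.Ob),
    Arrow.mk (δ (isometriesOperad.comp f g)
        fun (x : Lex (Σ s, T s)) (r : R (ofLex x).1 (ofLex x).2) => P (ofLex x).1 (ofLex x).2 r) =
      Arrow.mk ((mul.op f).map
          (X := fun s => (mul.op (g s)).obj fun t => (add.sum (R s t)).obj (P s t))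
          (Y := fun s => (add.sum (Lex (∀ t, R s t))).obj fun y =>
            (mul.op (g s)).obj fun t => P s t (ofLex y t))
          (fun s => δ (g s) (P s)) ≫
        δ f fun s (y : Lex (∀ t, R s t)) => (mul.op (g s)).obj fun t => P s t (ofLex y t))
  /-- `δ` is the identity for the product of a single factor. -/
  δ_mul_one : ∀ {S : Type} {T : S → Type} [LinearOrder S] [Unique S] [∀ s, LinearOrder (T s)]
    [∀ s, Finite (T s)] (P : ∀ s, T s → A.Ob),
    Arrow.mk (δ (isometriesOperad.one S) P) = Arrow.mk (𝟙 ((add.sum (T default)).obj (P default)))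
  /-- `δ` is the identity for sums with a single summand. -/
  δ_add_one : ∀ {S : Type} {T : S → Type} [LinearOrder S] [Finite S] [∀ s, LinearOrder (T s)]
    [∀ s, Unique (T s)] (f : isometriesOperad.Op S) (P : ∀ s, T s → A.Ob),
    Arrow.mk (δ f P) = Arrow.mk (𝟙 ((mul.op f).obj fun s => P s default))

/-! ## Lax functors and Street's rectification -/

/-- The data of a lax functor from a category `J` to categories. -/
structure LaxData (J : Type) [SmallCategory J] where
  obj : J → TopCategory.{u}
  map : ∀ {X Y : J}, (X ⟶ Y) → (obj X).Ob ⥤ (obj Y).Ob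
  /-- `ω : F h₂ ∘ F h₁ ⟶ F (h₂ ∘ h₁)` -/
  mapComp : ∀ {X Y Z : J} (h₁ : X ⟶ Y) (h₂ : Y ⟶ Z) (P : (obj X).Ob),
    (map h₂).obj ((map h₁).obj P) ⟶ (map (h₁ ≫ h₂)).obj P
  /-- `ω : id ⟶ F id` -/
  mapId : ∀ (X : J) (P : (obj X).Ob), P ⟶ (map (𝟙 X)).obj P

/-- The axioms of a lax functor: the `ω` are natural and coherent. -/
structure LaxData.IsLax {J : Type} [SmallCategory J] (F : LaxData.{u} J) : Prop where
  mapComp_naturality : ∀ {X Y Z : J} (h₁ : X ⟶ Y) (h₂ : Y ⟶ Z) {P Q : (F.obj X).Ob} (U : P ⟶ Q),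
    (F.map h₂).map ((F.map h₁).map U) ≫ F.mapComp h₁ h₂ Q =
      F.mapComp h₁ h₂ P ≫ (F.map (h₁ ≫ h₂)).map U
  mapId_naturality : ∀ (X : J) {P Q : (F.obj X).Ob} (U : P ⟶ Q),
    U ≫ F.mapId X Q = F.mapId X P ≫ (F.map (𝟙 X)).map U
  assoc : ∀ {W X Y Z : J} (h₁ : W ⟶ X) (h₂ : X ⟶ Y) (h₃ : Y ⟶ Z) (P : (F.obj W).Ob),
    (F.map h₃).map (F.mapComp h₁ h₂ P) ≫ F.mapComp (h₁ ≫ h₂) h₃ P =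
      F.mapComp h₂ h₃ ((F.map h₁).obj P) ≫ F.mapComp h₁ (h₂ ≫ h₃) P ≫
        eqToHom (by rw [Category.assoc])
  id_left : ∀ {X Y : J} (h : X ⟶ Y) (P : (F.obj X).Ob),
    F.mapId Y ((F.map h).obj P) ≫ F.mapComp h (𝟙 Y) P = eqToHom (by rw [Category.comp_id])
  id_right : ∀ {X Y : J} (h : X ⟶ Y) (P : (F.obj X).Ob),
    (F.map h).map (F.mapId X P) ≫ F.mapComp (𝟙 X) h P = eqToHom (by rw [Category.id_comp])

namespace LaxData

variable {J : Type} [SmallCategory J] (F : LaxData.{u} J)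

/-- Objects `(φ, P)` of the rectification at `X`: a morphism `φ : Y ⟶ X` and an object `P` of
`F Y`. -/
structure StreetOb (X : J) : Type u where
  Y : J
  φ : Y ⟶ X
  P : (F.obj Y).Ob

/-- Morphisms `(ψ, U)` of the rectification at `X`, from `(φ, P)` to `(φ', P')`: a morphism
`ψ : φ' ⟶ φ` over `X` and a morphism `U : P ⟶ F ψ P'`. -/
@[ext]
structure StreetHom {X : J} (a b : F.StreetOb X) : Type u where
  ψ : b.Y ⟶ a.Y
  w : ψ ≫ a.φ = b.φ
  U : a.P ⟶ (F.map ψ).obj b.P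

variable {F}

lemma eqToHom_map_obj {X Y : J} {h h' : X ⟶ Y} (e : h = h') (P : (F.obj X).Ob) :
    (F.map h).obj P = (F.map h').obj P := by rw [e]

lemma StreetHom.ext' {X : J} {a b : F.StreetOb X} {g g' : F.StreetHom a b} (e : g.ψ = g'.ψ)
    (h : g.U ≫ eqToHom (eqToHom_map_obj e b.P) = g'.U) : g = g' := by
  obtain ⟨ψ, w, U⟩ := g
  obtain ⟨ψ', w', U'⟩ := g'
  obtain rfl : ψ = ψ' := e
  simp only [eqToHom_refl, Category.comp_id] at h
  rw [h]

lemma mapComp_congr {X Y Z : J} (h₁ : X ⟶ Y) {h₂ h₂' : Y ⟶ Z} (e : h₂ = h₂') (P : (F.obj X).Ob) :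
    F.mapComp h₁ h₂ P ≫ eqToHom (eqToHom_map_obj (by rw [e]) P) =
      eqToHom (eqToHom_map_obj e _) ≫ F.mapComp h₁ h₂' P := by
  subst e
  simp

/-- The category `F̄ X`. -/
@[reducible]
def streetCategory (hF : F.IsLax) (X : J) : SmallCategory (F.StreetOb X) where
  Hom := F.StreetHom
  id a := ⟨𝟙 a.Y, Category.id_comp _, F.mapId a.Y a.P⟩
  comp {_ _ c} g₁ g₂ := ⟨g₂.ψ ≫ g₁.ψ, by rw [Category.assoc, g₁.w, g₂.w],
    g₁.U ≫ (F.map g₁.ψ).map g₂.U ≫ F.mapComp g₂.ψ g₁.ψ c.P⟩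
  id_comp {a b} g := by
    refine StreetHom.ext' (Category.comp_id _) ?_
    simp only [Category.assoc]
    have := hF.id_left g.ψ b.P
    rw [← Category.assoc (F.mapId _ _), ← hF.mapId_naturality, Category.assoc, reassoc_of% this]
    simp
  comp_id {a b} g := by
    refine StreetHom.ext' (Category.id_comp _) ?_
    simp only [Category.assoc]
    have := hF.id_right g.ψ b.P
    rw [reassoc_of% this]
    simp
  assoc {a b c d} g₁ g₂ g₃ := by
    refine StreetHom.ext' (Category.assoc _ _ _).symm ?_
    simp only [Category.assoc, Functor.map_comp]
    have h₁ := hF.assoc g₃.ψ g₂.ψ g₁.ψ d.P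
    have h₂ := hF.mapComp_naturality g₂.ψ g₁.ψ g₃.U
    rw [h₁, reassoc_of% h₂]

/-- The topology on the objects of `F̄ X`, as a disjoint union over `Y` of the products
`J(Y, X) × Ob (F Y)`. -/
instance StreetOb.instTopologicalSpace [∀ X Y : J, TopologicalSpace (X ⟶ Y)] (X : J) :
    TopologicalSpace (F.StreetOb X) :=
  @compactlyGenerated.{u} (F.StreetOb X) (induced
    (fun a => (⟨a.Y, (a.φ, a.P)⟩ : Σ Y : J, (Y ⟶ X) × (F.obj Y).Ob)) inferInstance)

/-- The topological category `F̄ X`.  A morphism is determined by `(φ, ψ, P', U)`, and the space of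
morphisms is topologized as a disjoint union of subspaces of the products
`J(Y, X) × J(Y', Y) × Ob (F Y') × Mor (F Y)`. -/
def street (hF : F.IsLax) [∀ X Y : J, TopologicalSpace (X ⟶ Y)] (X : J) : TopCategory.{u} where
  Ob := F.StreetOb X
  cat := streetCategory hF X
  topMor :=
    letI := streetCategory hF X
    @compactlyGenerated.{u} (Arrow (F.StreetOb X)) (induced
      (fun g : Arrow (F.StreetOb X) =>
        let h : F.StreetHom g.left g.right := g.hom
        (⟨(g.left.Y, g.right.Y), (g.left.φ, h.ψ, g.right.P, Arrow.mk h.U)⟩ :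
          Σ p : J × J, (p.1 ⟶ X) × (p.2 ⟶ p.1) × (F.obj p.2).Ob × Arrow (F.obj p.1).Ob))
      inferInstance)

/-- The functor `F̄ χ : F̄ X ⥤ F̄ X'`, `(φ, P) ↦ (χφ, P)`, `(ψ, U) ↦ (ψ, U)`. -/
def streetMap (hF : F.IsLax) [∀ X Y : J, TopologicalSpace (X ⟶ Y)] {X X' : J} (χ : X ⟶ X') :
    (street hF X).Ob ⥤ (street hF X').Ob where
  obj a := (⟨a.Y, a.φ ≫ χ, a.P⟩ : F.StreetOb X')
  map {a b} g :=
    let h : F.StreetHom a b := g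
    (⟨h.ψ, by rw [← h.w, Category.assoc], h.U⟩ :
      F.StreetHom ⟨a.Y, a.φ ≫ χ, a.P⟩ ⟨b.Y, b.φ ≫ χ, b.P⟩)

end LaxData

/-! ## Special `ℒ̂ ≀ ℱ`-spaces -/

/-- The data of a diagram of spaces on `J`. -/
structure SpaceDiagram (J : Type) [SmallCategory J] where
  obj : J → Type u
  [top : ∀ X, TopologicalSpace (obj X)]
  map : ∀ {X Y : J}, (X ⟶ Y) → obj X → obj Y

attribute [instance] SpaceDiagram.top

/-- `Z` is a continuous functor from the topologically enriched category `J` to compactly generated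
weak Hausdorff spaces. -/
structure SpaceDiagram.IsContinuousFunctor {J : Type} [SmallCategory J]
    [∀ X Y : J, TopologicalSpace (X ⟶ Y)] (Z : SpaceDiagram.{u} J) : Prop where
  cgwh : ∀ X, CGWHSpace (Z.obj X)
  map_id : ∀ X z, Z.map (𝟙 X) z = z
  map_comp : ∀ {X Y W : J} (h₁ : X ⟶ Y) (h₂ : Y ⟶ W) z, Z.map (h₁ ≫ h₂) z = Z.map h₂ (Z.map h₁ z)
  continuous_map : ∀ X Y : J, KContinuous fun p : (X ⟶ Y) × Z.obj X => Z.map p.1 p.2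

/-- The diagram `|F̄|` of the geometric realizations of the rectification of a lax functor. -/
def LaxData.classifyingDiagram {J : Type} [SmallCategory J] [∀ X Y : J, TopologicalSpace (X ⟶ Y)]
    {F : LaxData.{u} J} (hF : F.IsLax) : SpaceDiagram.{u} J where
  obj X := (LaxData.street hF X).Realization
  map χ := TopCategory.realizationMap (LaxData.streetMap hF χ)

namespace RingIndex

/-- The object `(1_*, a_*)`. -/
abbrev single (a : ℕ) : RingIndex := ⟨1, fun _ => a⟩

/-- The object `(0_*, *)`. -/
abbrev empty : RingIndex := ⟨0, Fin.elim0⟩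

/-- The based map `δ_i : m_* → 1_*` with `δ_i⁻¹(1) = {i}`. -/
def delta {m : ℕ} (i : Fin m) : Fin m → Option (Fin 1) := fun i' => if i' = i then some 0 else none

lemma delta_self {m : ℕ} (i : Fin m) (j : Fin 1) : delta i i = some j := by
  rw [delta, if_pos rfl, Subsingleton.elim j 0]

lemma eq_of_delta {m : ℕ} {i i' : Fin m} {j : Fin 1} (h : delta i i' = some j) : i' = i := by
  by_contra hne
  rw [delta, if_neg hne] at h
  exact Option.some_ne_none j h.symm

/-- The morphism `(η δ_i, id) : (m_*, ⟨a^i_*⟩) ⟶ (1_*, a^i_*)`. -/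
def proj (X : RingIndex) (i : Fin X.m) : X ⟶ single (X.a i) where
  ψ := delta i
  f j :=
    haveI : Unique (Fibre (delta i) j) :=
      ⟨⟨⟨i, delta_self i j⟩⟩, fun i' => Subtype.ext (eq_of_delta i'.2)⟩
    isometriesOperad.one _
  κ j x := some (x ⟨i, delta_self i j⟩)

/-- The morphism `(id, δ_x) : (1_*, a_*) ⟶ (1_*, 1_*)`. -/
def addProj (a : ℕ) (x : Fin a) : single a ⟶ single 1 where
  ψ := some
  f := (Hom.id (single a)).f
  κ j y := delta x (y ⟨j, rfl⟩)

end RingIndex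

/-- The conditions for a diagram of spaces on `ℒ̂ ≀ ℱ` to be special. Products of spaces carry the
product topology of compactly generated spaces. -/
structure IsSpecial (Z : SpaceDiagram.{u} RingIndex) : Prop where
  contractible_empty : ContractibleSpace (Z.obj RingIndex.empty)
  mul_equivalence : ∀ X : RingIndex, IsHomotopyEquivalence
    (Y := KSpace (∀ i : Fin X.m, Z.obj (RingIndex.single (X.a i))))
    fun z i => Z.map (X.proj i) z
  contractible_zero : ContractibleSpace (Z.obj (RingIndex.single 0))
  add_equivalence : ∀ a : ℕ, IsHomotopyEquivalence
    (Y := KSpace (Fin a → Z.obj (RingIndex.single 1)))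
    fun z x => Z.map (RingIndex.addProj a x) z

/-! ## The lax functor of an `ℒ`-permutative category -/

namespace LPermutativeCategory

open RingIndex

variable (C : LPermutativeCategory.{u})

/-- The index set `Σ_i a^i` of the factors of `ℱC(m_*, ⟨a^i_*⟩)`. -/
abbrev Index (X : RingIndex) : Type := Σ i : Fin X.m, Fin (X.a i)

/-- The preimage `(κ^j)⁻¹(x)` with the order induced from the lexicographic order. -/
abbrev Preimage {X Y : RingIndex} (h : Hom X Y) (p : Index Y) : Type :=
  {x : Lex (Smash X.a h.ψ p.1) // h.κ p.1 (ofLex x) = some p.2}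

/-- The functor `ℱC(f̂, ⟨κ^j⟩)`, `P ↦ ⟨⊕_{x ∈ (κ^j)⁻¹(y)} ⊗_{f^j} P_{i, x_i}⟩_{(j, y)}`. -/
def laxMap {X Y : RingIndex} (h : X ⟶ Y) : (Index X → C.A.Ob) ⥤ (Index Y → C.A.Ob) where
  obj P p := (C.add.sum (Preimage h p)).obj fun x => (C.mul.op (h.f p.1)).obj fun i =>
    P ⟨i.1, ofLex x.1 i⟩
  map {P Q} U p := (C.add.sum (Preimage h p)).map
    (X := fun x => (C.mul.op (h.f p.1)).obj fun i => P ⟨i.1, ofLex x.1 i⟩)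
    (Y := fun x => (C.mul.op (h.f p.1)).obj fun i => Q ⟨i.1, ofLex x.1 i⟩)
    fun x => (C.mul.op (h.f p.1)).map (X := fun i => P ⟨i.1, ofLex x.1 i⟩)
      (Y := fun i => Q ⟨i.1, ofLex x.1 i⟩) fun i => U ⟨i.1, ofLex x.1 i⟩
  map_id P := by
    funext p
    exact (congrArg _ (funext fun x => (C.mul.op (h.f p.1)).map_id _)).trans
      ((C.add.sum (Preimage h p)).map_id _)
  map_comp U V := by
    funext p
    exact (congrArg _ (funext fun x => (C.mul.op (h.f p.1)).map_comp _ _)).trans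
      ((C.add.sum (Preimage h p)).map_comp _ _)

/-- The index set `Σ_{y ∈ (κ₂^k)⁻¹(z)} Π_j (κ₁^j)⁻¹(y_j)`. -/
abbrev DoublePreimage {X Y Z : RingIndex} (h₁ : Hom X Y) (h₂ : Hom Y Z) (p : Index Z) : Type :=
  Lex (Σ y : Preimage h₂ p, Lex (∀ j : Fibre h₂.ψ p.1, Preimage h₁ ⟨j.1, ofLex y.1 j⟩))

/-- The point of `⋀_{i ∈ (ψ₂ψ₁)⁻¹(k)} a^i` that a family of points of the `⋀_{i ∈ ψ₁⁻¹(j)} a^i`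
determines. -/
def assemble {X Y Z : RingIndex} {h₁ : Hom X Y} {h₂ : Hom Y Z} {p : Index Z}
    (d : DoublePreimage h₁ h₂ p) : Lex (Smash X.a (h₁.comp h₂).ψ p.1) :=
  toLex fun i => ofLex (ofLex (ofLex d).2 (ofLex (fibreEquiv h₁.ψ h₂.ψ p.1 i)).1).1
    (ofLex (fibreEquiv h₁.ψ h₂.ψ p.1 i)).2

lemma assemble_fibreIncl {X Y Z : RingIndex} {h₁ : Hom X Y} {h₂ : Hom Y Z} {p : Index Z}
    (d : DoublePreimage h₁ h₂ p) (j : Fibre h₂.ψ p.1) (i : Fibre h₁.ψ j) :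
    ofLex (assemble d) (fibreIncl j i) = ofLex (ofLex (ofLex d).2 j).1 i := by
  have key : ∀ q : Σ j : Fibre h₂.ψ p.1, Fibre h₁.ψ j, (e : q = ⟨j, i⟩) →
      (ofLex (ofLex (ofLex d).2 q.1).1 q.2).1 = (ofLex (ofLex (ofLex d).2 j).1 i).1 := by
    rintro _ rfl
    rfl
  exact Fin.ext (key _ (sigma_fibre_ext rfl))

/-- The bijection `Σ_{y ∈ (κ₂^k)⁻¹(z)} Π_j (κ₁^j)⁻¹(y_j) ≃ (κ₂ ∘ ⋀ κ₁ ∘ σ)⁻¹(z)`. -/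
def preimageEquiv {X Y Z : RingIndex} (h₁ : Hom X Y) (h₂ : Hom Y Z) (p : Index Z) :
    DoublePreimage h₁ h₂ p ≃ Preimage (h₁.comp h₂) p :=
  Equiv.ofBijective (fun d => ⟨assemble d, (comp_κ_eq_some h₁ h₂ p.1 _ _).2
    ⟨ofLex (ofLex d).1.1, fun j => by
      rw [← (ofLex (ofLex d).2 j).2]
      congr 1
      funext i
      exact assemble_fibreIncl d j i, (ofLex d).1.2⟩⟩) (by
    constructor
    · intro d d' h
      have h' : assemble d = assemble d' := congrArg Subtype.val h
      have hx : ∀ j i, ofLex (ofLex (ofLex d).2 j).1 i = ofLex (ofLex (ofLex d').2 j).1 i := by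
        intro j i
        rw [← assemble_fibreIncl, ← assemble_fibreIncl, h']
      obtain ⟨⟨y, hy⟩, x⟩ := d
      obtain ⟨⟨y', hy'⟩, x'⟩ := d'
      obtain rfl : y = y' := by
        funext j
        refine Option.some_injective _ ((x j).2.symm.trans (Eq.trans ?_ (x' j).2))
        congr 1
        funext i
        exact hx j i
      obtain rfl : x = x' := by
        funext j
        refine Subtype.ext (funext fun i => ?_)
        exact hx j i
      rfl
    · rintro ⟨z, hz⟩
      obtain ⟨y, hy, hyp⟩ := (comp_κ_eq_some h₁ h₂ p.1 _ _).1 hz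
      refine ⟨toLex ⟨⟨toLex y, hyp⟩, toLex fun j =>
        ⟨toLex fun i => ofLex z (fibreIncl j i), hy j⟩⟩, ?_⟩
      rfl)

/-- The lax structure `ω` of `ℱC`, at the factor `p`: distribute, identify iterated sums and
products with sums and products over dependent sums, and permute first the factors and then the
summands. -/
def laxComp {X Y Z : RingIndex} (h₁ : X ⟶ Y) (h₂ : Y ⟶ Z) (P : Index X → C.A.Ob) (p : Index Z) :
    (C.laxMap h₂).obj ((C.laxMap h₁).obj P) p ⟶ (C.laxMap (h₁ ≫ h₂)).obj P p :=
  (C.add.sum (Preimage h₂ p)).map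
    (X := fun y => (C.mul.op (h₂.f p.1)).obj fun j =>
      (C.add.sum (Preimage h₁ ⟨j.1, ofLex y.1 j⟩)).obj fun x =>
        (C.mul.op (h₁.f j.1)).obj fun i => P ⟨i.1, ofLex x.1 i⟩)
    (Y := fun y => (C.add.sum (Lex (∀ j : Fibre h₂.ψ p.1, Preimage h₁ ⟨j.1, ofLex y.1 j⟩))).obj
      fun x => (C.mul.op (h₂.f p.1)).obj fun j =>
        (C.mul.op (h₁.f j.1)).obj fun i => P ⟨i.1, ofLex (ofLex x j).1 i⟩)
    (fun y => C.δ (h₂.f p.1) fun (j : Fibre h₂.ψ p.1)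
        (x : Preimage h₁ ⟨j.1, ofLex y.1 j⟩) =>
      (C.mul.op (h₁.f j.1)).obj fun i => P ⟨i.1, ofLex x.1 i⟩) ≫
  eqToHom (by
    have e := C.add.op_comp_obj (G := terminalOperad) (S := Preimage h₂ p) (T := fun y =>
      Lex (∀ j : Fibre h₂.ψ p.1, Preimage h₁ ⟨j.1, ofLex y.1 j⟩)) PUnit.unit
      (fun _ => PUnit.unit) fun y x => (C.mul.op (h₂.f p.1)).obj fun j =>
        (C.mul.op (h₁.f j.1)).obj fun i => P ⟨i.1, ofLex (ofLex x j).1 i⟩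
    refine e.symm.trans (congrArg _ (funext fun d => ?_))
    exact (C.mul.op_comp_obj (h₂.f p.1) (fun j => h₁.f j.1) fun j i =>
      P ⟨i.1, ofLex (ofLex (ofLex d).2 j).1 i⟩).symm) ≫
  (C.add.sum (DoublePreimage h₁ h₂ p)).map
    (X := fun d => (C.mul.op (isometriesOperad.comp (h₂.f p.1) fun j => h₁.f j.1)).obj fun q =>
      P ⟨(ofLex q).2.1, ofLex (ofLex (ofLex d).2 (ofLex q).1).1 (ofLex q).2⟩)
    (Y := fun d => (C.mul.op ((Hom.comp h₁ h₂).f p.1)).obj fun i =>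
      P ⟨i.1, ofLex (assemble d) i⟩)
    (fun d => (C.mul.τ (fibreEquiv h₁.ψ h₂.ψ p.1)
      (isometriesOperad.comp (h₂.f p.1) fun j => h₁.f j.1) fun q =>
        P ⟨(ofLex q).2.1, ofLex (ofLex (ofLex d).2 (ofLex q).1).1 (ofLex q).2⟩).inv) ≫
  (C.add.perm (preimageEquiv h₁ h₂ p) fun z => (C.mul.op ((Hom.comp h₁ h₂).f p.1)).obj fun i =>
    P ⟨i.1, ofLex z.1 i⟩).hom

lemma laxMap_id_obj (X : RingIndex) (P : Index X → C.A.Ob) (p : Index X) :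
    P p = (C.laxMap (𝟙 X)).obj P p := by
  obtain ⟨j, a⟩ := p
  let _ : Unique (Fibre (some : Fin X.m → _) j) :=
    ⟨⟨⟨j, rfl⟩⟩, fun i => Subtype.ext (Option.some_injective _ i.2)⟩
  let _ : Unique (Preimage (Hom.id X) ⟨j, a⟩) :=
    ⟨⟨⟨toLex fun i => Fin.cast (congrArg X.a (Option.some_injective _ i.2).symm) a, rfl⟩⟩, by
      rintro ⟨x, hx⟩
      refine Subtype.ext (funext fun i => ?_)
      obtain rfl : i = ⟨j, rfl⟩ := Subtype.ext (Option.some_injective _ i.2)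
      exact Option.some_injective _ hx⟩
  refine Eq.trans ?_ (C.add.op_one_obj (S := Preimage (Hom.id X) ⟨j, a⟩) _).symm
  exact (C.mul.op_one_obj (S := Fibre (some : Fin X.m → _) j) fun i =>
    P ⟨i.1, Fin.cast (congrArg X.a (Option.some_injective _ i.2).symm) a⟩).symm

/-- The lax functor `ℱC` on `ℒ̂ ≀ ℱ`: it sends `(m_*, ⟨a^i_*⟩)` to `C ^ (Σ_i a^i)`. -/
def laxData : LaxData.{u} RingIndex where
  obj X := C.A.pow (Index X)
  map h := C.laxMap h
  mapComp h₁ h₂ P := fun p => C.laxComp h₁ h₂ P p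
  mapId X P := fun p => eqToHom (C.laxMap_id_obj X P p)

end LPermutativeCategory

end

/-! Algebra. The constraint `ω` first distributes a sum of products of sums of products (`expand`)
and then renames summands and factors (`relabel`). Symmetries of order isomorphisms are identities,
so only non-monotone bijections matter. Associativity of `ω` thus splits into associativity of
expansion (`expand_assoc`, from `δ_add_comp` and `δ_mul_comp`), three squares that move relabellings
across an expansion (`expand_relabel_inner`, `expand_relabel_factors`, `expand_relabel_summands`),
and an equality of bijections of index sets. In the unit laws every `δ` belongs to one factor or to
one summand, hence is an identity, and every bijection is monotone.

Homotopy. The functors `(φ, P) ↦ F φ P` and `P ↦ (id, P)` between `F̄ X` and `F X` are related by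
natural transformations, namely the unit constraint and the arrows `(φ, id)`, so they induce inverse
homotopy equivalences of realizations (`isHomotopyEquivalence_evaluation`). If `π` only selects
factors, every `ω` with `π` as its outer morphism is an identity (`Pure.laxComp_same`), so
evaluation commutes strictly with `π` (`evaluation_naturality`), and `ℱC(π)` is a coordinate
projection of powers of `C`. The special maps are therefore equivalent to the comparison of the
realization of a finite product of topological categories with the product of the realizations,
which is a homeomorphism (`exists_homeomorph_prod`). The empty power gives the contractible cases.

Topology. Continuity is tested on maps from compact Hausdorff spaces, and weak Hausdorff separation
is used in the form `KT2`. A test map into a space of isometries is a family whose values on each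
basis vector lie in a fixed finite-dimensional space and have continuous coordinates
(`LinIsom.continuous_iff_tame`). A point of a realization is viewed as a piecewise constant functor
on `[0, 1)` (`Realization.ev`): this functor determines the point, and finitely many points have a
common subdivision. From this follow separation, maps out of products, and homotopies from natural
transformations, all without choosing a triangulation of a product of simplices. -/

open CategoryTheory TopologicalSpace
open scoped Topology

noncomputable section

/-! ### Compactly generated topologies through test maps -/

section KTopology

universe w w'

lemma compactlyGenerated_le (X : Type w) [t : TopologicalSpace X] :
    compactlyGenerated.{u} X ≤ t := by
  simp only [compactlyGenerated, ← continuous_iff_coinduced_le, continuous_sigma_iff, Sigma.forall]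
  exact fun S f => f.2

/-- The refined topology is final for all continuous maps from compact Hausdorff spaces, and `p` is
one of them. Refining a topology therefore does not change its test maps. -/
lemma continuous_to_compactlyGenerated {X : Type w} [TopologicalSpace X] {K : Type u}
    [tK : TopologicalSpace K] [CompactSpace K] [T2Space K] {p : K → X} :
    Continuous[tK, compactlyGenerated.{u} X] p ↔ Continuous p := by
  refine ⟨fun h => continuous_le_rng (compactlyGenerated_le X) h, fun hp => ?_⟩
  refine continuous_def.2 fun s hs => ?_
  rw [TopologicalSpace.compactlyGenerated, isOpen_coinduced, isOpen_sigma_iff] at hs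
  exact hs ⟨CompHaus.of K, ⟨p, hp⟩⟩

lemma continuous_compactlyGenerated_dom {X : Type w} {Y : Type w'} [TopologicalSpace X]
    [t : TopologicalSpace Y] {f : X → Y} :
    Continuous[compactlyGenerated.{u} X, t] f ↔
      ∀ (K : Type u) [TopologicalSpace K] [CompactSpace K] [T2Space K] (p : K → X),
        Continuous p → Continuous fun k => f (p k) :=
  ⟨fun h _ _ _ _ _ hp => @Continuous.comp _ _ _ _ (compactlyGenerated.{u} X) _ _ _ h
      (continuous_to_compactlyGenerated.2 hp),
    fun h => continuous_from_compactlyGenerated f fun S g => h S g g.2⟩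

lemma kContinuous_iff {X : Type u} {Y : Type w'} [TopologicalSpace X] [TopologicalSpace Y]
    {f : X → Y} : KContinuous f ↔
      ∀ (K : Type u) [TopologicalSpace K] [CompactSpace K] [T2Space K] (p : K → X),
        Continuous p → Continuous fun k => f (p k) :=
  continuous_compactlyGenerated_dom

lemma KContinuous.comp_test {X : Type u} {Y : Type w'} [TopologicalSpace X] [TopologicalSpace Y]
    {f : X → Y} (hf : KContinuous f) {K : Type u} [TopologicalSpace K] [CompactSpace K] [T2Space K]
    {p : K → X} (hp : Continuous p) : Continuous fun k => f (p k) :=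
  kContinuous_iff.1 hf K p hp

/-- On a compactly generated space continuity is detected by test maps. -/
lemma continuous_of_test {X : Type w} {Y : Type w'} [TopologicalSpace X] [TopologicalSpace Y]
    [UCompactlyGeneratedSpace.{u} X] {f : X → Y}
    (h : ∀ (K : Type u) [TopologicalSpace K] [CompactSpace K] [T2Space K] (p : K → X),
        Continuous p → Continuous fun k => f (p k)) : Continuous f :=
  continuous_from_uCompactlyGeneratedSpace f fun S g => h S g g.2

lemma continuous_to_kSpace {X : Type u} [tX : TopologicalSpace X] {K : Type u}
    [tK : TopologicalSpace K] [CompactSpace K] [T2Space K] {p : K → X} :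
    @Continuous K (KSpace X) tK (KSpace.instTopologicalSpace X) p ↔ @Continuous K X tK tX p :=
  @continuous_to_compactlyGenerated X tX K tK _ _ p

instance (X : Type u) [TopologicalSpace X] : CompactlyGeneratedSpace (KSpace X) := by
  refine compactlyGeneratedSpace_of_isOpen fun s hs => ?_
  refine isOpen_coinduced.2 (isOpen_sigma_iff.2 fun i => ?_)
  exact hs i.1 (fun k => i.2 k) (continuous_to_kSpace.2 i.2.2)

lemma compactlyGeneratedSpace_compactlyGenerated (X : Type u) [TopologicalSpace X] :
    @CompactlyGeneratedSpace X (compactlyGenerated.{u} X) :=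
  inferInstanceAs (CompactlyGeneratedSpace (KSpace X))

/-- Coincidence sets of test maps are closed. -/
structure KT2 (X : Type w) [TopologicalSpace X] : Prop where
  isClosed_eq : ∀ (K : Type u) [TopologicalSpace K] [CompactSpace K] [T2Space K] (p q : K → X),
    Continuous p → Continuous q → IsClosed {k | p k = q k}

/-- This is the advantage over closedness of images: the condition on coincidence sets pulls back
along every continuous injection, whatever the topology of the source. -/
lemma kT2_of_injective {X : Type w} {Y : Type w'} [TopologicalSpace X] [TopologicalSpace Y]
    (hY : KT2.{u} Y) {f : X → Y} (hf : Continuous f) (hi : Function.Injective f) : KT2.{u} X where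
  isClosed_eq K _ _ _ p q hp hq := by
    simpa only [hi.eq_iff, Function.comp_apply] using
      hY.isClosed_eq K (f ∘ p) (f ∘ q) (hf.comp hp) (hf.comp hq)

lemma kT2_compactlyGenerated {X : Type w} [t : TopologicalSpace X] (h : KT2.{u} X) :
    @KT2.{u} X (compactlyGenerated.{u} X) :=
  @kT2_of_injective _ _ (compactlyGenerated.{u} X) _ h id
    (continuous_id_iff_le.2 (compactlyGenerated_le X)) Function.injective_id

lemma kT2_pi {I : Type w} {X : I → Type w'} [∀ i, TopologicalSpace (X i)]
    (h : ∀ i, KT2.{u} (X i)) : KT2.{u} (∀ i, X i) where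
  isClosed_eq K _ _ _ p q hp hq := by
    simp only [funext_iff, Set.ofPred_forall]
    exact isClosed_iInter fun i => (h i).isClosed_eq K (fun k => p k i) (fun k => q k i)
      ((continuous_apply i).comp hp) ((continuous_apply i).comp hq)

lemma kT2_prod {X : Type w} {Y : Type w'} [TopologicalSpace X] [TopologicalSpace Y]
    (hX : KT2.{u} X) (hY : KT2.{u} Y) : KT2.{u} (X × Y) where
  isClosed_eq K _ _ _ p q hp hq := by
    simp only [Prod.ext_iff]
    exact (hX.isClosed_eq K _ _ hp.fst hq.fst).inter (hY.isClosed_eq K _ _ hp.snd hq.snd)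

lemma isClopen_sigma_fst {I : Type w} {X : I → Type w'} [∀ i, TopologicalSpace (X i)] {K : Type*}
    [TopologicalSpace K] {r : K → Σ i, X i} (hr : Continuous r) (i : I) :
    IsClopen {l | (r l).1 = i} := by
  have : {l | (r l).1 = i} = r ⁻¹' Set.range (Sigma.mk i) := by
    ext l
    simp
  rw [this]
  exact isClopen_range_sigmaMk.preimage hr

lemma exists_sigma_lift {I : Type w} {X : I → Type w'} [∀ i, TopologicalSpace (X i)] {K : Type*}
    [TopologicalSpace K] {r : K → Σ i, X i} (hr : Continuous r) (i : I) (h : ∀ l, (r l).1 = i) :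
    ∃ r' : K → X i, Continuous r' ∧ ∀ l, r l = ⟨i, r' l⟩ := by
  have : ∀ l, ∃ x : X i, r l = ⟨i, x⟩ := by
    intro l
    have h1 := h l
    revert h1
    generalize r l = rl
    intro h1
    obtain ⟨i, x⟩ := rl
    obtain rfl : i = _ := h1
    exact ⟨x, rfl⟩
  choose r' hr' using this
  refine ⟨r', Topology.IsEmbedding.sigmaMk.continuous_iff.2 ?_, hr'⟩
  rwa [show Sigma.mk i ∘ r' = r from funext fun l => (hr' l).symm]

/-- Continuity may be checked on the fibres of a locally constant function. -/
lemma continuous_of_fibres {K : Type*} {Z : Type*} {D : Type*} [TopologicalSpace K]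
    [TopologicalSpace Z] {f : K → Z} (c : K → D) (hc : ∀ d, IsOpen {k | c k = d})
    (h : ∀ d, Continuous fun k : {k // c k = d} => f k) : Continuous f := by
  rw [continuous_iff_continuousAt]
  intro k
  exact ((hc (c k)).isOpenEmbedding_subtypeVal.continuousAt_iff (x := ⟨k, rfl⟩)).1
    (h (c k)).continuousAt

/-- The complement of a fibre is the union of the other fibres, so fibres are clopen. They can then
serve as test spaces themselves. -/
lemma compactSpace_fibre {K : Type*} {D : Type*} [TopologicalSpace K] [CompactSpace K] {c : K → D}
    (hc : ∀ d, IsOpen {k | c k = d}) (d : D) : CompactSpace {k // c k = d} := by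
  refine isCompact_iff_compactSpace.1 (IsClosed.isCompact (s := {k | c k = d}) ?_)
  have : {k | c k = d} = (⋃ e : {e // e ≠ d}, {k | c k = e.1})ᶜ := by
    ext k
    simp only [Set.mem_ofPred_eq, Set.mem_compl_iff, Set.mem_iUnion, not_exists, Subtype.forall]
    exact ⟨fun h e he h' => he (h'.symm.trans h), fun h => by_contra fun hd => h _ hd rfl⟩
  rw [this]
  exact (isOpen_iUnion fun e : {e // e ≠ d} => hc e.1).isClosed_compl

lemma kT2_sigma {I : Type w} {X : I → Type w'} [∀ i, TopologicalSpace (X i)]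
    (h : ∀ i, KT2.{u} (X i)) : KT2.{u} (Σ i, X i) where
  isClosed_eq K _ _ _ p q hp hq := by
    -- Openness becomes continuity of a map to `Prop` with the Sierpiński topology, so that it can
    -- be checked on the pieces where both indices are constant.
    suffices hs : Continuous fun k => p k ≠ q k by
      rw [← isOpen_compl_iff]
      exact continuous_Prop.1 hs
    have hc : ∀ d : I × I, IsOpen {k | ((p k).1, (q k).1) = d} := by
      rintro ⟨i, j⟩
      simp only [Prod.mk.injEq]
      exact (isClopen_sigma_fst hp i).2.inter (isClopen_sigma_fst hq j).2
    refine continuous_of_fibres (fun k => ((p k).1, (q k).1)) hc ?_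
    rintro ⟨i, j⟩
    have := compactSpace_fibre hc (i, j)
    obtain ⟨p', hp', hpe⟩ := exists_sigma_lift (hp.comp continuous_subtype_val) i
      fun l : {k // ((p k).1, (q k).1) = (i, j)} => congrArg Prod.fst l.2
    obtain ⟨q', hq', hqe⟩ := exists_sigma_lift (hq.comp continuous_subtype_val) j
      fun l : {k // ((p k).1, (q k).1) = (i, j)} => congrArg Prod.snd l.2
    simp only [Function.comp_apply] at hpe hqe
    simp only [hpe, hqe]
    by_cases e : i = j
    · subst e
      simp only [ne_eq, Sigma.mk.injEq, heq_eq_eq, true_and]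
      exact continuous_Prop.2 ((h i).isClosed_eq _ p' q' hp' hq').isOpen_compl
    · simp [e, continuous_const]

/-- The map `r` on `K ⊕ K` assembled from `p` and `q` is closed and points are closed, so normality
of `K ⊕ K` separates the preimages of two distinct values `p k` and `q k` by open sets `U` and `V`.
Near `k` the values of `p` avoid the image of the complement of `U` and those of `q` avoid the image
of the complement of `V`; a coincidence `p l = q l` would put the point `inl l` in both `U` and `V`.
-/
lemma CGWHSpace.kT2 {X : Type u} [TopologicalSpace X] (h : CGWHSpace X) : KT2.{u} X where
  isClosed_eq K _ _ _ p q hp hq := by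
    rw [← isOpen_compl_iff, isOpen_iff_mem_nhds]
    intro k hk
    have hk : p k ≠ q k := hk
    let r : K ⊕ K → X := Sum.elim p q
    have hr : Continuous r := hp.sumElim hq
    have hcl : ∀ C : Set (K ⊕ K), IsClosed C → IsClosed (r '' C) := by
      intro C hC
      have : CompactSpace C := isCompact_iff_compactSpace.1 hC.isCompact
      rw [Set.image_eq_range]
      exact h.weaklyHausdorff.isClosed_range C (fun x => r x) (hr.comp continuous_subtype_val)
    have hpt : ∀ x : X, IsClosed ({x} : Set X) := fun x => by
      rw [← Set.range_const (ι := PUnit.{u + 1})]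
      exact h.weaklyHausdorff.isClosed_range PUnit (fun _ => x) continuous_const
    obtain ⟨U, V, hU, hV, hAU, hBV, hUV⟩ := normal_separation ((hpt (p k)).preimage hr)
      ((hpt (q k)).preimage hr) (by
        rw [Set.disjoint_left]
        intro e h1 h2
        exact hk ((show r e = p k from h1).symm.trans h2))
    have h1 := (hcl _ hU.isClosed_compl).isOpen_compl.preimage hp
    have h2 := (hcl _ hV.isClosed_compl).isOpen_compl.preimage hq
    refine Filter.mem_of_superset ((h1.inter h2).mem_nhds ⟨?_, ?_⟩) ?_
    · rintro ⟨e, he, hee⟩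
      exact he (hAU hee)
    · rintro ⟨e, he, hee⟩
      exact he (hBV hee)
    · rintro l ⟨hl1, hl2⟩ hh
      have hlU : Sum.inl l ∈ U := by
        by_contra hc
        exact hl1 ⟨Sum.inl l, hc, rfl⟩
      have hlV : Sum.inl l ∈ V := by
        by_contra hc
        exact hl2 ⟨Sum.inl l, hc, hh⟩
      exact Set.disjoint_left.1 hUV hlU hlV

/-- The preimage of `range p` under a test map `y` on `L` is the projection of a coincidence set in
`K × L`, which is closed and hence compact. -/
lemma CGWHSpace.of_kT2 {X : Type u} [TopologicalSpace X] (hc : CompactlyGeneratedSpace X)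
    (h : KT2.{u} X) : CGWHSpace X where
  compactlyGenerated := hc
  weaklyHausdorff := ⟨fun K _ _ _ p hp => by
    refine CompactlyGeneratedSpace.isClosed' fun L _ _ _ y hy => ?_
    have h1 : IsClosed {z : K × L | p z.1 = y z.2} := h.isClosed_eq (K × L) _ _
      (hp.comp continuous_fst) (hy.comp continuous_snd)
    have h2 := (h1.isCompact.image continuous_snd).isClosed
    convert h2 using 1
    ext l
    simp⟩

lemma CGWHSpace.of_compactlyGenerated {X : Type u} [TopologicalSpace X] (h : KT2.{u} X) :
    @CGWHSpace X (TopologicalSpace.compactlyGenerated.{u} X) :=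
  @CGWHSpace.of_kT2 X (TopologicalSpace.compactlyGenerated.{u} X) (compactlyGeneratedSpace_compactlyGenerated X)
    (kT2_compactlyGenerated h)

/-! ## Products and quotients -/

/-- A tube argument: the slice of `O` over `x₀` contains a compact neighbourhood `N` of `l₀`, and
the set of all `x` with `{x} × N ⊆ O` is open because it is open on test maps, where it is the
complement of the projection of a compact set. -/
lemma compactlyGeneratedSpace_prod {X L : Type u} [TopologicalSpace X] [TopologicalSpace L]
    [CompactlyGeneratedSpace X] [CompactSpace L] [T2Space L] : CompactlyGeneratedSpace (X × L) := by
  refine compactlyGeneratedSpace_of_isOpen fun O hO => ?_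
  rw [isOpen_iff_mem_nhds]
  rintro ⟨x₀, l₀⟩ h₀
  have h1 : IsOpen {l | (x₀, l) ∈ O} := hO L (fun l => (x₀, l)) (by fun_prop)
  obtain ⟨N, hN, hNO, hNc⟩ := local_compact_nhds (h1.mem_nhds h₀)
  have : CompactSpace N := isCompact_iff_compactSpace.1 hNc
  have h2 : IsOpen {x | ∀ l : N, (x, l.1) ∈ O} := by
    refine CompactlyGeneratedSpace.isOpen' fun K _ _ _ p hp => ?_
    have h3 : IsOpen ((fun z : K × N => (p z.1, (z.2 : L))) ⁻¹' O) :=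
      hO (K × N) _ (by fun_prop)
    have h4 := (h3.isClosed_compl.isCompact.image continuous_fst).isClosed.isOpen_compl
    convert h4 using 1
    ext k
    simp
  refine Filter.mem_of_superset (prod_mem_nhds (h2.mem_nhds fun l => hNO l.2) hN) ?_
  rintro ⟨x, l⟩ ⟨hx, hl⟩
  exact hx ⟨l, hl⟩

lemma compactlyGeneratedSpace_of_homeomorph {X Y : Type u} [TopologicalSpace X]
    [TopologicalSpace Y] [CompactlyGeneratedSpace X] (e : X ≃ₜ Y) : CompactlyGeneratedSpace Y :=
  uCompactlyGeneratedSpace_of_coinduced e.continuous e.isQuotientMap.eq_coinduced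

lemma compactlyGeneratedSpace_prod' {X : Type u} {L : Type} [TopologicalSpace X]
    [TopologicalSpace L] [CompactlyGeneratedSpace X] [CompactSpace L] [T2Space L] :
    CompactlyGeneratedSpace (X × L) :=
  have := compactlyGeneratedSpace_prod (X := X) (L := ULift.{u} L)
  compactlyGeneratedSpace_of_homeomorph ((Homeomorph.refl X).prodCongr Homeomorph.ulift)

lemma compactlyGeneratedSpace_prod_left {X : Type u} {L : Type} [TopologicalSpace X]
    [TopologicalSpace L] [CompactlyGeneratedSpace X] [CompactSpace L] [T2Space L] :
    CompactlyGeneratedSpace (L × X) :=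
  have := compactlyGeneratedSpace_prod' (X := X) (L := L)
  compactlyGeneratedSpace_of_homeomorph (Homeomorph.prodComm X L)

/-- A map out of `K × Y` is continuous if it is so on test maps that lift along a quotient map
`X → Y` in the second variable. -/
lemma continuous_prod_of_quotient {X Y K : Type u} {Z : Type w} [TopologicalSpace X]
    [TopologicalSpace Y] [TopologicalSpace K] [TopologicalSpace Z] [CompactlyGeneratedSpace X]
    [CompactSpace K] [T2Space K] {q : X → Y} (hq : Topology.IsQuotientMap q) (g : K × Y → Z)
    (h : ∀ (M : Type u) [TopologicalSpace M] [CompactSpace M] [T2Space M] (a : M → K) (x : M → X),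
      Continuous a → Continuous x → Continuous fun m => g (a m, q (x m))) : Continuous g := by
  -- The product of a quotient map with a locally compact space is again a quotient map.
  refine hq.continuous_lift_prod_right ?_
  have := compactlyGeneratedSpace_prod (X := X) (L := K)
  have h2 : Continuous fun z : X × K => g (z.2, q z.1) :=
    continuous_of_test fun M _ _ _ p hp => h M _ _ hp.snd hp.fst
  exact h2.comp continuous_swap

/-- A function on a finite product of quotients is continuous on test maps if it is so on test maps
that lift along the quotient maps. -/
lemma continuous_pi_of_quotient {I : Type} [Finite I] {X Y : I → Type u} {W Z : Type*}
    [∀ i, TopologicalSpace (X i)] [∀ i, TopologicalSpace (Y i)] [TopologicalSpace Z]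
    [TopologicalSpace W] [∀ i, CompactlyGeneratedSpace (X i)] {q : ∀ i, X i → Y i}
    (hq : ∀ i, Topology.IsQuotientMap (q i)) (g : W → (∀ i, Y i) → Z)
    (h : ∀ (M : Type u) [TopologicalSpace M] [CompactSpace M] [T2Space M] (w : M → W)
      (x : ∀ i, M → X i), Continuous w → (∀ i, Continuous (x i)) →
        Continuous fun m => g (w m) fun i => q i (x i m))
    (K : Type u) [TopologicalSpace K] [CompactSpace K] [T2Space K] (w : K → W) (hw : Continuous w)
    (y : ∀ i, K → Y i) (hy : ∀ i, Continuous (y i)) : Continuous fun k => g (w k) fun i => y i k := by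
  classical
  have := Fintype.ofFinite I
  -- The set `s` collects the coordinates that have not been lifted yet; the induction removes them
  -- one at a time.
  suffices key : ∀ (s : Finset I) (K : Type u) [TopologicalSpace K] [CompactSpace K] [T2Space K]
      (w : K → W) (y : ∀ i, K → Y i), Continuous w → (∀ i, Continuous (y i)) →
      (∀ i, i ∉ s → ∃ x : K → X i, Continuous x ∧ y i = q i ∘ x) →
      Continuous fun k => g (w k) fun i => y i k from
    key Finset.univ K w y hw hy fun i hi => (hi (Finset.mem_univ i)).elim
  intro s
  induction s using Finset.induction_on with
  | empty =>
    intro K _ _ _ w y hw _ hl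
    choose x hx hyx using fun i => hl i (Finset.notMem_empty i)
    obtain rfl : y = fun i => q i ∘ x i := funext hyx
    exact h K w x hw hx
  | insert j s hj ih =>
    intro K _ _ _ w y hw hy hl
    -- The `j`-th coordinate becomes an independent variable, so that only this one quotient map has
    -- to be lifted. Restriction to the graph of `y j` then gives the claim.
    have key : Continuous fun z : K × Y j =>
        g (w z.1) (Function.update (fun i => y i z.1) j z.2) := by
      refine continuous_prod_of_quotient (hq j) _ fun M _ _ _ a x ha hx => ?_
      refine ih M (fun m => w (a m))
        (fun i m => Function.update (fun i => y i (a m)) j (q j (x m)) i) (hw.comp ha) ?_ ?_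
      · intro i
        by_cases hi : i = j
        · subst hi
          simpa using! (hq i).continuous.comp hx
        · simpa [hi] using! (hy i).comp ha
      · intro i hi
        by_cases hij : i = j
        · subst hij
          exact ⟨x, hx, by funext m; simp⟩
        · obtain ⟨x', hx', e⟩ := hl i (by simp [hij, hi])
          exact ⟨x' ∘ a, hx'.comp ha, by funext m; simp [hij, e]⟩
    have := key.comp (continuous_id.prodMk (hy j))
    convert this using 2 with k
    simp

end KTopology

end

noncomputable section

/-! ## Continuity for spaces of linear isometries -/

section FiniteTopology

variable {ι κ : Type} {K : Type*} [TopologicalSpace K]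

lemma continuous_finiteTopology_dom {V : Type} [AddCommGroup V] [Module ℝ V] {Y : Type*}
    [t : TopologicalSpace Y] {p : V → Y} : Continuous[finiteTopology V, t] p ↔
      ∀ (n : ℕ) (g : (Fin n → ℝ) →ₗ[ℝ] V), Continuous fun x => p (g x) := by
  unfold finiteTopology
  simp only [continuous_iSup_dom, continuous_coinduced_dom]
  rfl

/-- A family of finitely supported vectors with supports in a common finite set and with continuous
coordinates. -/
structure Tame (w : K → ι →₀ ℝ) : Prop where
  support : ∃ F : Finset ι, ∀ k, (w k).support ⊆ F
  continuous : ∀ j, Continuous fun k => w k j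

/-- The family factors continuously through `ℝ ^ F` for a finite set `F` that contains all supports.
-/
lemma Tame.continuous_finiteTopology {w : K → ι →₀ ℝ} (hw : Tame w) :
    Continuous[_, finiteTopology (ι →₀ ℝ)] w := by
  obtain ⟨F, hF⟩ := hw.support
  let e := F.equivFin
  let g : (Fin F.card → ℝ) →ₗ[ℝ] (ι →₀ ℝ) :=
    Finsupp.lmapDomain ℝ ℝ (fun i => (e.symm i).1) ∘ₗ
      (Finsupp.linearEquivFunOnFinite ℝ ℝ (Fin F.card)).symm.toLinearMap
  have hg : Continuous[_, finiteTopology (ι →₀ ℝ)] g :=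
    (@continuous_finiteTopology_dom _ _ _ _ (finiteTopology (ι →₀ ℝ)) id).1
      (@continuous_id _ (finiteTopology _)) _ g
  have hwg : w = fun k => g fun i => w k (e.symm i) := by
    funext k
    ext j
    have hinj : Function.Injective fun i => (e.symm i).1 :=
      Subtype.val_injective.comp e.symm.injective
    by_cases hj : j ∈ F
    · obtain ⟨i, hi⟩ := e.symm.surjective ⟨j, hj⟩
      have hi' : j = (fun i => (e.symm i).1) i := by simp [hi]
      rw [hi']
      simp only [g, LinearMap.comp_apply, Finsupp.lmapDomain_apply]
      rw [Finsupp.mapDomain_apply hinj]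
      simp
    · rw [Finsupp.notMem_support_iff.1 fun h => hj (hF k h)]
      simp only [g, LinearMap.comp_apply, Finsupp.lmapDomain_apply]
      rw [Finsupp.mapDomain_of_notMem_range]
      rintro ⟨i, rfl⟩
      exact hj (e.symm i).2
  rw [hwg]
  exact @Continuous.comp _ _ _ _ _ (finiteTopology _) _ _ hg
    (continuous_pi fun i => hw.continuous _)

lemma continuous_finsupp_apply (i : ι) :
    Continuous[finiteTopology (ι →₀ ℝ), _] fun v : ι →₀ ℝ => v i :=
  continuous_finiteTopology_dom.2 fun _ g =>
    (Finsupp.lapply i ∘ₗ g).continuous_of_finiteDimensional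

/-- Otherwise infinitely many coordinates occur in `C`. A weighted `ℓ¹`-norm is continuous for the
colimit topology whatever its weights are, and suitable weights make it unbounded on `C`. -/
lemma exists_finset_of_isCompact {C : Set (ι →₀ ℝ)}
    (hC : @IsCompact _ (finiteTopology (ι →₀ ℝ)) C) : ∃ F : Finset ι, ∀ v ∈ C, v.support ⊆ F := by
  classical
  by_contra hF
  push Not at hF
  have hinf : (⋃ v ∈ C, (v.support : Set ι)).Infinite := by
    intro hfin
    obtain ⟨v, hv, hvF⟩ := hF hfin.toFinset
    apply hvF
    intro i hi
    simp only [Set.Finite.mem_toFinset, Set.mem_iUnion]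
    exact ⟨v, hv, hi⟩
  have hN := hinf.natEmbedding
  have hv : ∀ n, ∃ v ∈ C, v (hN n).1 ≠ 0 := by
    intro n
    have := (hN n).2
    simp only [Set.mem_iUnion] at this
    obtain ⟨v, hv, h⟩ := this
    exact ⟨v, hv, Finsupp.mem_support_iff.1 h⟩
  choose v hvC hv0 using hv
  -- The weight of the `n`-th chosen coordinate makes its contribution to the norm of `v n` equal to
  -- `n`; all other coordinates have weight `0`.
  let c : ι → ℝ := fun i => if h : ∃ n, (hN n).1 = i then h.choose / |v h.choose i| else 0
  have hc0 : ∀ i, 0 ≤ c i := by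
    intro i
    simp only [c]
    split_ifs <;> positivity
  have hcn : ∀ n, c (hN n).1 = n / |v n (hN n).1| := by
    intro n
    have h : ∃ m, (hN m).1 = (hN n).1 := ⟨n, rfl⟩
    have hm : h.choose = n := hN.injective (Subtype.ext h.choose_spec)
    simp only [c]
    rw [dif_pos h, hm]
  let φ : (ι →₀ ℝ) → ℝ := fun w => w.sum fun i a => c i * |a|
  have hφ : Continuous[finiteTopology (ι →₀ ℝ), _] φ := by
    refine continuous_finiteTopology_dom.2 fun n g => ?_
    -- The image of `g` is spanned by finitely many vectors, so only the coordinates in `F` enter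
    -- the norm.
    let F : Finset ι := Finset.univ.biUnion fun i : Fin n => (g (Pi.single i 1)).support
    have hs : ∀ x, (g x).support ⊆ F := by
      intro x i hi
      by_contra hiF
      refine Finsupp.mem_support_iff.1 hi ?_
      rw [LinearMap.pi_apply_eq_sum_univ g x, Finsupp.finsetSum_apply]
      refine Finset.sum_eq_zero fun m _ => ?_
      rw [Finsupp.smul_apply]
      have : i ∉ (g (Pi.single m 1)).support := fun h =>
        hiF (Finset.mem_biUnion.2 ⟨m, Finset.mem_univ _, h⟩)
      have h2 := Finsupp.notMem_support_iff.1 this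
      have h3 : (fun j => if m = j then (1 : ℝ) else 0) = Pi.single m 1 := by
        funext j
        simp [Pi.single_apply, eq_comm]
      rw [h3, h2, smul_zero]
    have : (fun x => φ (g x)) = fun x => ∑ i ∈ F, c i * |g x i| := by
      funext x
      exact Finsupp.sum_of_support_subset _ (hs x) _ (by simp)
    rw [this]
    refine continuous_finsetSum _ fun i _ => continuous_const.mul (Continuous.abs ?_)
    exact (Finsupp.lapply i ∘ₗ g).continuous_of_finiteDimensional
  obtain ⟨B, hB⟩ := (@IsCompact.image _ _ (finiteTopology _) _ _ _ hC hφ).bddAbove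
  obtain ⟨n, hn⟩ := exists_nat_gt B
  have h1 : φ (v n) ≤ B := hB ⟨v n, hvC n, rfl⟩
  have h2 : (n : ℝ) ≤ φ (v n) := by
    have h3 : c (hN n).1 * |v n (hN n).1| ≤ φ (v n) :=
      Finset.single_le_sum (f := fun i => c i * |v n i|)
        (fun i _ => mul_nonneg (hc0 i) (abs_nonneg _)) (Finsupp.mem_support_iff.2 (hv0 n))
    rwa [hcn, div_mul_cancel₀ _ (abs_ne_zero.2 (hv0 n))] at h3
  linarith

lemma Tame.of_continuous [CompactSpace K] {w : K → ι →₀ ℝ}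
    (hw : Continuous[_, finiteTopology (ι →₀ ℝ)] w) : Tame w where
  support := by
    let _ := finiteTopology (ι →₀ ℝ)
    obtain ⟨F, hF⟩ := exists_finset_of_isCompact (isCompact_range hw)
    exact ⟨F, fun k => hF _ ⟨k, rfl⟩⟩
  continuous j := @Continuous.comp _ _ _ _ (finiteTopology _) _ _ _ (continuous_finsupp_apply j) hw

end FiniteTopology

namespace LinIsom

variable {ι κ μ : Type} {K : Type*} [TopologicalSpace K]

lemma continuous_apply (v : ι →₀ ℝ) :
    Continuous[_, finiteTopology (κ →₀ ℝ)] fun f : LinIsom ι κ => f.1 v := by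
  let _ := finiteTopology (ι →₀ ℝ)
  refine continuous_def.2 fun U hU => isOpen_generateFrom_of_mem ⟨{v}, U, isCompact_singleton, hU, ?_⟩
  ext f
  simp

lemma apply_eq_sum (f : LinIsom ι κ) {v : ι →₀ ℝ} {G : Finset ι} (h : v.support ⊆ G) :
    f.1 v = ∑ i ∈ G, v i • f.1 (Finsupp.single i 1) := by
  conv_lhs => rw [← Finsupp.sum_single v, Finsupp.sum_of_support_subset v h _ (by simp)]
  rw [map_sum]
  refine Finset.sum_congr rfl fun i _ => ?_
  rw [← map_smul, Finsupp.smul_single, smul_eq_mul, mul_one]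

/-- Over a common finite support of the vectors, the value is a linear combination of the values on
finitely many basis vectors, with continuous coefficients. -/
lemma tame_apply {p : K → LinIsom ι κ} (hp : ∀ i, Tame fun k => (p k).1 (Finsupp.single i 1))
    {w : K → ι →₀ ℝ} (hw : Tame w) : Tame fun k => (p k).1 (w k) := by
  classical
  obtain ⟨G, hG⟩ := hw.support
  choose F hF using fun i => (hp i).support
  refine ⟨⟨G.biUnion F, fun k j hj => ?_⟩, fun j => ?_⟩
  · by_contra hjn
    refine Finsupp.mem_support_iff.1 hj ?_
    rw [apply_eq_sum _ (hG k), Finsupp.finsetSum_apply]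
    refine Finset.sum_eq_zero fun i hi => ?_
    rw [Finsupp.smul_apply, Finsupp.notMem_support_iff.1 fun h =>
      hjn (Finset.mem_biUnion.2 ⟨i, hi, hF i k h⟩), smul_zero]
  · have : (fun k => (p k).1 (w k) j) =
        fun k => ∑ i ∈ G, w k i * (p k).1 (Finsupp.single i 1) j := by
      funext k
      rw [apply_eq_sum _ (hG k), Finsupp.finsetSum_apply]
      rfl
    rw [this]
    exact continuous_finsetSum _ fun i _ => (hw.continuous i).mul ((hp i).continuous j)

/-- Evaluation at a vector is continuous, and compact families of vectors are tame. Conversely, a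
compact set `C` lies in the span of finitely many basis vectors, so `(k, c) ↦ p k c` is tame and
hence jointly continuous; the points `k` with `p k C ⊄ U` then form the projection of a closed set
along the compact factor `C`. -/
lemma continuous_iff_tame [CompactSpace K] {p : K → LinIsom ι κ} :
    Continuous p ↔ ∀ i, Tame fun k => (p k).1 (Finsupp.single i 1) := by
  constructor
  · intro hp i
    exact Tame.of_continuous (@Continuous.comp _ _ _ _ _ (finiteTopology _) _ _
      (continuous_apply (Finsupp.single i 1)) hp)
  · intro hp
    refine continuous_generateFrom_iff.2 ?_
    rintro _ ⟨C, U, hC, hU, rfl⟩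
    obtain ⟨G, hG⟩ := exists_finset_of_isCompact hC
    let _ := finiteTopology (ι →₀ ℝ)
    have hCc : CompactSpace C := isCompact_iff_compactSpace.1 hC
    have ht : Tame fun z : K × C => (p z.1).1 z.2.1 := by
      refine tame_apply (p := fun z : K × C => p z.1) (fun i => ⟨?_, fun j => ?_⟩)
        ⟨⟨G, fun z => hG _ z.2.2⟩, fun j => ?_⟩
      · obtain ⟨F, hF⟩ := (hp i).support
        exact ⟨F, fun z => hF z.1⟩
      · exact ((hp i).continuous j).comp continuous_fst
      · exact (continuous_finsupp_apply j).comp (continuous_subtype_val.comp continuous_snd)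
    have h1 := (@IsOpen.preimage _ _ _ (finiteTopology _) _ ht.continuous_finiteTopology _
      hU).isClosed_compl
    have h2 := (isClosedMap_fst_of_compactSpace _ h1).isOpen_compl
    convert h2 using 1
    ext k
    simp [Set.MapsTo]

lemma kT2 : KT2.{u} (LinIsom ι κ) where
  isClosed_eq K _ _ _ p q hp hq := by
    have : {k | p k = q k} = ⋂ i, ⋂ j, {k | (p k).1 (Finsupp.single i 1) j =
        (q k).1 (Finsupp.single i 1) j} := by
      ext k
      simp only [Set.mem_ofPred_eq, Set.mem_iInter]
      refine ⟨fun h i j => by rw [h], fun h => ?_⟩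
      refine Subtype.ext (Finsupp.lhom_ext' fun i => LinearMap.ext_ring ?_)
      exact Finsupp.ext (h i)
    rw [this]
    exact isClosed_iInter fun i => isClosed_iInter fun j =>
      isClosed_eq ((continuous_iff_tame.1 hp i).continuous j)
        ((continuous_iff_tame.1 hq i).continuous j)

end LinIsom

namespace isometriesOperad

variable {K : Type*} [TopologicalSpace K] [CompactSpace K]

lemma continuous_iff_tame {S : Type} {p : K → isometriesOperad.Op S} :
    Continuous p ↔ ∀ s n, Tame fun k => toLinear (p k) (Finsupp.single (s, n) 1) := by
  refine LinIsom.continuous_iff_tame.trans ?_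
  exact ⟨fun h s n => h (s, n), fun h i => h i.1 i.2⟩

lemma continuous_act {S T : Type} (σ : S ≃ T) {p : K → isometriesOperad.Op T}
    (hp : Continuous p) : Continuous fun k => isometriesOperad.act σ (p k) := by
  rw [continuous_iff_tame] at hp ⊢
  intro s n
  simp only [toLinear_act]
  exact hp (σ s) n

lemma tame_toLinear {S : Type} {p : K → isometriesOperad.Op S} (hp : Continuous p)
    {w : K → (S × ℕ) →₀ ℝ} (hw : Tame w) : Tame fun k => toLinear (p k) (w k) :=
  LinIsom.tame_apply (LinIsom.continuous_iff_tame.1 hp) hw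

lemma continuous_comp {S : Type} {T : S → Type} {p : K → isometriesOperad.Op S}
    (hp : Continuous p) {q : ∀ s, K → isometriesOperad.Op (T s)} (hq : ∀ s, Continuous (q s)) :
    Continuous fun k => isometriesOperad.comp (p k) fun s => q s k := by
  rw [continuous_iff_tame]
  intro x n
  obtain ⟨⟨s, t⟩, rfl⟩ := toLex.surjective x
  simp only [toLinear_comp]
  refine tame_toLinear hp ?_
  -- The inclusion of the `s`-th copy of `ℝ^∞` is itself an isometry, regarded here as a constant
  -- family.
  refine LinIsom.tame_apply (p := fun _ => LinIsom.ofInjective (fun n : ℕ => (s, n))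
    fun a b h => (Prod.ext_iff.1 h).2) (fun i => ⟨⟨_, fun _ => subset_rfl⟩,
      fun _ => continuous_const⟩) (continuous_iff_tame.1 (hq s) t n)

end isometriesOperad

/-! ## Test maps into the hom-spaces of the index category -/

namespace RingIndex

/-- The discrete part `(ψ, κ)` of a morphism. -/
def Hom.shape {X Y : RingIndex} (h : Hom X Y) : Σ ψ : Fin X.m → Option (Fin Y.m),
    ∀ j, Smash X.a ψ j → Option (Fin (Y.a j)) := ⟨h.ψ, h.κ⟩

/-- A morphism as an element of the disjoint union that defines the topology. -/
def Hom.toSigma {X Y : RingIndex} (h : Hom X Y) : Σ p : (Σ ψ : Fin X.m → Option (Fin Y.m),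
    ∀ j, Smash X.a ψ j → Option (Fin (Y.a j))), ∀ j, isometriesOperad.Op (Fibre p.1 j) :=
  ⟨h.shape, h.f⟩

lemma Hom.eq_of_toSigma {X Y : RingIndex} {h : Hom X Y} {d f} (e : h.toSigma = ⟨d, f⟩) :
    h = ⟨d.1, f, d.2⟩ := by
  obtain ⟨ψ, g, κ⟩ := h
  cases e
  rfl

lemma continuous_hom_iff {K : Type*} [TopologicalSpace K] {X Y : RingIndex} {h : K → (X ⟶ Y)} :
    Continuous h ↔ Continuous fun k => Hom.toSigma (h k) :=
  continuous_induced_rng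

variable {K : Type*} [TopologicalSpace K]

lemma isOpen_shape {X Y : RingIndex} {h : K → (X ⟶ Y)} (hh : Continuous h) (d) :
    IsOpen {k | Hom.shape (h k) = d} :=
  (isClopen_sigma_fst (continuous_hom_iff.1 hh) d).2

/-- Where the discrete part is constant, the fibres that index the operations no longer depend on
the parameter, and only the isometries vary. -/
lemma exists_hom_lift {X Y : RingIndex} {h : K → (X ⟶ Y)} (hh : Continuous h) (d)
    (hd : ∀ k, Hom.shape (h k) = d) : ∃ f : ∀ j, K → isometriesOperad.Op (Fibre d.1 j),
      (∀ j, Continuous (f j)) ∧ ∀ k, h k = (⟨d.1, fun j => f j k, d.2⟩ : Hom X Y) := by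
  obtain ⟨f, hf, e⟩ := exists_sigma_lift (continuous_hom_iff.1 hh) d hd
  exact ⟨fun j k => f k j, fun j => (continuous_apply j).comp hf,
    fun k => Hom.eq_of_toSigma (e k)⟩

lemma continuous_hom_mk {X Y : RingIndex} (ψ : Fin X.m → Option (Fin Y.m))
    (κ : ∀ j, Smash X.a ψ j → Option (Fin (Y.a j))) {f : ∀ j, K → isometriesOperad.Op (Fibre ψ j)}
    (hf : ∀ j, Continuous (f j)) :
    Continuous fun k => ((⟨ψ, fun j => f j k, κ⟩ : Hom X Y) : X ⟶ Y) :=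
  continuous_hom_iff.2 ((continuous_sigmaMk (σ := fun p : (Σ ψ : Fin X.m → Option (Fin Y.m),
    ∀ j, Smash X.a ψ j → Option (Fin (Y.a j))) => ∀ j, isometriesOperad.Op (Fibre p.1 j))
    (i := ⟨ψ, κ⟩)).comp (continuous_pi hf))

lemma continuous_comp {K : Type*} [TopologicalSpace K] [CompactSpace K] {X Y Z : RingIndex}
    {h₁ : K → (X ⟶ Y)} {h₂ : K → (Y ⟶ Z)} (hh₁ : Continuous h₁) (hh₂ : Continuous h₂) :
    Continuous fun k => h₁ k ≫ h₂ k := by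
  refine continuous_of_fibres (fun k => Hom.shape (h₁ k)) (isOpen_shape hh₁) fun d₁ => ?_
  have := compactSpace_fibre (isOpen_shape hh₁) d₁
  obtain ⟨f₁, hf₁, e₁⟩ := exists_hom_lift (hh₁.comp continuous_subtype_val) d₁
    fun k : {k // Hom.shape (h₁ k) = d₁} => k.2
  have hh₂' := hh₂.comp (continuous_subtype_val (p := fun k => Hom.shape (h₁ k) = d₁))
  refine continuous_of_fibres _ (isOpen_shape hh₂') fun d₂ => ?_
  have := compactSpace_fibre (isOpen_shape hh₂') d₂
  obtain ⟨f₂, hf₂, e₂⟩ := exists_hom_lift (hh₂'.comp continuous_subtype_val) d₂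
    fun k : {k // Hom.shape ((h₂ ∘ Subtype.val) k) = d₂} => k.2
  have key : Continuous fun k : {k : {k // Hom.shape (h₁ k) = d₁} //
      Hom.shape ((h₂ ∘ Subtype.val) k) = d₂} =>
      ((Hom.comp ⟨d₁.1, fun j => f₁ j k.1, d₁.2⟩ ⟨d₂.1, fun j => f₂ j k, d₂.2⟩ : Hom X Z) :
        X ⟶ Z) := by
    have hf : ∀ l, Continuous fun k : {k : {k // Hom.shape (h₁ k) = d₁} //
        Hom.shape ((h₂ ∘ Subtype.val) k) = d₂} =>
        isometriesOperad.act (fibreEquiv d₁.1 d₂.1 l) (isometriesOperad.comp (f₂ l k)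
          fun j => f₁ j.1 k.1) := fun l =>
      isometriesOperad.continuous_act _ (isometriesOperad.continuous_comp (hf₂ l)
        fun j => (hf₁ j.1).comp continuous_subtype_val)
    -- The composite of the `κ` depends on the discrete parts only, but `compSmash` takes whole
    -- morphisms. A base point `k₀` supplies their operations; without one there is nothing to
    -- prove.
    rcases isEmpty_or_nonempty {k : {k // Hom.shape (h₁ k) = d₁} //
      Hom.shape ((h₂ ∘ Subtype.val) k) = d₂} with _ | ⟨⟨k₀⟩⟩
    · exact continuous_of_const fun k => isEmptyElim k
    · exact continuous_hom_mk (X := X) (Y := Z) (compMap d₁.1 d₂.1)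
        (compSmash (X := X) (Y := Y) (Z := Z) ⟨d₁.1, fun j => f₁ j k₀.1, d₁.2⟩
          ⟨d₂.1, fun j => f₂ j k₀, d₂.2⟩) hf
  refine key.congr fun k => ?_
  have h1 := e₁ k.1
  have h2 := e₂ k
  simp only [Function.comp_apply] at h1 h2
  change _ = h₁ k.1.1 ≫ h₂ k.1.1
  rw [h1, h2]
  rfl

lemma kT2_hom (X Y : RingIndex) : KT2.{u} (X ⟶ Y) := by
  have h : KT2.{u} (Σ p : (Σ ψ : Fin X.m → Option (Fin Y.m),
      ∀ j, Smash X.a ψ j → Option (Fin (Y.a j))), ∀ j, isometriesOperad.Op (Fibre p.1 j)) :=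
    kT2_sigma fun p => kT2_pi fun j => LinIsom.kT2
  refine kT2_of_injective h (f := fun g : X ⟶ Y => Hom.toSigma g)
    (continuous_hom_iff.1 continuous_id) ?_
  intro h h' e
  exact (Hom.eq_of_toSigma e).trans rfl

end RingIndex

end

noncomputable section

/-! ## Points of simplices as step functions -/

namespace SimplexPoint

variable {m n : ℕ}

/-- The partial sums of the barycentric coordinates. -/
def cum (s : stdSimplex ℝ (Fin (n + 1))) (i : Fin (n + 1)) : ℝ := ∑ j ∈ Finset.Iic i, s j

/-- The sums of the barycentric coordinates before a vertex. -/
def cumLt (s : stdSimplex ℝ (Fin (n + 1))) (i : Fin (n + 1)) : ℝ := ∑ j ∈ Finset.Iio i, s j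

lemma cum_mono (s : stdSimplex ℝ (Fin (n + 1))) : Monotone (cum s) := fun _ _ h =>
  Finset.sum_le_sum_of_subset_of_nonneg (Finset.Iic_subset_Iic.2 h) fun _ _ _ => s.2.1 _

lemma cum_le_cumLt (s : stdSimplex ℝ (Fin (n + 1))) {i j : Fin (n + 1)} (h : i < j) :
    cum s i ≤ cumLt s j :=
  Finset.sum_le_sum_of_subset_of_nonneg
    (fun _ hk => Finset.mem_Iio.2 ((Finset.mem_Iic.1 hk).trans_lt h)) fun _ _ _ => s.2.1 _

lemma cumLt_add (s : stdSimplex ℝ (Fin (n + 1))) (i : Fin (n + 1)) : cumLt s i + s i = cum s i := by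
  rw [cum, ← Finset.Iio_insert i, Finset.sum_insert (by simp), add_comm, cumLt]

lemma cum_nonneg (s : stdSimplex ℝ (Fin (n + 1))) (i : Fin (n + 1)) : 0 ≤ cum s i :=
  Finset.sum_nonneg fun _ _ => s.2.1 _

lemma cum_last (s : stdSimplex ℝ (Fin (n + 1))) : cum s (Fin.last n) = 1 := by
  rw [← stdSimplex.sum_eq_one s, cum]
  congr 1
  ext i
  simp [Fin.le_last]

lemma cum_le_one (s : stdSimplex ℝ (Fin (n + 1))) (i : Fin (n + 1)) : cum s i ≤ 1 :=
  (cum_mono s (Fin.le_last i)).trans (cum_last s).le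

lemma continuous_coord (i : Fin (n + 1)) :
    Continuous fun s : stdSimplex ℝ (Fin (n + 1)) => s i :=
  (continuous_apply i).comp continuous_subtype_val

lemma continuous_cum (i : Fin (n + 1)) :
    Continuous fun s : stdSimplex ℝ (Fin (n + 1)) => cum s i :=
  continuous_finsetSum _ fun j _ => continuous_coord j

lemma continuous_cumLt (i : Fin (n + 1)) :
    Continuous fun s : stdSimplex ℝ (Fin (n + 1)) => cumLt s i :=
  continuous_finsetSum _ fun j _ => continuous_coord j

lemma ext_cum {s t : stdSimplex ℝ (Fin (n + 1))} (h : ∀ i, cum s i = cum t i) : s = t := by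
  have key : ∀ k : ℕ, ∀ i : Fin (n + 1), i.1 < k → s i = t i := by
    intro k
    induction k with
    | zero => intro i hi; omega
    | succ k ih =>
      intro i hi
      have h1 : cumLt s i = cumLt t i := Finset.sum_congr rfl fun j hj => ih j (by
        have : j.1 < i.1 := Fin.lt_def.1 (Finset.mem_Iio.1 hj)
        omega)
      have := cumLt_add s i
      have := cumLt_add t i
      have := h i
      linarith
  exact stdSimplex.ext (funext fun i => key _ i i.2)

lemma cum_map (f : Fin (m + 1) → Fin (n + 1)) (s : stdSimplex ℝ (Fin (m + 1))) (j : Fin (n + 1)) :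
    cum (stdSimplex.map f s) j = ∑ i with f i ≤ j, s i := by
  classical
  simp only [cum, stdSimplex.map_coe, FunOnFinite.linearMap_apply_apply, Finset.sum_filter]
  rw [Finset.sum_comm]
  refine Finset.sum_congr rfl fun i _ => ?_
  simp

lemma cumLt_map (f : Fin (m + 1) → Fin (n + 1)) (s : stdSimplex ℝ (Fin (m + 1)))
    (j : Fin (n + 1)) : cumLt (stdSimplex.map f s) j = ∑ i with f i < j, s i := by
  classical
  simp only [cumLt, stdSimplex.map_coe, FunOnFinite.linearMap_apply_apply, Finset.sum_filter]
  rw [Finset.sum_comm]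
  refine Finset.sum_congr rfl fun i _ => ?_
  simp

/-- The step function of `s`, on subintervals of lengths `s 0, s 1, …`, has the value `i` at `u`. -/
structure IsStep (s : stdSimplex ℝ (Fin (n + 1))) (u : ℝ) (i : Fin (n + 1)) : Prop where
  le : cumLt s i ≤ u
  lt : u < cum s i

/-- The value is the first vertex whose partial sum exceeds `u`; the last partial sum is `1`. As the
subintervals are half-open, vertices of weight zero are never values. -/
lemma exists_isStep (s : stdSimplex ℝ (Fin (n + 1))) {u : ℝ} (h0 : 0 ≤ u) (h1 : u < 1) :
    ∃ i, IsStep s u i := by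
  classical
  have hne : (Finset.univ.filter fun i => u < cum s i).Nonempty :=
    ⟨Fin.last n, by simpa [cum_last] using h1⟩
  refine ⟨_, ?_, (Finset.mem_filter.1 (Finset.min'_mem _ hne)).2⟩
  set i := (Finset.univ.filter fun i => u < cum s i).min' hne with hi
  rcases Fin.eq_zero_or_eq_succ i with h | ⟨j, h⟩
  · rw [h, cumLt]
    rw [show Finset.Iio (0 : Fin (n + 1)) = ∅ from by ext; simp]
    simpa using h0
  · have hj : ¬ u < cum s j.castSucc := by
      intro hj
      have h2 : i ≤ j.castSucc := Finset.min'_le _ _ (by simpa using hj)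
      rw [h] at h2
      exact absurd h2 (not_le.2 Fin.castSucc_lt_succ)
    rw [h]
    have : cumLt s j.succ = cum s j.castSucc := by
      rw [cumLt, cum]
      congr 1
    rw [this]
    exact not_lt.1 hj

lemma IsStep.mono {s : stdSimplex ℝ (Fin (n + 1))} {u v : ℝ} {i j : Fin (n + 1)}
    (hi : IsStep s u i) (hj : IsStep s v j) (h : u ≤ v) : i ≤ j := by
  by_contra hij
  have := cum_le_cumLt s (not_le.1 hij)
  linarith [hi.le, hj.lt]

lemma IsStep.unique {s : stdSimplex ℝ (Fin (n + 1))} {u : ℝ} {i j : Fin (n + 1)}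
    (hi : IsStep s u i) (hj : IsStep s u j) : i = j :=
  le_antisymm (hi.mono hj le_rfl) (hj.mono hi le_rfl)

lemma IsStep.le_iff {s : stdSimplex ℝ (Fin (n + 1))} {u : ℝ} {i : Fin (n + 1)}
    (hi : IsStep s u i) (j : Fin (n + 1)) : i ≤ j ↔ u < cum s j := by
  constructor
  · intro h
    exact hi.lt.trans_le (cum_mono s h)
  · intro h
    by_contra hij
    have := cum_le_cumLt s (not_le.1 hij)
    linarith [hi.le]

/-- A monotone map merges neighbouring subintervals or inserts empty ones, so on step functions it
acts by composition. This makes evaluation compatible with the gluing relation of the realization.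
-/
lemma IsStep.map {s : stdSimplex ℝ (Fin (m + 1))} {u : ℝ} {i : Fin (m + 1)} (h : IsStep s u i)
    {f : Fin (m + 1) → Fin (n + 1)} (hf : Monotone f) : IsStep (stdSimplex.map f s) u (f i) where
  le := by
    refine le_trans ?_ h.le
    rw [cumLt_map]
    refine Finset.sum_le_sum_of_subset_of_nonneg (fun k hk => ?_) fun _ _ _ => s.2.1 _
    refine Finset.mem_Iio.2 ?_
    by_contra hki
    exact absurd (hf (not_lt.1 hki)) (not_le.2 (Finset.mem_filter.1 hk).2)
  lt := by
    refine h.lt.trans_le ?_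
    rw [cum_map]
    refine Finset.sum_le_sum_of_subset_of_nonneg (fun k hk => ?_) fun _ _ _ => s.2.1 _
    exact Finset.mem_filter.2 ⟨Finset.mem_univ _, hf (Finset.mem_Iic.1 hk)⟩

/-- The step function of a point of a simplex. -/
def step (s : stdSimplex ℝ (Fin (n + 1))) (u : Set.Ico (0 : ℝ) 1) : Fin (n + 1) :=
  (exists_isStep s u.2.1 u.2.2).choose

lemma isStep_step (s : stdSimplex ℝ (Fin (n + 1))) (u : Set.Ico (0 : ℝ) 1) : IsStep s u (step s u) :=
  (exists_isStep s u.2.1 u.2.2).choose_spec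

lemma step_mono (s : stdSimplex ℝ (Fin (n + 1))) : Monotone (step s) := fun u v h =>
  (isStep_step s u).mono (isStep_step s v) h

lemma step_map (s : stdSimplex ℝ (Fin (m + 1))) (u : Set.Ico (0 : ℝ) 1)
    {f : Fin (m + 1) → Fin (n + 1)} (hf : Monotone f) :
    step (stdSimplex.map f s) u = f (step s u) :=
  (isStep_step _ u).unique ((isStep_step s u).map hf)

/-- The left end of the `i`-th subinterval is a witness. For an interior point of the simplex every
vertex is thus a value, and the step function sees the whole string. -/
lemma exists_step_eq {s : stdSimplex ℝ (Fin (n + 1))} {i : Fin (n + 1)} (h : 0 < s i) :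
    ∃ u, step s u = i := by
  have h1 := cumLt_add s i
  refine ⟨⟨cumLt s i, Finset.sum_nonneg fun _ _ => s.2.1 _, ?_⟩, ?_⟩
  · have := cum_le_one s i
    linarith
  · exact (isStep_step _ _).unique ⟨le_rfl, by linarith⟩

/-- Slightly to the right of any point, the value of a step function is locally constant. -/
lemma eventually_step (s : stdSimplex ℝ (Fin (n + 1))) (u : Set.Ico (0 : ℝ) 1) :
    ∀ᶠ ε in 𝓝[>] (0 : ℝ), ∀ (h : (u : ℝ) + ε ∈ Set.Ico (0 : ℝ) 1),
      ∀ᶠ s' in 𝓝 s, step s' ⟨u + ε, h⟩ = step s u := by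
  have hs := isStep_step s u
  have h1 : (0 : ℝ) < cum s (step s u) - u := sub_pos.2 hs.lt
  filter_upwards [self_mem_nhdsWithin, mem_nhdsWithin_of_mem_nhds (Iio_mem_nhds h1)]
    with ε hε0 hε1 h
  -- The point `u` may be a left end point, where the value can jump when `s` moves. Slightly to the
  -- right both inequalities are strict, hence stable.
  have h2 : cumLt s (step s u) < u + ε := hs.le.trans_lt (lt_add_of_pos_right _ hε0)
  have h3 : u + ε < cum s (step s u) := by
    have : ε < cum s (step s u) - u := hε1
    linarith
  filter_upwards [(continuous_cumLt (step s u)).continuousAt.eventually_lt_const h2,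
    (continuous_cum (step s u)).continuousAt.eventually_const_lt h3] with s' h4 h5
  exact (isStep_step s' _).unique ⟨h4.le, h5⟩

/-- The point with prescribed partial sums. -/
lemma exists_cum_eq {p : ℕ} (b : Fin (p + 1) → ℝ) (hb : StrictMono b) (h0 : 0 < b 0)
    (h1 : b (Fin.last p) = 1) : ∃ τ : stdSimplex ℝ (Fin (p + 1)),
      (∀ k, cum τ k = b k) ∧ (∀ k, 0 < τ k) := by
  -- This is `b` shifted by one with a leading `0`, so that the coordinates are consecutive
  -- differences and their sums telescope.
  let c : ℕ → ℝ := fun k => if h : 0 < k ∧ k - 1 < p + 1 then b ⟨k - 1, h.2⟩ else 0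
  have hc0 : c 0 = 0 := by simp [c]
  have hcs : ∀ k : Fin (p + 1), c (k.1 + 1) = b k := by
    intro k
    exact dif_pos (c := 0 < k.1 + 1 ∧ k.1 + 1 - 1 < p + 1) ⟨k.1.succ_pos, k.2⟩
  let t : Fin (p + 1) → ℝ := fun k => c (k.1 + 1) - c k.1
  have hsum : ∀ k : Fin (p + 1), ∑ j ∈ Finset.Iic k, t j = b k := by
    intro k
    have h2 : ∑ j ∈ Finset.Iic k, t j = ∑ j ∈ (Finset.Iic k).map Fin.valEmbedding,
        (c (j + 1) - c j) := by
      rw [Finset.sum_map]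
      rfl
    rw [h2, Fin.map_valEmbedding_Iic, ← Nat.range_succ_eq_Iic, Finset.sum_range_sub, hc0, sub_zero,
      hcs]
  have hpos : ∀ k, 0 < t k := by
    intro k
    simp only [t]
    rw [hcs]
    rcases Fin.eq_zero_or_eq_succ k with rfl | ⟨j, rfl⟩
    · simpa [hc0] using h0
    · have := hcs j.castSucc
      simp only [Fin.val_castSucc] at this
      rw [Fin.val_succ, this, sub_pos]
      exact hb Fin.castSucc_lt_succ
  refine ⟨⟨t, fun k => (hpos k).le, ?_⟩, hsum, hpos⟩
  rw [← h1, ← hsum]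
  congr 1
  ext i
  simp [Fin.le_last]

/-- Finitely many points of simplices are degeneracies of a common interior point of a simplex. -/
lemma exists_refinement {I : Type} [Fintype I] (n : I → ℕ)
    (s : ∀ i, stdSimplex ℝ (Fin (n i + 1))) : ∃ p < 1 + ∑ i, (n i + 1),
      ∃ (τ : stdSimplex ℝ (Fin (p + 1))) (θ : ∀ i, Fin (p + 1) →o Fin (n i + 1)),
        (∀ k, 0 < τ k) ∧ ∀ i, stdSimplex.map (θ i) τ = s i := by
  classical
  -- The common break points. Dropping `0` makes all subintervals of `τ` nondegenerate, and
  -- inserting `1` covers the empty family.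
  let B : Finset ℝ := (insert 1 (Finset.univ.biUnion fun i => Finset.univ.image (cum (s i)))).filter
    fun x => 0 < x
  have hB1 : (1 : ℝ) ∈ B := by simp [B]
  have hBle : ∀ x ∈ B, x ≤ 1 := by
    intro x hx
    simp only [B, Finset.mem_filter, Finset.mem_insert, Finset.mem_biUnion, Finset.mem_univ,
      Finset.mem_image, true_and] at hx
    rcases hx.1 with rfl | ⟨i, j, rfl⟩
    · exact le_rfl
    · exact cum_le_one _ _
  have hBpos : ∀ x ∈ B, 0 < x := fun x hx => (Finset.mem_filter.1 hx).2
  have hBcum : ∀ i j, 0 < cum (s i) j → cum (s i) j ∈ B := fun i j h =>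
    Finset.mem_filter.2 ⟨Finset.mem_insert_of_mem (Finset.mem_biUnion.2 ⟨i, Finset.mem_univ _,
      Finset.mem_image.2 ⟨j, Finset.mem_univ _, rfl⟩⟩), h⟩
  -- The bound depends on the dimensions only, so that finitely many pairs `(p, θ)` suffice for a
  -- whole family of points.
  have hcard : B.card ≤ 1 + ∑ i, (n i + 1) := by
    refine (Finset.card_filter_le _ _).trans ((Finset.card_insert_le _ _).trans ?_)
    rw [add_comm]
    refine Nat.add_le_add_left (Finset.card_biUnion_le.trans (Finset.sum_le_sum fun i _ => ?_)) _
    exact Finset.card_image_le.trans (by simp)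
  obtain ⟨p, hp⟩ : ∃ p, B.card = p + 1 := Nat.exists_eq_succ_of_ne_zero (Finset.card_ne_zero_of_mem hB1)
  let b := B.orderEmbOfFin hp
  have hbB : ∀ k, b k ∈ B := fun k => Finset.orderEmbOfFin_mem B hp k
  have hbsurj : ∀ x ∈ B, ∃ k, b k = x := by
    intro x hx
    have : x ∈ Set.range b := by
      rw [Finset.range_orderEmbOfFin]
      exact hx
    exact this
  have hlast : b (Fin.last p) = 1 := by
    obtain ⟨k, hk⟩ := hbsurj 1 hB1
    refine le_antisymm (hBle _ (hbB _)) ?_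
    rw [← hk]
    exact b.monotone (Fin.le_last k)
  obtain ⟨τ, hτ, hpos⟩ := exists_cum_eq b b.strictMono (hBpos _ (hbB 0)) hlast
  have hu : ∀ k, cumLt τ k ∈ Set.Ico (0 : ℝ) 1 := by
    intro k
    refine ⟨Finset.sum_nonneg fun _ _ => τ.2.1 _, ?_⟩
    have := cumLt_add τ k
    have := cum_le_one τ k
    linarith [hpos k]
  have humono : ∀ k l, k ≤ l → cumLt τ k ≤ cumLt τ l := fun k l h =>
    Finset.sum_le_sum_of_subset_of_nonneg (Finset.Iio_subset_Iio h) fun _ _ _ => τ.2.1 _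
  -- The step function of `s i` is constant on each subinterval of `τ`; `θ i` records its value at
  -- the left end.
  refine ⟨p, by omega, τ, fun i => ⟨fun k => step (s i) ⟨_, hu k⟩, fun k l h =>
    step_mono _ (humono k l h)⟩, hpos, fun i => ext_cum fun j => ?_⟩
  rw [cum_map]
  change ∑ k with step (s i) ⟨cumLt τ k, hu k⟩ ≤ j, τ k = _
  simp only [(isStep_step (s i) _).le_iff]
  rcases (cum_nonneg (s i) j).eq_or_lt with h0 | h0
  · rw [← h0]
    refine Finset.sum_eq_zero fun k hk => ?_
    exact absurd (Finset.mem_filter.1 hk).2 (not_lt.2 (hu k).1)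
  · obtain ⟨l, hl⟩ := hbsurj _ (hBcum i j h0)
    rw [← hl, ← hτ l, cum]
    congr 1
    ext k
    simp only [Finset.mem_filter, Finset.mem_univ, true_and, Finset.mem_Iic]
    constructor
    · intro h
      by_contra hkl
      exact absurd h (not_lt.2 (cum_le_cumLt τ (not_le.1 hkl)))
    · intro h
      have h1 := cum_mono τ h
      have h2 := cumLt_add τ k
      change _ < cum τ l
      linarith [hpos k]

end SimplexPoint

end

noncomputable section

/-! ## Strings of composable morphisms -/

section Arrows

universe v w v' w'

variable {C : Type w} [Category.{v} C]

/-- An equality of arrows contains the equality of the end points, so no transport along equalities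
of objects has to be written. -/
lemma functor_ext_of_arrow {D : Type w'} [Category.{v'} D] {F G : C ⥤ D}
    (h : ∀ {a b : C} (f : a ⟶ b), Arrow.mk (F.map f) = Arrow.mk (G.map f)) : F = G := by
  have hobj : ∀ a, F.obj a = G.obj a := fun a => congrArg (fun g : Arrow D => g.left) (h (𝟙 a))
  refine CategoryTheory.Functor.hext hobj fun a b f => ?_
  obtain ⟨h1, h2, h3⟩ := (Arrow.mk_eq_mk_iff _ _).1 (h f)
  rw [h3]
  simp

namespace CategoryTheory.ComposableArrows

/-- The composites of a string of composable morphisms. -/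
def arr {n : ℕ} (x : ComposableArrows C n) {i j : Fin (n + 1)} (h : i ≤ j) : Arrow C :=
  Arrow.mk (x.map (homOfLE h))

/-- Restriction of a string of composable morphisms along a monotone map. -/
def pull {n p : ℕ} (x : ComposableArrows C n) (θ : Fin (p + 1) →o Fin (n + 1)) :
    ComposableArrows C p :=
  θ.monotone.functor ⋙ x

lemma ext_arr {n : ℕ} {x y : ComposableArrows C n}
    (h : ∀ (i j : Fin (n + 1)) (hij : i ≤ j), x.arr hij = y.arr hij) : x = y :=
  functor_ext_of_arrow fun f => h _ _ (leOfHom f)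

end CategoryTheory.ComposableArrows

end Arrows

/-! ## Points and test maps of realizations -/

open SimplexPoint

namespace TopCategory

variable (A : TopCategory.{u}) {B : TopCategory.{u}}

instance (n : SimplexCategory) : CompactlyGeneratedSpace ((nerve A.Ob).obj (Opposite.op n)) :=
  @compactlyGeneratedSpace_compactlyGenerated (ComposableArrows A.Ob n.len) (induced _ _)

instance : CompactlyGeneratedSpace A.PreRealization :=
  have (n : SimplexCategory) : CompactlyGeneratedSpace
      ((nerve A.Ob).obj (Opposite.op n) × stdSimplex ℝ (Fin (n.len + 1))) :=
    compactlyGeneratedSpace_prod'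
  inferInstanceAs (CompactlyGeneratedSpace (Σ n : SimplexCategory,
    (nerve A.Ob).obj (Opposite.op n) × stdSimplex ℝ (Fin (n.len + 1))))

lemma isQuotientMap_mk : Topology.IsQuotientMap (Quot.mk A.RealizationRel) := isQuotientMap_quot_mk

instance : CompactlyGeneratedSpace A.Realization :=
  compactlyGeneratedSpace_of_coinduced A.isQuotientMap_mk.continuous
    A.isQuotientMap_mk.eq_coinduced

variable {A}

lemma continuous_nerve_iff {K : Type u} [TopologicalSpace K] [CompactSpace K] [T2Space K]
    {n : SimplexCategory} {x : K → (nerve A.Ob).obj (Opposite.op n)} :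
    Continuous x ↔ ∀ (i j : Fin (n.len + 1)) (h : i ≤ j),
      Continuous fun k => ComposableArrows.arr (n := n.len) (x k) h := by
  refine (@continuous_to_compactlyGenerated (ComposableArrows A.Ob n.len) (induced _ _) K
    _ _ _ x).trans (continuous_induced_rng.trans (continuous_pi_iff.trans ?_))
  exact ⟨fun h i j hij => h ⟨(i, j), hij⟩, fun h p => h _ _ p.2⟩

namespace Realization

/-- The point of the realization given by a simplex of the nerve and a point of the standard
simplex. -/
def mk {n : ℕ} (x : ComposableArrows A.Ob n) (s : stdSimplex ℝ (Fin (n + 1))) : A.Realization :=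
  Quot.mk _ ⟨SimplexCategory.mk n, (x, s)⟩

lemma exists_mk (z : A.Realization) :
    ∃ (n : ℕ) (x : ComposableArrows A.Ob n) (s : stdSimplex ℝ (Fin (n + 1))), z = mk x s := by
  obtain ⟨⟨n, x, s⟩, rfl⟩ := Quot.exists_rep z
  exact ⟨n.len, x, s, rfl⟩

lemma mk_pull {n p : ℕ} (x : ComposableArrows A.Ob n) (θ : Fin (p + 1) →o Fin (n + 1))
    (τ : stdSimplex ℝ (Fin (p + 1))) : mk (x.pull θ) τ = mk x (stdSimplex.map θ τ) :=
  Quot.sound (RealizationRel.glue (A := A) (m := SimplexCategory.mk p) (n := SimplexCategory.mk n)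
    (SimplexCategory.Hom.mk θ) x τ)

/-- A point of the realization as a functor on the interval `[0, 1)`, piecewise constant. -/
def ev (z : A.Realization) {u v : Set.Ico (0 : ℝ) 1} (h : u ≤ v) : Arrow A.Ob :=
  Quot.lift (fun p : A.PreRealization =>
    ComposableArrows.arr (n := p.1.len) p.2.1 (step_mono p.2.2 h)) (by
    rintro _ _ ⟨θ, x, t⟩
    -- Both representatives give the same composite because `θ` acts on step functions by
    -- composition.
    have e : ∀ u, step (stdSimplex.map θ t) u = θ (step t u) := fun u =>
      step_map t u (SimplexCategory.Hom.toOrderHom θ).monotone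
    change ComposableArrows.arr _ _ = ComposableArrows.arr _ _
    have key : ∀ (i j) (hij : i ≤ j) (i' j') (hij' : i' ≤ j'), i' = θ i → j' = θ j →
        ComposableArrows.arr (n := _) ((nerve A.Ob).map θ.op x) hij =
          ComposableArrows.arr (n := _) x hij' := by
      rintro i j hij _ _ hij' rfl rfl
      rfl
    exact key _ _ _ _ _ _ (e u) (e v)) z

lemma ev_mk {n : ℕ} (x : ComposableArrows A.Ob n) (s : stdSimplex ℝ (Fin (n + 1)))
    {u v : Set.Ico (0 : ℝ) 1} (h : u ≤ v) : (mk x s).ev h = x.arr (step_mono s h) := rfl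

lemma ev_realizationMap (G : A.Ob ⥤ B.Ob) (z : A.Realization) {u v : Set.Ico (0 : ℝ) 1}
    (h : u ≤ v) : (realizationMap G z : B.Realization).ev h = G.mapArrow.obj (z.ev h) := by
  obtain ⟨n, x, s, rfl⟩ := exists_mk z
  rfl

/-- Finitely many points are represented by the same interior point of a simplex. -/
lemma exists_common {I : Type} [Finite I] {A : I → TopCategory.{u}} (z : ∀ i, (A i).Realization) :
    ∃ (p : ℕ) (x : ∀ i, ComposableArrows (A i).Ob p) (τ : stdSimplex ℝ (Fin (p + 1))),
      (∀ k, 0 < τ k) ∧ ∀ i, z i = mk (x i) τ := by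
  have := Fintype.ofFinite I
  choose n x s hz using fun i => exists_mk (z i)
  obtain ⟨p, -, τ, θ, hτ, hθ⟩ := exists_refinement n s
  exact ⟨p, fun i => (x i).pull (θ i), τ, hτ, fun i => by rw [hz i, mk_pull, hθ i]⟩

/-- The two points are represented over one interior point `τ` of a simplex. Every vertex is a value
of the step function of `τ`, so evaluation recovers all composites of both strings. -/
lemma ext_ev {z z' : A.Realization}
    (h : ∀ (u v : Set.Ico (0 : ℝ) 1) (huv : u ≤ v), z.ev huv = z'.ev huv) : z = z' := by
  obtain ⟨p, x, τ, hτ, hz⟩ := exists_common (I := Bool) (A := fun _ => A) fun b => bif b then z else z'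
  have h1 : z = mk (x true) τ := hz true
  have h2 : z' = mk (x false) τ := hz false
  subst h1 h2
  congr 1
  refine ComposableArrows.ext_arr fun i j hij => ?_
  obtain ⟨u, rfl⟩ := exists_step_eq (hτ i)
  obtain ⟨v, rfl⟩ := exists_step_eq (hτ j)
  rcases le_total u v with huv | hvu
  · exact h u v huv
  -- Here the order of the vertices forces them to agree, so the composite can be read off at the
  -- single parameter `u`.
  · have e : step τ u = step τ v := le_antisymm hij (step_mono τ hvu)
    have key : ∀ (i j) (hij : i ≤ j) (hji : j = i), (x true).arr hij = (x false).arr hij ↔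
        (x true).arr (le_refl i) = (x false).arr (le_refl i) := by
      rintro i _ hij rfl
      rfl
    exact (key _ _ _ e.symm).2 (h u u le_rfl)

lemma continuous_mk {K : Type u} [TopologicalSpace K] [CompactSpace K] [T2Space K] {n : ℕ}
    {x : K → ComposableArrows A.Ob n} {s : K → stdSimplex ℝ (Fin (n + 1))}
    (hx : ∀ (i j : Fin (n + 1)) (h : i ≤ j), Continuous fun k => (x k).arr h)
    (hs : Continuous s) : Continuous fun k => mk (x k) (s k) := by
  have h1 := (continuous_nerve_iff (A := A) (n := SimplexCategory.mk n) (x := x)).2 hx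
  exact A.isQuotientMap_mk.continuous.comp ((continuous_sigmaMk
    (σ := fun n : SimplexCategory =>
      (nerve A.Ob).obj (Opposite.op n) × stdSimplex ℝ (Fin (n.len + 1)))
    (i := SimplexCategory.mk n)).comp (h1.prodMk hs))

/-- Continuity on families of simplices may be checked on families with the same simplicial
coordinates. -/
lemma continuous_of_refinement {I : Type} [Finite I] {A : I → TopCategory.{u}} {W Z : Type*}
    [TopologicalSpace W] [TopologicalSpace Z] (g : W → (∀ i, (A i).Realization) → Z)
    (h : ∀ (K : Type u) [TopologicalSpace K] [CompactSpace K] [T2Space K] (w : K → W) (p : ℕ)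
      (x : ∀ i, K → ComposableArrows (A i).Ob p) (τ : K → stdSimplex ℝ (Fin (p + 1))),
      Continuous w → (∀ i (a b : Fin (p + 1)) (hab : a ≤ b), Continuous fun k => (x i k).arr hab) →
        Continuous τ → Continuous fun k => g (w k) fun i => mk (x i k) (τ k))
    {K : Type u} [TopologicalSpace K] [CompactSpace K] [T2Space K] {w : K → W} (hw : Continuous w)
    {n : I → ℕ} {x : ∀ i, K → ComposableArrows (A i).Ob (n i)}
    {s : ∀ i, K → stdSimplex ℝ (Fin (n i + 1))}
    (hx : ∀ i (a b : Fin (n i + 1)) (hab : a ≤ b), Continuous fun k => (x i k).arr hab)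
    (hs : ∀ i, Continuous (s i)) : Continuous fun k => g (w k) fun i => mk (x i k) (s i k) := by
  have := Fintype.ofFinite I
  let J := Σ p : Fin (1 + ∑ i, (n i + 1)), ∀ i, (Fin (p.1 + 1) →o Fin (n i + 1))
  have (a b : ℕ) : Finite (Fin a →o Fin b) :=
    Finite.of_injective (fun f => (f : Fin a → Fin b)) DFunLike.coe_injective
  have : Finite J := inferInstanceAs (Finite (Σ p : Fin _, _))
  -- The piece `V j` consists of the parameters together with a common subdivision of combinatorial
  -- type `j`. The finitely many `V j` are compact and their projections cover `K`.
  let V : ∀ j : J, Set (K × stdSimplex ℝ (Fin (j.1.1 + 1))) :=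
    fun j => {v | ∀ i, stdSimplex.map (j.2 i) v.2 = s i v.1}
  have hV : ∀ j, IsClosed (V j) := by
    intro j
    simp only [V, Set.ofPred_forall]
    exact isClosed_iInter fun i => isClosed_eq
      ((stdSimplex.continuous_map _).comp continuous_snd) ((hs i).comp continuous_fst)
  have hVc : ∀ j, CompactSpace (V j) := fun j => isCompact_iff_compactSpace.1 (hV j).isCompact
  have hcont : ∀ j, Continuous fun v : V j => g (w v.1.1) fun i => mk (x i v.1.1) (s i v.1.1) := by
    intro j
    have := h (V j) (fun v => w v.1.1) j.1.1 (fun i v => (x i v.1.1).pull (j.2 i)) (fun v => v.1.2)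
      (hw.comp (continuous_fst.comp continuous_subtype_val))
      (fun i a b hab => (hx i _ _ ((j.2 i).monotone hab)).comp
        (continuous_fst.comp continuous_subtype_val))
      (continuous_snd.comp continuous_subtype_val)
    refine this.congr fun v => ?_
    congr 1
    funext i
    rw [mk_pull, v.2 i]
  rw [continuous_iff_isClosed]
  intro C hC
  -- A closed set thus has as preimage a finite union of images of compact sets.
  have hU : (fun k => g (w k) fun i => mk (x i k) (s i k)) ⁻¹' C =
      ⋃ j : J, (fun v : V j => v.1.1) ''
        ((fun v : V j => g (w v.1.1) fun i => mk (x i v.1.1) (s i v.1.1)) ⁻¹' C) := by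
    ext k
    simp only [Set.mem_preimage, Set.mem_iUnion, Set.mem_image]
    constructor
    · intro hk
      obtain ⟨p, hp, τ, θ, -, hθ⟩ := exists_refinement n fun i => s i k
      exact ⟨⟨⟨p, hp⟩, θ⟩, ⟨(k, τ), hθ⟩, hk, rfl⟩
    · rintro ⟨j, v, hv, rfl⟩
      exact hv
  rw [hU]
  refine isClosed_iUnion_of_finite fun j => ?_
  exact ((hC.preimage (hcont j)).isCompact.image
    (continuous_fst.comp continuous_subtype_val)).isClosed

/-- Continuity on test maps into a finite product of realizations may be checked on families of
simplices with the same simplicial coordinates. -/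
lemma continuous_of_simplices {I : Type} [Finite I] {A : I → TopCategory.{u}} {W Z : Type*}
    [TopologicalSpace W] [TopologicalSpace Z] (g : W → (∀ i, (A i).Realization) → Z)
    (h : ∀ (K : Type u) [TopologicalSpace K] [CompactSpace K] [T2Space K] (w : K → W) (p : ℕ)
      (x : ∀ i, K → ComposableArrows (A i).Ob p) (τ : K → stdSimplex ℝ (Fin (p + 1))),
      Continuous w → (∀ i (a b : Fin (p + 1)) (hab : a ≤ b), Continuous fun k => (x i k).arr hab) →
        Continuous τ → Continuous fun k => g (w k) fun i => mk (x i k) (τ k))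
    {K : Type u} [TopologicalSpace K] [CompactSpace K] [T2Space K] {w : K → W} (hw : Continuous w)
    {z : ∀ i, K → (A i).Realization} (hz : ∀ i, Continuous (z i)) :
    Continuous fun k => g (w k) fun i => z i k := by
  refine continuous_pi_of_quotient (fun i => (A i).isQuotientMap_mk) g ?_ K w hw z hz
  intro K _ _ _ w y hw hy
  -- After lifting to disjoint unions of simplices, the dimensions are locally constant and may be
  -- fixed.
  have hc : ∀ d : I → SimplexCategory, IsOpen {k | (fun i => (y i k).1) = d} := by
    intro d
    simp only [funext_iff, Set.ofPred_forall]
    exact isOpen_iInter_of_finite fun i => (isClopen_sigma_fst (hy i) (d i)).2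
  refine continuous_of_fibres (fun k i => (y i k).1) hc fun d => ?_
  have := compactSpace_fibre hc d
  choose xs hxs hyx using fun i => exists_sigma_lift ((hy i).comp continuous_subtype_val) (d i)
    fun l : {k // (fun i => (y i k).1) = d} => congrFun l.2 i
  refine (continuous_of_refinement g h (hw.comp continuous_subtype_val)
    (x := fun i k => (xs i k).1) (fun i => continuous_nerve_iff.1 (hxs i).fst)
    fun i => (hxs i).snd).congr fun l => ?_
  refine congrArg (g (w l)) (funext fun i => ?_)
  exact (congrArg (Quot.mk (A i).RealizationRel) (hyx i l)).symm

/-- It suffices to treat two families of strings over the same family `τ` of points of a simplex. If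
the points at `k` differ, they differ under evaluation at some `u ≤ v`, that is, in one composite of
the strings; that composite still differs near `k` by the hypothesis on arrows. -/
lemma kT2 (hA : KT2.{u} (Arrow A.Ob)) : KT2.{u} A.Realization where
  isClosed_eq K _ _ _ z z' hz hz' := by
    rw [← isOpen_compl_iff]
    refine continuous_Prop.1 ?_
    have key := continuous_of_simplices (I := Bool) (A := fun _ => A) (W := PUnit.{1}) (Z := Prop)
      (fun _ z => z true ≠ z false) ?_ (K := K) (w := fun _ => PUnit.unit) continuous_const
      (z := fun b => bif b then z else z') (by rintro (_ | _) <;> assumption)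
    · exact key
    · clear hz hz' z z'
      intro K _ _ _ w p x τ _ hx hτ
      rw [continuous_Prop, isOpen_iff_mem_nhds]
      intro k hk
      have hk' : ∃ (u v : Set.Ico (0 : ℝ) 1) (huv : u ≤ v),
          (mk (x true k) (τ k)).ev huv ≠ (mk (x false k) (τ k)).ev huv := by
        by_contra! hall
        exact hk (ext_ev hall)
      obtain ⟨u, v, huv, hne⟩ := hk'
      have hsmall : ∀ᶠ ε in 𝓝[>] (0 : ℝ), (v : ℝ) + ε < 1 := by
        have : (0 : ℝ) < 1 - v := sub_pos.2 v.2.2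
        filter_upwards [mem_nhdsWithin_of_mem_nhds (Iio_mem_nhds this)] with ε hε
        have : ε < 1 - v := hε
        linarith
      -- At `u` and `v` themselves the step function of `τ l` can jump as `l` varies. At `u + ε` and
      -- `v + ε` it keeps, for `l` near `k`, the values it has at `u` and `v` for `k`.
      obtain ⟨ε, hv1, h0, hu, hv⟩ := (hsmall.and ((eventually_mem_nhdsWithin).and
        ((eventually_step (τ k) u).and (eventually_step (τ k) v)))).exists
      have h0 : (0 : ℝ) < ε := h0
      have huv' : (u : ℝ) ≤ v := huv
      have hv2 : (v : ℝ) + ε ∈ Set.Ico (0 : ℝ) 1 := ⟨by linarith [v.2.1], hv1⟩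
      have hu2 : (u : ℝ) + ε ∈ Set.Ico (0 : ℝ) 1 := ⟨by linarith [u.2.1], by linarith⟩
      have huv2 : (⟨u + ε, hu2⟩ : Set.Ico (0 : ℝ) 1) ≤ ⟨v + ε, hv2⟩ := by
        change (u : ℝ) + ε ≤ v + ε
        linarith
      have hij := step_mono (τ k) huv
      have hopen := (hA.isClosed_eq K (fun l => (x true l).arr hij) (fun l => (x false l).arr hij)
        (hx true _ _ hij) (hx false _ _ hij)).isOpen_compl
      filter_upwards [hopen.mem_nhds hne, hτ.continuousAt.eventually (hu hu2),
        hτ.continuousAt.eventually (hv hv2)] with l h1 h2 h3 h4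
      apply h1
      have h5 := congrArg (fun z : A.Realization => z.ev huv2) h4
      simp only [ev_mk] at h5
      have gen : ∀ (i j i' j') (h : i ≤ j) (h' : i' ≤ j'), i' = i → j' = j →
          (x true l).arr h' = (x false l).arr h' → (x true l).arr h = (x false l).arr h := by
        rintro i j _ _ h h' rfl rfl e
        exact e
      exact gen _ _ _ _ _ _ h2 h3 h5

lemma cgwh (hA : KT2.{u} (Arrow A.Ob)) : CGWHSpace A.Realization :=
  CGWHSpace.of_kT2 inferInstance (kT2 hA)

lemma continuous_realizationMap {G : A.Ob ⥤ B.Ob}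
    (hG : KContinuous fun g : Arrow A.Ob => G.mapArrow.obj g) :
    Continuous (realizationMap G : A.Realization → B.Realization) := by
  refine continuous_of_test fun K _ _ _ z hz => ?_
  refine continuous_of_simplices (I := PUnit.{1}) (A := fun _ => A) (W := PUnit.{1})
    (fun _ z => (realizationMap G (z PUnit.unit) : B.Realization)) ?_ (w := fun _ => PUnit.unit)
    continuous_const (z := fun _ => z) fun _ => hz
  intro K _ _ _ w p x τ _ hx hτ
  exact continuous_mk (x := fun k => (x PUnit.unit k ⋙ G : ComposableArrows B.Ob p))
    (fun i j h => hG.comp_test (hx PUnit.unit i j h)) hτ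

lemma realizationMap_congr {G G' : A.Ob ⥤ B.Ob}
    (h : ∀ g : Arrow A.Ob, G.mapArrow.obj g = G'.mapArrow.obj g) (z : A.Realization) :
    (realizationMap G z : B.Realization) = realizationMap G' z := by
  refine ext_ev fun u v huv => ?_
  rw [ev_realizationMap, ev_realizationMap, h]

lemma realizationMap_id (z : A.Realization) : realizationMap (𝟭 A.Ob) z = z :=
  ext_ev fun u v huv => by
    rw [ev_realizationMap]
    rfl

lemma realizationMap_comp {D : TopCategory.{u}} (G : A.Ob ⥤ B.Ob) (H : B.Ob ⥤ D.Ob)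
    (z : A.Realization) : (realizationMap (G ⋙ H) z : D.Realization) =
      realizationMap H (realizationMap G z : B.Realization) :=
  ext_ev fun u v huv => by
    rw [ev_realizationMap, ev_realizationMap, ev_realizationMap]
    rfl

/-! ## Maps out of products of realizations -/

/-- `L` sends families of strings of composable morphisms to strings of composable morphisms. -/
def IsMultifunctor {I : Type} {A : I → TopCategory.{u}} {B : TopCategory.{u}}
    (L : (∀ i, Arrow (A i).Ob) → Arrow B.Ob) : Prop :=
  ∀ (p : ℕ) (x : ∀ i, ComposableArrows (A i).Ob p), ∃ y : ComposableArrows B.Ob p,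
    ∀ (a b : Fin (p + 1)) (h : a ≤ b), y.arr h = L fun i => (x i).arr h

section Multi

variable {I : Type} [Finite I] {A : I → TopCategory.{u}} {B : TopCategory.{u}}
  {L : (∀ i, Arrow (A i).Ob) → Arrow B.Ob}

/-- With all the points represented over a common point of one simplex, `L` is applied to the
strings componentwise. -/
lemma exists_multiMap (hL : IsMultifunctor L) (z : ∀ i, (A i).Realization) :
    ∃ w : B.Realization, ∀ (u v : Set.Ico (0 : ℝ) 1) (h : u ≤ v),
      w.ev h = L fun i => (z i).ev h := by
  obtain ⟨p, x, τ, -, hz⟩ := exists_common z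
  obtain rfl : z = fun i => mk (x i) τ := funext hz
  obtain ⟨y, hy⟩ := hL p x
  exact ⟨mk y τ, fun u v h => hy _ _ _⟩

/-- The map of realizations that a functor of several variables induces. -/
def multiMap (hL : IsMultifunctor L) (z : ∀ i, (A i).Realization) : B.Realization :=
  (exists_multiMap hL z).choose

lemma ev_multiMap (hL : IsMultifunctor L) (z : ∀ i, (A i).Realization) {u v : Set.Ico (0 : ℝ) 1}
    (h : u ≤ v) : (multiMap hL z).ev h = L fun i => (z i).ev h :=
  (exists_multiMap hL z).choose_spec u v h

/-- For families of strings with common simplicial coordinates the value is an explicit simplex, by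
`ext_ev`, and its composites depend continuously on the parameter. -/
lemma continuous_multiMap (hL : IsMultifunctor L) (hLc : KContinuous L) {K : Type u}
    [TopologicalSpace K] [CompactSpace K] [T2Space K] {z : ∀ i, K → (A i).Realization}
    (hz : ∀ i, Continuous (z i)) : Continuous fun k => multiMap hL fun i => z i k := by
  refine continuous_of_simplices (W := PUnit.{1}) (fun _ z => multiMap hL z) ?_
    (w := fun _ => PUnit.unit) continuous_const hz
  intro K _ _ _ w p x τ _ hx hτ
  choose y hy using fun k => hL p fun i => x i k
  have h1 : ∀ k, (multiMap hL fun i => mk (x i k) (τ k)) = mk (y k) (τ k) := fun k =>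
    ext_ev fun u v h => (ev_multiMap hL _ h).trans (hy k _ _ (step_mono (τ k) h)).symm
  simp only [h1]
  refine continuous_mk (fun i j h => ?_) hτ
  simp only [hy]
  exact hLc.comp_test (continuous_pi fun a => hx a i j h)

end Multi

end Realization

end TopCategory

end

noncomputable section

open SimplexPoint

namespace TopCategory

/-! ## Products -/

namespace Realization

/-- Geometric realization preserves finite products. -/
lemma exists_homeomorph_prod {I : Type} [Finite I] {A : I → TopCategory.{u}} {D : TopCategory.{u}}
    (p : ∀ i, D.Ob ⥤ (A i).Ob) (hp : ∀ i, KContinuous fun g : Arrow D.Ob => (p i).mapArrow.obj g)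
    {L : (∀ i, Arrow (A i).Ob) → Arrow D.Ob} (hL : IsMultifunctor L) (hLc : KContinuous L)
    (h₁ : ∀ g i, (p i).mapArrow.obj (L g) = g i)
    (h₂ : ∀ g, (L fun i => (p i).mapArrow.obj g) = g) :
    ∃ e : D.Realization ≃ₜ KSpace (∀ i, (A i).Realization),
      ∀ z, e z = fun i => realizationMap (p i) z := by
  have hl : ∀ z : D.Realization, (multiMap hL fun i => realizationMap (p i) z) = z := by
    refine fun z => ext_ev fun u v h => ?_
    rw [ev_multiMap]
    simp only [ev_realizationMap]
    exact h₂ _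
  have hr : ∀ (z : ∀ i, (A i).Realization) (i : I),
      (realizationMap (p i) (multiMap hL z) : (A i).Realization) = z i := by
    refine fun z i => ext_ev fun u v h => ?_
    rw [ev_realizationMap, ev_multiMap, h₁]
  have hcl : Continuous[_, KSpace.instTopologicalSpace _]
      fun (z : D.Realization) i => (realizationMap (p i) z : (A i).Realization) :=
    continuous_of_test fun K _ _ _ z hz => continuous_to_kSpace.2 (continuous_pi fun i =>
      (continuous_realizationMap (hp i)).comp hz)
  have hcr : Continuous fun z : KSpace (∀ i, (A i).Realization) => multiMap hL (id z) := by
    refine continuous_of_test fun K _ _ _ z hz => ?_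
    exact continuous_multiMap hL hLc (z := fun i k => z k i)
      fun i => (continuous_apply i).comp (continuous_to_kSpace.1 hz)
  exact ⟨⟨⟨fun z i => realizationMap (p i) z, fun z => multiMap hL (id z), hl,
    fun z => funext (hr z)⟩, hcl, hcr⟩, fun _ => rfl⟩

end Realization

/-! ## Homotopies from natural transformations -/

/-- The category `0 → 1` as a discrete topological category. -/
def walkingArrow : TopCategory.{u} where
  Ob := ULift.{u} (Fin 2)
  topOb := ⊥
  topMor := ⊥

/-- The functor to the ordinal `[1]`. -/
def walkingArrowDown : walkingArrow.{u}.Ob ⥤ Fin 2 :=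
  Monotone.functor (X := ULift.{u} (Fin 2)) (f := ULift.down) fun _ _ h => h

/-- The functor from the ordinal `[1]`. -/
def walkingArrowUp : ComposableArrows walkingArrow.{u}.Ob 1 :=
  Monotone.functor (Y := ULift.{u} (Fin 2)) (f := ULift.up) fun _ _ h => h

/-- The point of the `1`-simplex with barycentric coordinates `(1 - r, r)`. -/
def pathPoint (r : unitInterval) : stdSimplex ℝ (Fin (1 + 1)) :=
  ⟨![1 - r, r], by
    refine ⟨fun i => ?_, by simp⟩
    fin_cases i
    · exact sub_nonneg.2 r.2.2
    · exact r.2.1⟩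

lemma continuous_pathPoint : Continuous pathPoint := by
  refine Continuous.subtype_mk (continuous_pi fun i => ?_) _
  fin_cases i
  · exact continuous_const.sub continuous_subtype_val
  · exact continuous_subtype_val

/-- The path in the realization of `0 → 1` between its two vertices. -/
def walkingPath (r : unitInterval) : walkingArrow.{u}.Realization :=
  Realization.mk walkingArrowUp (pathPoint r)

lemma continuous_walkingPath {K : Type u} [TopologicalSpace K] [CompactSpace K] [T2Space K]
    {r : K → unitInterval} (hr : Continuous r) : Continuous fun k => walkingPath.{u} (r k) :=
  Realization.continuous_mk (fun _ _ _ => continuous_const) (continuous_pathPoint.comp hr)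

/-- At either end of the path one weight vanishes and the step function is constant; this identifies
the ends of the homotopies with the given functors. -/
lemma step_pathPoint_zero (u : Set.Ico (0 : ℝ) 1) : step (pathPoint 0) u = 0 :=
  (isStep_step _ u).unique ⟨by
    rw [cumLt, show Finset.Iio (0 : Fin 2) = ∅ from rfl]
    exact u.2.1, by
    rw [cum, show Finset.Iic (0 : Fin 2) = {0} from rfl, Finset.sum_singleton]
    change (u : ℝ) < 1 - ((0 : unitInterval) : ℝ)
    simpa using u.2.2⟩

lemma step_pathPoint_one (u : Set.Ico (0 : ℝ) 1) : step (pathPoint 1) u = 1 :=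
  (isStep_step _ u).unique ⟨by
    rw [cumLt, show Finset.Iio (1 : Fin 2) = {0} from rfl, Finset.sum_singleton]
    change 1 - ((1 : unitInterval) : ℝ) ≤ u
    simpa using u.2.1, by
    rw [show (1 : Fin (1 + 1)) = Fin.last 1 from rfl, cum_last]
    exact u.2.2⟩

/-- The family consisting of two topological categories. -/
def pair (A W : TopCategory.{u}) : Bool → TopCategory.{u}
  | false => A
  | true => W

section Homotopy

variable {A B : TopCategory.{u}} {G H : A.Ob ⥤ B.Ob} (α : G ⟶ H)

/-- The functor on the product with `0 → 1` given by a natural transformation. -/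
def cylFunctor : walkingArrow.{u}.Ob × A.Ob ⥤ B.Ob :=
  Functor.uncurry.obj (walkingArrowDown ⋙ (ComposableArrows.mk₁ α : Fin 2 ⥤ (A.Ob ⥤ B.Ob)))

/-- The functor on the product with `0 → 1` given by a natural transformation, on morphisms. -/
def cylArrow (g : ∀ b, Arrow (pair A walkingArrow.{u} b).Ob) : Arrow B.Ob :=
  let g₀ : Arrow A.Ob := g false
  let g₁ : Arrow walkingArrow.{u}.Ob := g true
  Arrow.mk ((cylFunctor α).map (X := (g₁.left, g₀.left)) (Y := (g₁.right, g₀.right))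
    ((g₁.hom, g₀.hom) : (g₁.left, g₀.left) ⟶ (g₁.right, g₀.right)))

lemma isMultifunctor_cylArrow : Realization.IsMultifunctor (cylArrow α) := fun p x =>
  let x₀ : ComposableArrows A.Ob p := x false
  let x₁ : ComposableArrows walkingArrow.{u}.Ob p := x true
  ⟨(Functor.prod' x₁ x₀ ⋙ cylFunctor α : ComposableArrows B.Ob p), fun _ _ _ => rfl⟩

lemma kContinuous_cylFunctor (hG : KContinuous fun g : Arrow A.Ob => G.mapArrow.obj g)
    (hH : KContinuous fun g : Arrow A.Ob => H.mapArrow.obj g)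
    (hα : KContinuous fun g : Arrow A.Ob => Arrow.mk (α.app g.left ≫ H.map g.hom))
    (d : Arrow walkingArrow.{u}.Ob) : KContinuous fun g : Arrow A.Ob =>
      Arrow.mk ((cylFunctor α).map (X := (d.left, g.left)) (Y := (d.right, g.right))
        ((d.hom, g.hom) : (d.left, g.left) ⟶ (d.right, g.right))) := by
  obtain ⟨⟨i⟩, ⟨j⟩, f⟩ := d
  have hij : i ≤ j := leOfHom (X := ULift.{u} (Fin 2)) f
  -- Over the two identities of `0 → 1` the functor is `G` or `H`; over the remaining morphism it is
  -- the diagonal of the naturality square of `α`.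
  fin_cases i <;> fin_cases j
  · convert hG using 2 with g
    exact congrArg Arrow.mk (Category.id_comp (G.map g.hom))
  · exact hα
  · exact absurd hij (by decide)
  · convert hH using 2 with g
    exact congrArg Arrow.mk (Category.id_comp (H.map g.hom))

/-- The component in the discrete category `0 → 1` is locally constant on test maps, so it may be
fixed. -/
lemma kContinuous_cylArrow (hG : KContinuous fun g : Arrow A.Ob => G.mapArrow.obj g)
    (hH : KContinuous fun g : Arrow A.Ob => H.mapArrow.obj g)
    (hα : KContinuous fun g : Arrow A.Ob => Arrow.mk (α.app g.left ≫ H.map g.hom)) :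
    KContinuous (cylArrow α) := by
  refine kContinuous_iff.2 fun K _ _ _ g hg => ?_
  have h₀ : Continuous fun k => (g k false : Arrow A.Ob) := (continuous_apply false).comp hg
  have h₁ : Continuous fun k => (g k true : Arrow walkingArrow.{u}.Ob) :=
    (continuous_apply true).comp hg
  have : DiscreteTopology (Arrow walkingArrow.{u}.Ob) := ⟨rfl⟩
  have hc : ∀ d : Arrow walkingArrow.{u}.Ob,
      IsOpen {k | (g k true : Arrow walkingArrow.{u}.Ob) = d} := fun d =>
    (isOpen_discrete {d}).preimage h₁
  refine continuous_of_fibres (fun k => (g k true : Arrow walkingArrow.{u}.Ob)) hc fun d => ?_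
  let c : K → Arrow walkingArrow.{u}.Ob := fun k => g k true
  have : CompactSpace {k // c k = d} := compactSpace_fibre hc d
  have h₀' : Continuous fun k : {k // c k = d} => (g k false : Arrow A.Ob) :=
    h₀.comp continuous_subtype_val
  have key : (fun k : {k // c k = d} => cylArrow α (g k)) =
      fun k : {k // c k = d} => Arrow.mk ((cylFunctor α).map (X := (d.left, (g k false : Arrow A.Ob).left))
        (Y := (d.right, (g k false : Arrow A.Ob).right))
        ((d.hom, (g k false : Arrow A.Ob).hom) :
          (d.left, (g k false : Arrow A.Ob).left) ⟶ (d.right, (g k false : Arrow A.Ob).right))) := by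
    funext ⟨k, hk⟩
    subst hk
    rfl
  exact ((kContinuous_cylFunctor α hG hH hα d).comp_test h₀').congr
    fun k => (congrFun key k).symm

/-- The homotopy given by a natural transformation. -/
def homotopyMap (r : unitInterval) (z : A.Realization) : B.Realization :=
  Realization.multiMap (isMultifunctor_cylArrow α) fun b => match b with
    | false => z
    | true => walkingPath r

lemma cylArrow_of_eq (g₀ : Arrow A.Ob) (i : Fin 2) :
    (cylArrow α fun b => match b with
      | false => g₀
      | true => (Arrow.mk (𝟙 (⟨i⟩ : ULift.{u} (Fin 2))) : Arrow walkingArrow.{u}.Ob)) =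
      ((ComposableArrows.mk₁ α : Fin 2 ⥤ (A.Ob ⥤ B.Ob)).obj i).mapArrow.obj g₀ := by
  fin_cases i
  · exact congrArg Arrow.mk (Category.id_comp (G.map g₀.hom))
  · exact congrArg Arrow.mk (Category.id_comp (H.map g₀.hom))

lemma ev_walkingPath {r : unitInterval} {i : Fin 2} (hi : ∀ u, step (pathPoint r) u = i)
    {u v : Set.Ico (0 : ℝ) 1} (h : u ≤ v) : (walkingPath.{u} r).ev h =
      (Arrow.mk (𝟙 (⟨i⟩ : ULift.{u} (Fin 2))) : Arrow walkingArrow.{u}.Ob) := by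
  refine (Realization.ev_mk _ _ h).trans ?_
  have key : ∀ (a b : Fin 2) (hab : a ≤ b), a = i → b = i →
      walkingArrowUp.{u}.arr (n := 1) hab =
        (Arrow.mk (𝟙 (⟨i⟩ : ULift.{u} (Fin 2))) : Arrow walkingArrow.{u}.Ob) := by
    rintro a b hab rfl rfl
    rfl
  exact key _ _ _ (hi u) (hi v)

lemma homotopyMap_of_step {r : unitInterval} {i : Fin 2} (hi : ∀ u, step (pathPoint r) u = i)
    (z : A.Realization) : homotopyMap α r z =
      realizationMap ((ComposableArrows.mk₁ α : Fin 2 ⥤ (A.Ob ⥤ B.Ob)).obj i) z := by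
  refine Realization.ext_ev fun u v h => ?_
  rw [Realization.ev_realizationMap, ← cylArrow_of_eq]
  refine (Realization.ev_multiMap _ _ h).trans (congrArg _ (funext fun b => ?_))
  cases b
  · rfl
  · exact ev_walkingPath hi h

/-- A continuous natural transformation induces a homotopy. -/
lemma homotopic_of_natTrans (hG : KContinuous fun g : Arrow A.Ob => G.mapArrow.obj g)
    (hH : KContinuous fun g : Arrow A.Ob => H.mapArrow.obj g)
    (hα : KContinuous fun g : Arrow A.Ob => Arrow.mk (α.app g.left ≫ H.map g.hom)) :
    ContinuousMap.Homotopic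
      (⟨realizationMap G, Realization.continuous_realizationMap hG⟩ :
        C(A.Realization, B.Realization))
      ⟨realizationMap H, Realization.continuous_realizationMap hH⟩ := by
  refine ⟨⟨⟨fun p => homotopyMap α p.1 p.2, ?_⟩, fun z => homotopyMap_of_step α step_pathPoint_zero z,
    fun z => homotopyMap_of_step α step_pathPoint_one z⟩⟩
  have := compactlyGeneratedSpace_prod_left (X := A.Realization) (L := unitInterval)
  refine continuous_of_test fun K _ _ _ p hp => ?_
  refine Realization.continuous_multiMap _ (kContinuous_cylArrow α hG hH hα)
    (z := fun b k => match b with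
      | false => (p k).2
      | true => walkingPath (p k).1) ?_
  rintro (_ | _)
  · exact hp.snd
  · exact continuous_walkingPath hp.fst

end Homotopy

end TopCategory

/-! ## Homotopy equivalences -/

lemma isHomotopyEquivalence_of_homotopic {X Y : Type*} [TopologicalSpace X] [TopologicalSpace Y]
    {f : C(X, Y)} {g : C(Y, X)} (h₁ : (g.comp f).Homotopic (ContinuousMap.id X))
    (h₂ : (f.comp g).Homotopic (ContinuousMap.id Y)) : IsHomotopyEquivalence f :=
  ⟨⟨f, g, h₁, h₂⟩, rfl⟩

/-- If `d` inverts `g ∘ f` up to homotopy, then `d ∘ g` inverts `f`. -/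
lemma IsHomotopyEquivalence.of_comp {X Y Z : Type*} [TopologicalSpace X] [TopologicalSpace Y]
    [TopologicalSpace Z] {f : X → Y} {g : Y → Z} (hf : Continuous f) (hg : IsHomotopyEquivalence g)
    (hgf : IsHomotopyEquivalence (g ∘ f)) : IsHomotopyEquivalence f := by
  obtain ⟨e, rfl⟩ := hg
  obtain ⟨d, hd⟩ := hgf
  have hd' : d.toFun = e.toFun.comp ⟨f, hf⟩ := ContinuousMap.ext fun x => congrFun hd x
  refine isHomotopyEquivalence_of_homotopic (f := ⟨f, hf⟩) (g := d.invFun.comp e.toFun) ?_ ?_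
  · have := d.left_inv
    rw [hd'] at this
    exact this
  -- The other composite is compared with the identity after applying `g`, which is then cancelled
  -- by its homotopy inverse.
  · have h1 : (e.toFun.comp ((ContinuousMap.mk f hf).comp (d.invFun.comp e.toFun))).Homotopic
        e.toFun := by
      have := (d.right_inv).comp (ContinuousMap.Homotopic.refl e.toFun)
      rw [hd'] at this
      exact this
    have h2 := (ContinuousMap.Homotopic.refl e.invFun).comp h1
    have h3 := (e.left_inv).comp (ContinuousMap.Homotopic.refl
      ((ContinuousMap.mk f hf).comp (d.invFun.comp e.toFun)))
    exact h3.symm.trans (h2.trans e.left_inv)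

lemma IsHomotopyEquivalence.comp {X Y Z : Type*} [TopologicalSpace X] [TopologicalSpace Y]
    [TopologicalSpace Z] {f : X → Y} {g : Y → Z} (hg : IsHomotopyEquivalence g)
    (hf : IsHomotopyEquivalence f) : IsHomotopyEquivalence (g ∘ f) := by
  obtain ⟨e, rfl⟩ := hg
  obtain ⟨d, rfl⟩ := hf
  exact ⟨d.trans e, rfl⟩

lemma IsHomotopyEquivalence.of_homeomorph {X Y : Type*} [TopologicalSpace X] [TopologicalSpace Y]
    (e : X ≃ₜ Y) : IsHomotopyEquivalence e :=
  ⟨e.toHomotopyEquiv, rfl⟩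

lemma continuous_kSpace_pi_map {I : Type} {X Y : I → Type u} [∀ i, TopologicalSpace (X i)]
    [∀ i, TopologicalSpace (Y i)] {f : ∀ i, X i → Y i} (hf : ∀ i, Continuous (f i)) :
    @Continuous (KSpace (∀ i, X i)) (KSpace (∀ i, Y i)) _ _ fun x i => f i (x i) :=
  continuous_of_test fun _ _ _ _ _ hz => continuous_to_kSpace.2 (continuous_pi fun i =>
    (hf i).comp ((continuous_apply i).comp (continuous_to_kSpace.1 hz)))

/-- Products of homotopic maps, for the compactly generated product topology. -/
lemma homotopic_kSpace_pi {I : Type} {X Y : I → Type u} [∀ i, TopologicalSpace (X i)]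
    [∀ i, TopologicalSpace (Y i)] {f g : ∀ i, C(X i, Y i)} (h : ∀ i, (f i).Homotopic (g i)) :
    ContinuousMap.Homotopic
      (⟨fun x i => f i (x i), continuous_kSpace_pi_map fun i => (f i).continuous⟩ :
        C(KSpace (∀ i, X i), KSpace (∀ i, Y i)))
      ⟨fun x i => g i (x i), continuous_kSpace_pi_map fun i => (g i).continuous⟩ := by
  let H := fun i => (h i).some
  refine ⟨⟨⟨fun p i => H i (p.1, p.2 i), ?_⟩, fun z => funext fun i => (H i).apply_zero _,
    fun z => funext fun i => (H i).apply_one _⟩⟩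
  have := compactlyGeneratedSpace_prod_left (X := KSpace (∀ i, X i)) (L := unitInterval)
  refine continuous_of_test fun K _ _ _ p hp => ?_
  refine continuous_to_kSpace.2 (continuous_pi fun i => ?_)
  exact (H i).continuous.comp (hp.fst.prodMk
    ((continuous_apply i).comp (continuous_to_kSpace.1 hp.snd)))

lemma IsHomotopyEquivalence.kSpace_pi {I : Type} {X Y : I → Type u} [∀ i, TopologicalSpace (X i)]
    [∀ i, TopologicalSpace (Y i)] {f : ∀ i, X i → Y i} (h : ∀ i, IsHomotopyEquivalence (f i)) :
    IsHomotopyEquivalence (X := KSpace (∀ i, X i)) (Y := KSpace (∀ i, Y i))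
      fun x i => f i (x i) := by
  choose e he using h
  obtain rfl : f = fun i => ⇑(e i).toFun := funext fun i => (he i).symm
  exact isHomotopyEquivalence_of_homotopic (X := KSpace (∀ i, X i)) (Y := KSpace (∀ i, Y i))
    (f := ⟨fun x i => (e i).toFun (x i), continuous_kSpace_pi_map fun i => (e i).toFun.continuous⟩)
    (g := ⟨fun x i => (e i).invFun (x i),
      continuous_kSpace_pi_map fun i => (e i).invFun.continuous⟩)
    (homotopic_kSpace_pi fun i => (e i).left_inv) (homotopic_kSpace_pi fun i => (e i).right_inv)

end

noncomputable section

/-! ## Morphisms up to equality of source and target -/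

section SameArrow

variable {C : Type*} [Category* C]

/-- Equality of morphisms whose sources and targets need not agree definitionally. -/
def SameArrow {a b a' b' : C} (f : a ⟶ b) (g : a' ⟶ b') : Prop := Arrow.mk f = Arrow.mk g

infix:50 " ∼ₐ " => SameArrow

namespace SameArrow

variable {a b c a' b' c' a'' b'' : C}

lemma refl (f : a ⟶ b) : f ∼ₐ f := Eq.refl (Arrow.mk f)

lemma of_eq {f g : a ⟶ b} (h : f = g) : f ∼ₐ g := h ▸ refl f

lemma symm {f : a ⟶ b} {g : a' ⟶ b'} (h : f ∼ₐ g) : g ∼ₐ f := Eq.symm h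

lemma trans {f : a ⟶ b} {g : a' ⟶ b'} {k : a'' ⟶ b''} (h : f ∼ₐ g) (h' : g ∼ₐ k) : f ∼ₐ k :=
  Eq.trans h h'

lemma eq {f g : a ⟶ b} (h : f ∼ₐ g) : f = g := (Arrow.mk_inj _ _).1 h

lemma left {f : a ⟶ b} {g : a' ⟶ b'} (h : f ∼ₐ g) : a = a' :=
  congrArg (fun k : Arrow C => k.left) h

lemma right {f : a ⟶ b} {g : a' ⟶ b'} (h : f ∼ₐ g) : b = b' :=
  congrArg (fun k : Arrow C => k.right) h

/-- The relation includes the equality of end points, so the strict axioms, which equate objects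
only propositionally, can be used inside composites without transports. -/
lemma comp {f : a ⟶ b} {g : b ⟶ c} {f' : a' ⟶ b'} {g' : b' ⟶ c'} (hf : f ∼ₐ f') (hg : g ∼ₐ g') :
    f ≫ g ∼ₐ f' ≫ g' := by
  obtain rfl := hf.left
  obtain rfl := hf.right
  obtain rfl := hg.right
  rw [hf.eq, hg.eq]
  exact refl _

lemma comp_left {f : a ⟶ b} {f' : a' ⟶ b} (hf : f ∼ₐ f') (g : b ⟶ c) : f ≫ g ∼ₐ f' ≫ g :=
  hf.comp (refl g)

lemma comp_right (f : a ⟶ b) {g : b ⟶ c} {g' : b ⟶ c'} (hg : g ∼ₐ g') : f ≫ g ∼ₐ f ≫ g' :=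
  (refl f).comp hg

lemma comp_eqToHom (f : a ⟶ b) (h : b = c) : f ≫ eqToHom h ∼ₐ f := by
  subst h
  exact of_eq (Category.comp_id f)

lemma eqToHom_id (h : a = b) : eqToHom h ∼ₐ 𝟙 a := by
  subst h
  exact refl _

lemma id_of_eq (h : a = b) : 𝟙 a ∼ₐ 𝟙 b := by
  subst h
  exact refl _

lemma comp_id_left {f : a ⟶ b} {g : b ⟶ c} (hf : f ∼ₐ 𝟙 a') : f ≫ g ∼ₐ g := by
  obtain rfl := hf.left
  obtain rfl := hf.right
  rw [hf.eq]
  exact of_eq (Category.id_comp g)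

lemma comp_id_right {f : a ⟶ b} {g : b ⟶ c} (hg : g ∼ₐ 𝟙 a') : f ≫ g ∼ₐ f := by
  obtain rfl := hg.left
  obtain rfl := hg.right
  rw [hg.eq]
  exact of_eq (Category.comp_id f)

lemma inv {e : a ≅ b} {e' : a' ≅ b'} (h : e.hom ∼ₐ e'.hom) : e.inv ∼ₐ e'.inv := by
  obtain rfl := h.left
  obtain rfl := h.right
  obtain rfl : e = e' := Iso.ext h.eq
  exact refl _

lemma inv_id {e : a ≅ b} (h : e.hom ∼ₐ 𝟙 a') : e.inv ∼ₐ 𝟙 a' :=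
  inv (e' := Iso.refl a') h

end SameArrow

end SameArrow

namespace OperadCategory

variable {G : OperadData} {A : TopCategory.{u}} (M : OperadCategory G A)

lemma op_map_same {S : Type} [LinearOrder S] [Finite S] (f : G.Op S) {P Q P' Q' : S → A.Ob}
    {U : ∀ s, P s ⟶ Q s} {U' : ∀ s, P' s ⟶ Q' s} (h : ∀ s, U s ∼ₐ U' s) :
    (M.op f).map (X := P) (Y := Q) U ∼ₐ (M.op f).map (X := P') (Y := Q') U' := by
  obtain rfl : P = P' := funext fun s => (h s).left
  obtain rfl : Q = Q' := funext fun s => (h s).right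
  obtain rfl : U = U' := funext fun s => (h s).eq
  exact SameArrow.refl _

lemma op_map_comp {S : Type} [LinearOrder S] [Finite S] (f : G.Op S) {P Q R : S → A.Ob}
    (U : ∀ s, P s ⟶ Q s) (V : ∀ s, Q s ⟶ R s) :
    (M.op f).map (X := P) (Y := R) (fun s => U s ≫ V s) =
      (M.op f).map (X := P) (Y := Q) U ≫ (M.op f).map (X := Q) (Y := R) V :=
  (M.op f).map_comp (X := P) (Y := Q) (Z := R) U V

lemma op_map_id {S : Type} [LinearOrder S] [Finite S] (f : G.Op S) {P P' Q : S → A.Ob}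
    {U : ∀ s, P s ⟶ Q s} (h : ∀ s, U s ∼ₐ 𝟙 (P' s)) :
    (M.op f).map (X := P) (Y := Q) U ∼ₐ 𝟙 ((M.op f).obj P') :=
  (M.op_map_same f h).trans (SameArrow.of_eq ((M.op f).map_id P'))

/-- The image of a family of isomorphisms. -/
def opIso {S : Type} [LinearOrder S] [Finite S] (f : G.Op S) {P Q : S → A.Ob}
    (U : ∀ s, P s ≅ Q s) : (M.op f).obj P ≅ (M.op f).obj Q where
  hom := (M.op f).map (X := P) (Y := Q) fun s => (U s).hom
  inv := (M.op f).map (X := Q) (Y := P) fun s => (U s).inv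
  hom_inv_id := by
    rw [← op_map_comp]
    exact (M.op_map_id f fun s => SameArrow.of_eq (U s).hom_inv_id).eq
  inv_hom_id := by
    rw [← op_map_comp]
    exact (M.op_map_id f fun s => SameArrow.of_eq (U s).inv_hom_id).eq

end OperadCategory

namespace isometriesOperad

/-- The operad identities for isometries are checked on basis vectors, where the action and the
composition are computed by `toLinear_act` and `toLinear_comp`. -/
lemma op_ext {S : Type} {f g : isometriesOperad.Op S}
    (h : ∀ s n, toLinear f (Finsupp.single (s, n) 1) = toLinear g (Finsupp.single (s, n) 1)) :
    f = g :=
  Subtype.ext (Finsupp.lhom_ext' fun ⟨s, n⟩ => LinearMap.ext_ring (h s n))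

lemma act_trans {R S T : Type} (σ' : R ≃ S) (σ : S ≃ T) (f : isometriesOperad.Op T) :
    isometriesOperad.act σ' (isometriesOperad.act σ f) =
      isometriesOperad.act (σ'.trans σ) f :=
  op_ext fun s n => (toLinear_act σ' (isometriesOperad.act σ f) s n).trans
    ((toLinear_act σ f (σ' s) n).trans (toLinear_act (σ'.trans σ) f s n).symm)

lemma act_refl {T : Type} (f : isometriesOperad.Op T) :
    isometriesOperad.act (Equiv.refl T) f = f :=
  op_ext fun s n => toLinear_act (Equiv.refl T) f s n

lemma comp_act_right {S : Type} {T T' : S → Type} (σ : ∀ s, T s ≃ T' s)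
    (f : isometriesOperad.Op S) (g : ∀ s, isometriesOperad.Op (T' s)) :
    isometriesOperad.comp f (fun s => isometriesOperad.act (σ s) (g s)) =
      isometriesOperad.act (lexSigmaCongrRight σ) (isometriesOperad.comp f g) := by
  refine op_ext fun ⟨s, t⟩ n => ?_
  refine (toLinear_comp f (fun s => isometriesOperad.act (σ s) (g s)) s t n).trans ?_
  rw [toLinear_act]
  exact ((toLinear_act (lexSigmaCongrRight σ) (isometriesOperad.comp f g) (toLex ⟨s, t⟩) n).trans
    (toLinear_comp f g s (σ s t) n)).symm

lemma toLinear_act_mapDomain {S T : Type} (σ : S ≃ T) (f : isometriesOperad.Op T) (s : S)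
    (v : ℕ →₀ ℝ) : toLinear (isometriesOperad.act σ f) (Finsupp.mapDomain (fun n => (s, n)) v) =
      toLinear f (Finsupp.mapDomain (fun n => (σ s, n)) v) := by
  induction v using Finsupp.induction_linear with
  | zero => simp
  | add x y hx hy => simp only [Finsupp.mapDomain_add, map_add, hx, hy]
  | single n b =>
    rw [← mul_one b, ← smul_eq_mul, ← Finsupp.smul_single]
    simp only [Finsupp.mapDomain_smul, map_smul, Finsupp.mapDomain_single]
    rw [toLinear_act]

lemma comp_act_left {S S' : Type} {T : S' → Type} (σ : S ≃ S')
    (f : isometriesOperad.Op S') (g : ∀ s, isometriesOperad.Op (T s)) :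
    isometriesOperad.comp (isometriesOperad.act σ f) (fun s => g (σ s)) =
      isometriesOperad.act (lexSigmaCongrLeft σ T) (isometriesOperad.comp f g) := by
  refine op_ext fun ⟨s, t⟩ n => ?_
  refine (toLinear_comp (isometriesOperad.act σ f) (fun s => g (σ s)) s t n).trans
    ((toLinear_act_mapDomain σ f s (toLinear (g (σ s)) (Finsupp.single (t, n) 1))).trans ?_)
  exact ((toLinear_act (lexSigmaCongrLeft σ T) (isometriesOperad.comp f g) (toLex ⟨s, t⟩) n).trans
    (toLinear_comp f g (σ s) t n)).symm

lemma toLinear_comp_mapDomain {S : Type} {T : S → Type} (f : isometriesOperad.Op S)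
    (g : ∀ s, isometriesOperad.Op (T s)) (s : S) (t : T s) (v : ℕ →₀ ℝ) :
    toLinear (isometriesOperad.comp f g)
        (Finsupp.mapDomain (fun n => ((toLex ⟨s, t⟩ : Lex (Σ s, T s)), n)) v) =
      toLinear f (Finsupp.mapDomain (fun n => (s, n))
        (toLinear (g s) (Finsupp.mapDomain (fun n => (t, n)) v))) := by
  induction v using Finsupp.induction_linear with
  | zero => simp
  | add x y hx hy => simp only [Finsupp.mapDomain_add, map_add, hx, hy]
  | single n b =>
    rw [← mul_one b, ← smul_eq_mul, ← Finsupp.smul_single]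
    simp only [Finsupp.mapDomain_smul, map_smul, Finsupp.mapDomain_single]
    rw [toLinear_comp]

end isometriesOperad

/-! ## Sums of products -/

namespace LPermutativeCategory

variable {C : LPermutativeCategory.{u}}

section Perm

variable {R S T : Type} [LinearOrder R] [Finite R] [LinearOrder S] [Finite S] [LinearOrder T]
  [Finite T]

lemma perm_naturality (σ : S ≃ T) {P Q : T → C.A.Ob} (U : ∀ t, P t ⟶ Q t) :
    (C.add.sum S).map (X := fun s => P (σ s)) (Y := fun s => Q (σ s)) (fun s => U (σ s)) ≫
      (C.add.perm σ Q).hom = (C.add.perm σ P).hom ≫ (C.add.sum T).map (X := P) (Y := Q) U :=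
  C.add.τ_naturality σ PUnit.unit (P := P) (Q := Q) U

lemma perm_trans (σ' : R ≃ S) (σ : S ≃ T) (P : T → C.A.Ob) :
    (C.add.perm (σ'.trans σ) P).hom =
      (C.add.perm σ' fun s => P (σ s)).hom ≫ (C.add.perm σ P).hom :=
  SameArrow.eq (C.add.τ_trans σ' σ PUnit.unit P)

lemma perm_orderIso (e : S ≃o T) (P : T → C.A.Ob) {σ : S ≃ T} (hσ : ∀ s, σ s = e s) :
    (C.add.perm σ P).hom ∼ₐ 𝟙 ((C.add.sum T).obj P) := by
  obtain rfl : σ = e.toEquiv := Equiv.ext hσ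
  exact C.add.τ_orderIso e PUnit.unit P

/-- A sum over a dependent sum is an iterated sum. -/
lemma sum_sigma_same {T : S → Type} [∀ s, LinearOrder (T s)] [∀ s, Finite (T s)]
    {P Q : Lex (Σ s, T s) → C.A.Ob} (U : ∀ x, P x ⟶ Q x) :
    (C.add.sum (Lex (Σ s, T s))).map (X := P) (Y := Q) U ∼ₐ
      (C.add.sum S).map (X := fun s => (C.add.sum (T s)).obj fun t => P (toLex ⟨s, t⟩))
        (Y := fun s => (C.add.sum (T s)).obj fun t => Q (toLex ⟨s, t⟩))
        fun s => (C.add.sum (T s)).map (X := fun t => P (toLex ⟨s, t⟩))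
          (Y := fun t => Q (toLex ⟨s, t⟩)) fun t => U (toLex ⟨s, t⟩) :=
  C.add.op_comp (G := terminalOperad) PUnit.unit (fun _ => PUnit.unit)
    (P := fun s t => P (toLex ⟨s, t⟩)) (Q := fun s t => Q (toLex ⟨s, t⟩))
    fun s t => U (toLex ⟨s, t⟩)

end Perm

section Prod

variable {S S' S'' : Type} [LinearOrder S] [Finite S] [LinearOrder S'] [Finite S']
  [LinearOrder S''] [Finite S'']

/-- The comparison of two products that a bijection of the factors induces. -/
def prodIso (f : isometriesOperad.Op S) (P : S → C.A.Ob) (f' : isometriesOperad.Op S')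
    (P' : S' → C.A.Ob) (σ : S' ≃ S) (hf : f' = isometriesOperad.act σ f)
    (hP : ∀ s, P' s = P (σ s)) : (C.mul.op f).obj P ⟶ (C.mul.op f').obj P' :=
  -- The inverse occurs because `ω` leads from the product for `f` to the product for `f · σ`.
  (C.mul.τ σ f P).inv ≫ eqToHom (by
    subst hf
    rw [show P' = fun s => P (σ s) from funext hP])

variable (f : isometriesOperad.Op S) (P : S → C.A.Ob) (f' : isometriesOperad.Op S')
  (P' : S' → C.A.Ob) (σ : S' ≃ S) (hf : f' = isometriesOperad.act σ f) (hP : ∀ s, P' s = P (σ s))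

lemma prodIso_same : prodIso f P f' P' σ hf hP ∼ₐ (C.mul.τ σ f P).inv :=
  SameArrow.comp_eqToHom _ _

lemma prodIso_trans (f'' : isometriesOperad.Op S'') (P'' : S'' → C.A.Ob) (σ' : S'' ≃ S')
    (hf' : f'' = isometriesOperad.act σ' f') (hP' : ∀ s, P'' s = P' (σ' s))
    (hf'' : f'' = isometriesOperad.act (σ'.trans σ) f) (hP'' : ∀ s, P'' s = P (σ (σ' s))) :
    prodIso f P f' P' σ hf hP ≫ prodIso f' P' f'' P'' σ' hf' hP' =
      prodIso f P f'' P'' (σ'.trans σ) hf'' hP'' := by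
  obtain rfl : P' = fun s => P (σ s) := funext hP
  subst hf
  refine SameArrow.eq (((prodIso_same _ _ _ _ _ _ _).comp
    (prodIso_same _ _ _ _ _ _ _)).trans (SameArrow.trans ?_ (prodIso_same _ _ _ _ _ _ _).symm))
  exact (SameArrow.inv (e := C.mul.τ (σ'.trans σ) f P)
    (e' := (C.mul.τ σ' (isometriesOperad.act σ f) fun s => P (σ s)) ≪≫ C.mul.τ σ f P)
    (C.mul.τ_trans σ' σ f P)).symm

/-- Symmetries of order isomorphisms are identities, so a monotone renaming of the factors is
invisible. -/
lemma prodIso_orderIso (e : S' ≃o S) (he : ∀ s, σ s = e s) :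
    prodIso f P f' P' σ hf hP ∼ₐ 𝟙 ((C.mul.op f).obj P) := by
  refine (prodIso_same f P f' P' σ hf hP).trans (SameArrow.inv_id ?_)
  obtain rfl : σ = e.toEquiv := Equiv.ext he
  exact C.mul.τ_orderIso e f P

variable {P P'} in
lemma prodIso_naturality {Q : S → C.A.Ob} {Q' : S' → C.A.Ob} (hQ : ∀ s, Q' s = Q (σ s))
    (U : ∀ s, P s ⟶ Q s) (U' : ∀ s, P' s ⟶ Q' s) (hU : ∀ s, U' s ∼ₐ U (σ s)) :
    prodIso f P f' P' σ hf hP ≫ (C.mul.op f').map (X := P') (Y := Q') U' =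
      (C.mul.op f).map (X := P) (Y := Q) U ≫ prodIso f Q f' Q' σ hf hQ := by
  obtain rfl : P' = fun s => P (σ s) := funext hP
  obtain rfl : Q' = fun s => Q (σ s) := funext hQ
  obtain rfl : U' = fun s => U (σ s) := funext fun s => (hU s).eq
  subst hf
  have := C.mul.τ_naturality σ f (P := P) (Q := Q) U
  simp only [prodIso, eqToHom_refl, Category.comp_id]
  rw [Iso.inv_comp_eq, ← Category.assoc, Iso.eq_comp_inv]
  exact this

end Prod

section SumProd

variable {X X' X'' S S' S'' : Type} [LinearOrder X] [Finite X] [LinearOrder X'] [Finite X']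
  [LinearOrder X''] [Finite X''] [LinearOrder S] [Finite S] [LinearOrder S'] [Finite S']
  [LinearOrder S''] [Finite S''] {f : isometriesOperad.Op S} {f' : isometriesOperad.Op S'}
  {f'' : isometriesOperad.Op S''}

variable (C X) in
/-- The sum over `X` of the products of the families `P x`. -/
abbrev sumProd (f : isometriesOperad.Op S) (P : X → S → C.A.Ob) : C.A.Ob :=
  (C.add.sum X).obj fun x => (C.mul.op f).obj (P x)

/-- The sum of products of morphisms. -/
def sumProdMap (f : isometriesOperad.Op S) {P Q : X → S → C.A.Ob} (U : ∀ x s, P x s ⟶ Q x s) :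
    C.sumProd X f P ⟶ C.sumProd X f Q :=
  (C.add.sum X).map (X := fun x => (C.mul.op f).obj (P x)) (Y := fun x => (C.mul.op f).obj (Q x))
    fun x => (C.mul.op f).map (X := P x) (Y := Q x) (U x)

lemma sumProdMap_comp {P Q R : X → S → C.A.Ob} (U : ∀ x s, P x s ⟶ Q x s)
    (V : ∀ x s, Q x s ⟶ R x s) :
    sumProdMap f (fun x s => U x s ≫ V x s) = sumProdMap f U ≫ sumProdMap f V :=
  (SameArrow.eq (C.add.op_map_same _ fun x =>
    SameArrow.of_eq (C.mul.op_map_comp f (U x) (V x)))).trans (C.add.op_map_comp PUnit.unit _ _)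

lemma sumProdMap_id {P P' Q : X → S → C.A.Ob} {U : ∀ x s, P x s ⟶ Q x s}
    (h : ∀ x s, U x s ∼ₐ 𝟙 (P' x s)) : sumProdMap f U ∼ₐ 𝟙 (C.sumProd X f P') :=
  C.add.op_map_id _ fun x => C.mul.op_map_id _ (h x)

/-- The comparison of sums of products that bijections of the summands and factors induce. -/
def relabel (e : X ≃ X') (σ : S' ≃ S) (hf : f' = isometriesOperad.act σ f) {P : X → S → C.A.Ob}
    {P' : X' → S' → C.A.Ob} (hP : ∀ x s, P' (e x) s = P x (σ s)) :
    C.sumProd X f P ⟶ C.sumProd X' f' P' :=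
  (C.add.sum X).map (X := fun x => (C.mul.op f).obj (P x))
    (Y := fun x => (C.mul.op f').obj (P' (e x)))
    (fun x => prodIso f (P x) f' (P' (e x)) σ hf (hP x)) ≫
  (C.add.perm e fun x => (C.mul.op f').obj (P' x)).hom

lemma relabel_congr {e e' : X ≃ X'} {σ σ' : S' ≃ S} {hf : f' = isometriesOperad.act σ f}
    {hf' : f' = isometriesOperad.act σ' f} {P : X → S → C.A.Ob}
    {P' : X' → S' → C.A.Ob} {hP : ∀ x s, P' (e x) s = P x (σ s)}
    {hP' : ∀ x s, P' (e' x) s = P x (σ' s)} (he : ∀ x, e x = e' x) (hσ : ∀ s, σ s = σ' s) :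
    relabel e σ hf hP = relabel e' σ' hf' hP' := by
  obtain rfl := Equiv.ext he
  obtain rfl := Equiv.ext hσ
  rfl

/-- Naturality of the symmetry of sums moves the second comparison of products in front of the first
permutation. Then comparisons compose by `prodIso_trans` and permutations by `perm_trans`. -/
lemma relabel_trans (e : X ≃ X') (σ : S' ≃ S) (hf : f' = isometriesOperad.act σ f) (e' : X' ≃ X'')
    (σ' : S'' ≃ S') (hf' : f'' = isometriesOperad.act σ' f') {P : X → S → C.A.Ob}
    {P' : X' → S' → C.A.Ob} {P'' : X'' → S'' → C.A.Ob} (hP : ∀ x s, P' (e x) s = P x (σ s))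
    (hP' : ∀ x s, P'' (e' x) s = P' x (σ' s)) :
    relabel e σ hf hP ≫ relabel e' σ' hf' hP' =
      relabel (e.trans e') (σ'.trans σ) (P := P) (P' := P'')
        (hf'.trans ((congrArg _ hf).trans (isometriesOperad.act_trans _ _ _)))
        (fun x s => (hP' (e x) s).trans (hP x _)) := by
  have e1 := perm_trans (C := C) e e' fun x => (C.mul.op f'').obj (P'' x)
  have e2 := perm_naturality (C := C) e (P := fun x => (C.mul.op f').obj (P' x))
    (Q := fun x => (C.mul.op f'').obj (P'' (e' x))) fun x =>
    prodIso f' (P' x) f'' (P'' (e' x)) σ' hf' (hP' x)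
  refine (Category.assoc _ _ _).trans ?_
  refine (congrArg (_ ≫ ·) ((Category.assoc _ _ _).symm.trans
    ((congrArg (· ≫ _) e2.symm).trans (Category.assoc _ _ _)))).trans ?_
  refine (Category.assoc _ _ _).symm.trans ?_
  refine (congrArg₂ (· ≫ ·) (C.add.op_map_comp PUnit.unit _ _).symm e1.symm).trans ?_
  refine congrArg (· ≫ _) (congrArg _ (funext fun x => ?_))
  exact prodIso_trans _ _ _ _ _ _ _ _ _ _ _ _ _ _

lemma relabel_naturality (e : X ≃ X') (σ : S' ≃ S) (hf : f' = isometriesOperad.act σ f)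
    {P Q : X → S → C.A.Ob} {P' Q' : X' → S' → C.A.Ob} (hP : ∀ x s, P' (e x) s = P x (σ s))
    (hQ : ∀ x s, Q' (e x) s = Q x (σ s)) (U : ∀ x s, P x s ⟶ Q x s)
    (U' : ∀ x s, P' x s ⟶ Q' x s) (hU : ∀ x s, U' (e x) s ∼ₐ U x (σ s)) :
    relabel e σ hf hP ≫ sumProdMap f' U' = sumProdMap f U ≫ relabel e σ hf hQ := by
  have e2 := perm_naturality (C := C) e (P := fun x => (C.mul.op f').obj (P' x))
    (Q := fun x => (C.mul.op f').obj (Q' x)) fun x =>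
    (C.mul.op f').map (X := P' x) (Y := Q' x) (U' x)
  refine (Category.assoc _ _ _).trans ?_
  refine (congrArg (_ ≫ ·) e2.symm).trans ?_
  refine (Category.assoc _ _ _).symm.trans (Eq.trans ?_ (Category.assoc _ _ _))
  refine congrArg (· ≫ _) ?_
  refine (C.add.op_map_comp PUnit.unit _ _).symm.trans
    (Eq.trans ?_ (C.add.op_map_comp PUnit.unit _ _))
  exact SameArrow.eq (C.add.op_map_same _ fun x =>
    SameArrow.of_eq (prodIso_naturality _ _ _ _ _ _ _ _ (hU x)))

/-- The comparison is just a permutation of the sum if the factors are relabelled monotonically. -/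
lemma relabel_same_perm (e : X ≃ X') (σ : S' ≃ S) (hf : f' = isometriesOperad.act σ f)
    {P : X → S → C.A.Ob} {P' : X' → S' → C.A.Ob} (hP : ∀ x s, P' (e x) s = P x (σ s))
    (o : S' ≃o S) (ho : ∀ s, σ s = o s) :
    relabel e σ hf hP ∼ₐ (C.add.perm e fun x => (C.mul.op f').obj (P' x)).hom :=
  SameArrow.comp_id_left (C.add.op_map_id _ fun _ => prodIso_orderIso _ _ _ _ _ _ _ o ho)

lemma relabel_orderIso (e : X ≃ X') (σ : S' ≃ S) (hf : f' = isometriesOperad.act σ f)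
    {P : X → S → C.A.Ob} {P' : X' → S' → C.A.Ob} (hP : ∀ x s, P' (e x) s = P x (σ s))
    (o : S' ≃o S) (ho : ∀ s, σ s = o s) (o' : X ≃o X') (ho' : ∀ x, e x = o' x) :
    relabel e σ hf hP ∼ₐ 𝟙 (C.sumProd X' f' P') :=
  (relabel_same_perm e σ hf hP o ho).trans (perm_orderIso o' _ ho')

end SumProd

end LPermutativeCategory

end

noncomputable section

/-! ## Lexicographic orders on iterated sums and products -/

section LexOrder

/-- The first component of an element of a dependent sum. -/
def lexFst {S : Type} {T : S → Type} (d : Lex (Σ s, T s)) : S := (ofLex d).1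

/-- The second component of an element of a dependent sum. -/
def lexSnd {S : Type} {T : S → Type} (d : Lex (Σ s, T s)) : T (lexFst d) := (ofLex d).2

/-- A component of an element of a dependent product. -/
def lexApp {S : Type} {T : S → Type} (y : Lex (∀ s, T s)) (s : S) : T s := ofLex y s

/-- Reassociation of dependent sums. -/
def lexSigmaAssoc {S : Type} {T : S → Type} (R : ∀ s, T s → Type) :
    Lex (Σ s, Lex (Σ t, R s t)) ≃
      Lex (Σ x : Lex (Σ s, T s), R (lexFst x) (lexSnd x)) where
  toFun d := toLex ⟨toLex ⟨(lexFst d), (lexFst (lexSnd d))⟩, (lexSnd (lexSnd d))⟩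
  invFun d := toLex ⟨(lexFst (lexFst d)), toLex ⟨(lexSnd (lexFst d)), (lexSnd d)⟩⟩
  left_inv _ := rfl
  right_inv _ := rfl

/-- Currying of dependent products. -/
def lexPiCurry {S : Type} {T : S → Type} (R : ∀ s, T s → Type) :
    Lex (∀ s, Lex (∀ t, R s t)) ≃ Lex (∀ x : Lex (Σ s, T s), R (lexFst x) (lexSnd x)) where
  toFun y := toLex fun x => lexApp (lexApp y (lexFst x)) (lexSnd x)
  invFun z := toLex fun s => toLex fun t => lexApp z (toLex ⟨s, t⟩)
  left_inv _ := rfl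
  right_inv _ := rfl

/-- A strictly monotone bijection of linear orders as an order isomorphism. -/
def Equiv.orderIsoOfStrictMono {α β : Type} [LinearOrder α] [LinearOrder β] (e : α ≃ β)
    (h : StrictMono e) : α ≃o β :=
  ⟨e, h.le_iff_le⟩

lemma lexSigma_lt {S : Type} {T : S → Type} [LinearOrder S] [∀ s, LinearOrder (T s)] {s s' : S}
    {t : T s} {t' : T s'} : (toLex ⟨s, t⟩ : Lex (Σ s, T s)) < toLex ⟨s', t'⟩ ↔
      s < s' ∨ ∃ h : s = s', h ▸ t < t' :=
  Sigma.Lex.lt_def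

/-- Both sides order triples lexicographically, so this reassociation contributes only an identity
symmetry. -/
lemma lexSigmaAssoc_strictMono {S : Type} {T : S → Type} (R : ∀ s, T s → Type) [LinearOrder S]
    [∀ s, LinearOrder (T s)] [∀ s t, LinearOrder (R s t)] : StrictMono (lexSigmaAssoc R) := by
  rintro ⟨s, ⟨t, r⟩⟩ ⟨s', ⟨t', r'⟩⟩ h
  rcases lexSigma_lt.1 h with h | ⟨rfl, h⟩
  · exact lexSigma_lt.2 (Or.inl (lexSigma_lt.2 (Or.inl h)))
  · rcases lexSigma_lt.1 h with h | ⟨rfl, h⟩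
    · exact lexSigma_lt.2 (Or.inl (lexSigma_lt.2 (Or.inr ⟨rfl, h⟩)))
    · exact lexSigma_lt.2 (Or.inr ⟨rfl, h⟩)

/-- The first place where two families differ is the same before and after currying. -/
lemma lexPiCurry_strictMono {S : Type} {T : S → Type} (R : ∀ s, T s → Type) [LinearOrder S]
    [Finite S] [∀ s, LinearOrder (T s)] [∀ s, Finite (T s)] [∀ s t, LinearOrder (R s t)] :
    StrictMono (lexPiCurry R) := by
  rintro y z ⟨s, hs, t, ht, hlt⟩
  refine ⟨toLex ⟨s, t⟩, ?_, hlt⟩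
  rintro ⟨s', t'⟩ h
  rcases lexSigma_lt.1 h with h | ⟨rfl, h⟩
  · exact congrFun (hs s' h) t'
  · exact ht t' h

lemma lexSigmaCongrRight_strictMono {S : Type} {T T' : S → Type} [LinearOrder S]
    [∀ s, LinearOrder (T s)] [∀ s, LinearOrder (T' s)] (σ : ∀ s, T s ≃ T' s)
    (hσ : ∀ s, StrictMono (σ s)) : StrictMono (lexSigmaCongrRight σ) := by
  rintro ⟨s, t⟩ ⟨s', t'⟩ h
  rcases lexSigma_lt.1 h with h | ⟨rfl, h⟩
  · exact lexSigma_lt.2 (Or.inl h)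
  · exact lexSigma_lt.2 (Or.inr ⟨rfl, hσ _ h⟩)

end LexOrder

/-- Both sides have the components `f_s g^s_t h^{s,t}_u`; only the labels of the inputs are
bracketed differently. -/
lemma isometriesOperad.comp_assoc {S : Type} {T : S → Type} {R : ∀ s, T s → Type}
    (f : isometriesOperad.Op S) (g : ∀ s, isometriesOperad.Op (T s))
    (h : ∀ s t, isometriesOperad.Op (R s t)) :
    isometriesOperad.comp (isometriesOperad.comp f g)
        (fun x : Lex (Σ s, T s) => h (lexFst x) (lexSnd x)) =
      isometriesOperad.act (lexSigmaAssoc R).symm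
        (isometriesOperad.comp f fun s => isometriesOperad.comp (g s) (h s)) := by
  refine isometriesOperad.op_ext fun ⟨⟨s, t⟩, u⟩ n => ?_
  refine (isometriesOperad.toLinear_comp (isometriesOperad.comp f g)
    (fun x : Lex (Σ s, T s) => h (lexFst x) (lexSnd x)) (toLex ⟨s, t⟩) u n).trans ?_
  refine (isometriesOperad.toLinear_comp_mapDomain f g s t
    (isometriesOperad.toLinear (h s t) (Finsupp.single (u, n) 1))).trans ?_
  refine Eq.symm ((isometriesOperad.toLinear_act (lexSigmaAssoc R).symm _
    (toLex ⟨toLex ⟨s, t⟩, u⟩) n).trans ?_)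
  refine (isometriesOperad.toLinear_comp f (fun s => isometriesOperad.comp (g s) (h s)) s
    (toLex ⟨t, u⟩) n).trans ?_
  rw [isometriesOperad.toLinear_comp (g s) (h s) t u n]


end

/-! ### Expansion of nested sums of products and its compatibility with relabelling -/

noncomputable section

/-- This rewrites the axiom `δ_mul_equivariant`, which concerns `τ`, for the inverse of `τ`, which
is what `prodIso` uses. -/
lemma CategoryTheory.inv_comp_eq_of_conj {D : Type*} [Category* D] {a a' b b' c : D} (t : a' ≅ a)
    (d : a ⟶ c) (d' : a' ⟶ b) (p : b' ≅ b) (m : b' ≅ c)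
    (h : t.hom ≫ d = d' ≫ p.inv ≫ m.hom) : t.inv ≫ d' = d ≫ m.inv ≫ p.hom := by
  rw [Iso.inv_comp_eq, reassoc_of% h, Iso.hom_inv_id_assoc, Iso.inv_hom_id, Category.comp_id]

namespace LPermutativeCategory

variable {C : LPermutativeCategory.{u}}

lemma perm_same {S T : Type} [LinearOrder S] [Finite S] [LinearOrder T] [Finite T] (σ : S ≃ T)
    {P Q : T → C.A.Ob} (h : ∀ t, P t = Q t) : (C.add.perm σ P).hom ∼ₐ (C.add.perm σ Q).hom := by
  obtain rfl : P = Q := funext h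
  exact SameArrow.refl _

lemma relabel_refl_same {X S S' : Type} [LinearOrder X] [Finite X] [LinearOrder S] [Finite S]
    [LinearOrder S'] [Finite S'] {f : isometriesOperad.Op S} {f' : isometriesOperad.Op S'}
    (σ : S' ≃ S) (hf : f' = isometriesOperad.act σ f) {P : X → S → C.A.Ob}
    {P' : X → S' → C.A.Ob} (hP : ∀ x s, P' x s = P x (σ s)) :
    relabel (Equiv.refl X) σ hf hP ∼ₐ (C.add.sum X).map (X := fun x => (C.mul.op f).obj (P x))
      (Y := fun x => (C.mul.op f').obj (P' x)) fun x => prodIso f (P x) f' (P' x) σ hf (hP x) :=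
  SameArrow.comp_id_right (perm_orderIso (OrderIso.refl X) _ fun _ => rfl)

section CongrRight

variable {S : Type} [LinearOrder S] [Finite S] {T T' : S → Type} [∀ s, LinearOrder (T s)]
  [∀ s, Finite (T s)] [∀ s, LinearOrder (T' s)] [∀ s, Finite (T' s)]

lemma perm_sigmaCongrRight (e : ∀ s, T s ≃ T' s) (P : Lex (Σ s, T' s) → C.A.Ob) :
    (C.add.perm (lexSigmaCongrRight e) P).hom ∼ₐ
      (C.add.sum S).map (X := fun s => (C.add.sum (T s)).obj fun t => P (toLex ⟨s, e s t⟩))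
        (Y := fun s => (C.add.sum (T' s)).obj fun t => P (toLex ⟨s, t⟩))
        fun s => (C.add.perm (e s) fun t => P (toLex ⟨s, t⟩)).hom :=
  C.add.τ_comp_right e (PUnit.unit : terminalOperad.Op S) (fun _ => PUnit.unit)
    fun s t => P (toLex ⟨s, t⟩)

/-- Inverted form of the coherence `τ_comp_right`: renaming within each block is the product of the
renamings of the blocks. -/
lemma prodIso_sigmaCongrRight (σ : ∀ s, T' s ≃ T s) (f : isometriesOperad.Op S)
    (g : ∀ s, isometriesOperad.Op (T s)) (g' : ∀ s, isometriesOperad.Op (T' s))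
    (hg : ∀ s, g' s = isometriesOperad.act (σ s) (g s)) (P : ∀ s, T s → C.A.Ob)
    (P' : ∀ s, T' s → C.A.Ob) (hP : ∀ s t, P' s t = P s (σ s t))
    (hf : isometriesOperad.comp f g' =
      isometriesOperad.act (lexSigmaCongrRight σ) (isometriesOperad.comp f g)) :
    prodIso (isometriesOperad.comp f g) (fun z => P (lexFst z) (lexSnd z))
      (isometriesOperad.comp f g') (fun z => P' (lexFst z) (lexSnd z)) (lexSigmaCongrRight σ) hf
      (fun _ => hP _ _) ∼ₐ
    (C.mul.op f).map (X := fun s => (C.mul.op (g s)).obj (P s))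
      (Y := fun s => (C.mul.op (g' s)).obj (P' s))
      fun s => prodIso (g s) (P s) (g' s) (P' s) (σ s) (hg s) (hP s) := by
  obtain rfl : g' = fun s => isometriesOperad.act (σ s) (g s) := funext hg
  obtain rfl : P' = fun s t => P s (σ s t) := funext fun s => funext (hP s)
  refine (prodIso_same _ _ _ _ _ _ _).trans ?_
  refine SameArrow.trans ?_ (C.mul.op_map_same f fun s => (prodIso_same _ _ _ _ _ _ _).symm)
  exact SameArrow.inv (e' := C.mul.opIso f fun s => C.mul.τ (σ s) (g s) (P s))
    (C.mul.τ_comp_right σ f g P)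

end CongrRight

section CongrLeft

variable {S S' : Type} [LinearOrder S] [Finite S] [LinearOrder S'] [Finite S'] {T : S' → Type}
  [∀ s, LinearOrder (T s)] [∀ s, Finite (T s)]

lemma perm_sigmaCongrLeft (e : S ≃ S') (P : Lex (Σ s, T s) → C.A.Ob) :
    (C.add.perm (lexSigmaCongrLeft e T) P).hom ∼ₐ
      (C.add.perm e fun s => (C.add.sum (T s)).obj fun t => P (toLex ⟨s, t⟩)).hom :=
  C.add.τ_comp_left e (PUnit.unit : terminalOperad.Op S') (fun _ => PUnit.unit)
    fun s t => P (toLex ⟨s, t⟩)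

/-- Inverted form of the coherence `τ_comp_left`: a block permutation permutes the products over the
blocks. -/
lemma prodIso_sigmaCongrLeft (σ : S ≃ S') (f : isometriesOperad.Op S')
    (f' : isometriesOperad.Op S) (hf : f' = isometriesOperad.act σ f)
    (g : ∀ s, isometriesOperad.Op (T s)) (P : ∀ s, T s → C.A.Ob)
    (P' : ∀ s, T (σ s) → C.A.Ob) (hP : ∀ s t, P' s t = P (σ s) t)
    (hfg : isometriesOperad.comp f' (fun s => g (σ s)) =
      isometriesOperad.act (lexSigmaCongrLeft σ T) (isometriesOperad.comp f g)) :
    prodIso (isometriesOperad.comp f g) (fun z => P (lexFst z) (lexSnd z))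
      (isometriesOperad.comp f' fun s => g (σ s)) (fun z => P' (lexFst z) (lexSnd z))
      (lexSigmaCongrLeft σ T) hfg (fun _ => hP _ _) ∼ₐ
    prodIso f (fun s => (C.mul.op (g s)).obj (P s)) f'
      (fun s => (C.mul.op (g (σ s))).obj (P' s)) σ hf
      (fun s => congrArg _ (funext (hP s))) := by
  obtain rfl : P' = fun s => P (σ s) := funext fun s => funext (hP s)
  refine (prodIso_same _ _ _ _ _ _ _).trans ?_
  refine SameArrow.trans ?_ (prodIso_same _ _ _ _ _ _ _).symm
  exact SameArrow.inv (C.mul.τ_comp_left σ f g P)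

end CongrLeft

section Expand

variable {X S : Type} [LinearOrder X] [Finite X] [LinearOrder S] [Finite S]
  {Y : X → S → Type} [∀ x s, LinearOrder (Y x s)] [∀ x s, Finite (Y x s)]
  {T : S → Type} [∀ s, LinearOrder (T s)] [∀ s, Finite (T s)]

/-- Iterated sums and products agree strictly with sums and products over dependent sums, so the two
forms of the expanded object are equal. -/
lemma expand_aux (f : isometriesOperad.Op S) (g : ∀ s, isometriesOperad.Op (T s))
    (P : ∀ x s, Y x s → T s → C.A.Ob) :
    ((C.add.sum X).obj fun x => (C.add.sum (Lex (∀ s, Y x s))).obj fun y =>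
        (C.mul.op f).obj fun s => (C.mul.op (g s)).obj (P x s (lexApp y s))) =
      C.sumProd (Lex (Σ x, Lex (∀ s, Y x s))) (isometriesOperad.comp f g)
        (fun d z => P (lexFst d) (lexFst z) (lexApp (lexSnd d) (lexFst z)) (lexSnd z)) := by
  refine (C.add.op_comp_obj (G := terminalOperad) (S := X) (T := fun x => Lex (∀ s, Y x s))
    PUnit.unit (fun _ => PUnit.unit) _).symm.trans (congrArg _ (funext fun d => ?_))
  exact (C.mul.op_comp_obj f g fun s => P (lexFst d) s (lexApp (lexSnd d) s)).symm

/-- The expansion of a sum of products of sums of products. -/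
def expand (f : isometriesOperad.Op S) (g : ∀ s, isometriesOperad.Op (T s))
    (P : ∀ x s, Y x s → T s → C.A.Ob) :
    C.sumProd X f (fun x s => C.sumProd (Y x s) (g s) (P x s)) ⟶
      C.sumProd (Lex (Σ x, Lex (∀ s, Y x s))) (isometriesOperad.comp f g)
        (fun d z => P (lexFst d) (lexFst z) (lexApp (lexSnd d) (lexFst z)) (lexSnd z)) :=
  (C.add.sum X).map (X := fun x => (C.mul.op f).obj fun s => C.sumProd (Y x s) (g s) (P x s))
    (Y := fun x => (C.add.sum (Lex (∀ s, Y x s))).obj fun y =>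
        (C.mul.op f).obj fun s => (C.mul.op (g s)).obj (P x s (lexApp y s)))
    (fun x => C.δ f fun s y => (C.mul.op (g s)).obj (P x s y)) ≫
  eqToHom (expand_aux f g P)

lemma expand_same (f : isometriesOperad.Op S) (g : ∀ s, isometriesOperad.Op (T s))
    (P : ∀ x s, Y x s → T s → C.A.Ob) : expand f g P ∼ₐ
      (C.add.sum X).map (X := fun x => (C.mul.op f).obj fun s => C.sumProd (Y x s) (g s) (P x s))
        (Y := fun x => (C.add.sum (Lex (∀ s, Y x s))).obj fun y =>
          (C.mul.op f).obj fun s => (C.mul.op (g s)).obj (P x s (lexApp y s)))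
        (fun x => C.δ f fun s y => (C.mul.op (g s)).obj (P x s y)) :=
  SameArrow.comp_eqToHom _ _

/-- The distributivity transformation commutes with comparisons of the sums of products. -/
lemma δ_relabel {Y Y' : S → Type} [∀ s, LinearOrder (Y s)] [∀ s, Finite (Y s)]
    [∀ s, LinearOrder (Y' s)] [∀ s, Finite (Y' s)] {T' : S → Type} [∀ s, LinearOrder (T' s)]
    [∀ s, Finite (T' s)] (e : ∀ s, Y s ≃ Y' s) (σ : ∀ s, T' s ≃ T s) (f : isometriesOperad.Op S)
    (g : ∀ s, isometriesOperad.Op (T s)) (g' : ∀ s, isometriesOperad.Op (T' s))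
    (hg : ∀ s, g' s = isometriesOperad.act (σ s) (g s)) {P : ∀ s, Y s → T s → C.A.Ob}
    {P' : ∀ s, Y' s → T' s → C.A.Ob} (hP : ∀ s y t, P' s (e s y) t = P s y (σ s t)) :
    (C.mul.op f).map (X := fun s => C.sumProd (Y s) (g s) (P s))
        (Y := fun s => C.sumProd (Y' s) (g' s) (P' s))
        (fun s => relabel (e s) (σ s) (hg s) (hP s)) ≫
      C.δ f (fun s y => (C.mul.op (g' s)).obj (P' s y)) =
    C.δ f (fun s y => (C.mul.op (g s)).obj (P s y)) ≫
      (C.add.sum (Lex (∀ s, Y s))).map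
        (X := fun y => (C.mul.op f).obj fun s => (C.mul.op (g s)).obj (P s (lexApp y s)))
        (Y := fun y => (C.mul.op f).obj fun s => (C.mul.op (g' s)).obj (P' s (e s (lexApp y s))))
        (fun y => (C.mul.op f).map (X := fun s => (C.mul.op (g s)).obj (P s (lexApp y s)))
          (Y := fun s => (C.mul.op (g' s)).obj (P' s (e s (lexApp y s))))
          fun s => prodIso (g s) (P s (lexApp y s)) (g' s) (P' s (e s (lexApp y s))) (σ s) (hg s)
            (hP s (lexApp y s))) ≫
      (C.add.perm (lexPiCongrRight e) fun y =>
        (C.mul.op f).obj fun s => (C.mul.op (g' s)).obj (P' s (lexApp y s))).hom := by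
  -- A relabelling is a sum of comparisons of products followed by a permutation. The permutation
  -- crosses `δ` by `δ_add_equivariant`, the comparisons by naturality of `δ`.
  refine (congrArg (· ≫ _) (C.mul.op_map_comp f _ _)).trans ?_
  refine (Category.assoc _ _ _).trans ?_
  refine (congrArg (_ ≫ ·) (C.δ_add_equivariant e f
    fun s y => (C.mul.op (g' s)).obj (P' s y))).trans ?_
  refine (Category.assoc _ _ _).symm.trans ?_
  refine (congrArg (· ≫ _) (C.δ_naturality f fun s y => prodIso (g s) (P s y) (g' s)
    (P' s (e s y)) (σ s) (hg s) (hP s y))).trans ?_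
  exact Category.assoc _ _ _

/-- Expansion commutes with comparisons of the inner sums of products. -/
lemma expand_relabel_inner {Y' : X → S → Type} [∀ x s, LinearOrder (Y' x s)]
    [∀ x s, Finite (Y' x s)] {T' : S → Type} [∀ s, LinearOrder (T' s)] [∀ s, Finite (T' s)]
    (e : ∀ x s, Y x s ≃ Y' x s) (σ : ∀ s, T' s ≃ T s) (f : isometriesOperad.Op S)
    (g : ∀ s, isometriesOperad.Op (T s)) (g' : ∀ s, isometriesOperad.Op (T' s))
    (hg : ∀ s, g' s = isometriesOperad.act (σ s) (g s)) {P : ∀ x s, Y x s → T s → C.A.Ob}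
    {P' : ∀ x s, Y' x s → T' s → C.A.Ob} (hP : ∀ x s y t, P' x s (e x s y) t = P x s y (σ s t))
    (hfg : isometriesOperad.comp f g' =
      isometriesOperad.act (lexSigmaCongrRight σ) (isometriesOperad.comp f g)) :
    sumProdMap f (fun x s => relabel (e x s) (σ s) (hg s) (hP x s)) ≫ expand f g' P' =
      expand f g P ≫ relabel (lexSigmaCongrRight fun x => lexPiCongrRight (e x))
        (lexSigmaCongrRight σ) hfg fun d z => hP (lexFst d) (lexFst z) _ _ := by
  refine SameArrow.eq ?_
  refine (SameArrow.comp_right _ (expand_same f g' P')).trans ?_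
  refine (SameArrow.of_eq (C.add.op_map_comp PUnit.unit _ _).symm).trans ?_
  refine (C.add.op_map_same _ fun x => SameArrow.of_eq
    (δ_relabel (e x) σ f g g' hg (hP x))).trans ?_
  refine (SameArrow.of_eq (C.add.op_map_comp PUnit.unit _ _)).trans ?_
  refine SameArrow.comp (expand_same f g P).symm ?_
  refine (SameArrow.of_eq (C.add.op_map_comp PUnit.unit _ _)).trans ?_
  -- The permutations for the single `x` assemble to one permutation of the dependent sum, and the
  -- comparisons of the inner factors to one comparison of products.
  refine SameArrow.comp ?_ ((perm_sigmaCongrRight (fun x => lexPiCongrRight (e x)) fun d =>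
    (C.mul.op f).obj fun s => (C.mul.op (g' s)).obj (P' (lexFst d) s (lexApp (lexSnd d) s))).symm.trans
    (perm_same _ fun d => (C.mul.op_comp_obj f g' fun s =>
      P' (lexFst d) s (lexApp (lexSnd d) s)).symm))
  refine SameArrow.trans ?_ (sum_sigma_same _).symm
  exact C.add.op_map_same _ fun x => C.add.op_map_same _ fun y =>
    (prodIso_sigmaCongrRight σ f g g' hg (fun s => P x s (lexApp y s))
      (fun s => P' x s (e x s (lexApp y s))) (fun s => hP x s (lexApp y s)) hfg).symm

/-- The distributivity transformation commutes with bijections of the factors. -/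
lemma δ_prodIso {S' : Type} [LinearOrder S'] [Finite S'] {Y : S → Type} [∀ s, LinearOrder (Y s)]
    [∀ s, Finite (Y s)] (σ : S' ≃ S) (f : isometriesOperad.Op S) (f' : isometriesOperad.Op S')
    (hf : f' = isometriesOperad.act σ f) (P : ∀ s, Y s → C.A.Ob) :
    prodIso f (fun s => (C.add.sum (Y s)).obj (P s)) f'
        (fun s => (C.add.sum (Y (σ s))).obj (P (σ s))) σ hf (fun _ => rfl) ≫
      C.δ f' (fun s => P (σ s)) =
    C.δ f P ≫
      (C.add.sum (Lex (∀ s, Y s))).map (X := fun y => (C.mul.op f).obj fun s => P s (lexApp y s))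
        (Y := fun y => (C.mul.op f').obj fun s => P (σ s) (lexApp y (σ s)))
        (fun y => prodIso f (fun s => P s (lexApp y s)) f' (fun s => P (σ s) (lexApp y (σ s))) σ hf
          (fun _ => rfl)) ≫
      (C.add.perm (lexPiComp σ Y) fun y =>
        (C.mul.op f').obj fun s => P (σ s) (lexApp y s)).hom := by
  subst hf
  have h := C.δ_mul_equivariant σ f P
  simp only [prodIso, eqToHom_refl, Category.comp_id]
  exact inv_comp_eq_of_conj _ _ _ _ (C.add.opIso _ fun y : Lex (∀ s, Y s) =>
    C.mul.τ σ f fun s => P s (lexApp y s)) h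

/-- Expansion commutes with bijections of the outer factors. -/
lemma expand_relabel_factors {S' : Type} [LinearOrder S'] [Finite S'] (σ : S' ≃ S)
    (f : isometriesOperad.Op S) (f' : isometriesOperad.Op S')
    (hf : f' = isometriesOperad.act σ f) (g : ∀ s, isometriesOperad.Op (T s))
    (P : ∀ x s, Y x s → T s → C.A.Ob)
    (hfg : isometriesOperad.comp f' (fun s => g (σ s)) =
      isometriesOperad.act (lexSigmaCongrLeft σ T) (isometriesOperad.comp f g)) :
    relabel (Equiv.refl X) σ hf (P := fun x s => C.sumProd (Y x s) (g s) (P x s))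
        (P' := fun x s => C.sumProd (Y x (σ s)) (g (σ s)) (P x (σ s))) (fun _ _ => rfl) ≫
      expand f' (fun s => g (σ s)) (fun x s => P x (σ s)) =
    expand f g P ≫ relabel (lexSigmaCongrRight fun x => lexPiComp σ (Y x))
      (lexSigmaCongrLeft σ T) hfg (P' := fun d z =>
        P (lexFst d) (σ (lexFst z)) (lexApp (lexSnd d) (lexFst z)) (lexSnd z))
      fun _ _ => rfl := by
  refine SameArrow.eq ?_
  refine (SameArrow.comp (relabel_refl_same σ hf _) (expand_same f' (fun s => g (σ s)) (fun x s => P x (σ s)))).trans ?_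
  refine (SameArrow.of_eq (C.add.op_map_comp PUnit.unit _ _).symm).trans ?_
  refine (C.add.op_map_same _ fun x => SameArrow.of_eq
    (δ_prodIso σ f f' hf fun s y => (C.mul.op (g s)).obj (P x s y))).trans ?_
  refine (SameArrow.of_eq (C.add.op_map_comp PUnit.unit _ _)).trans ?_
  refine SameArrow.comp (expand_same f g P).symm ?_
  refine (SameArrow.of_eq (C.add.op_map_comp PUnit.unit _ _)).trans ?_
  refine SameArrow.comp ?_ ((perm_sigmaCongrRight (fun x => lexPiComp σ (Y x)) fun d =>
    (C.mul.op f').obj fun s => (C.mul.op (g (σ s))).obj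
      (P (lexFst d) (σ s) (lexApp (lexSnd d) s))).symm.trans
    (perm_same _ fun d => (C.mul.op_comp_obj f' (fun s => g (σ s)) fun s =>
      P (lexFst d) (σ s) (lexApp (lexSnd d) s)).symm))
  refine SameArrow.trans ?_ (sum_sigma_same _).symm
  exact C.add.op_map_same _ fun x => C.add.op_map_same _ fun y =>
    (prodIso_sigmaCongrLeft σ f f' hf g (fun s => P x s (lexApp y s))
      (fun s => P x (σ s) (lexApp y (σ s))) (fun _ _ => rfl) hfg).symm

/-- Expansion commutes with bijections of the outer summands. -/
lemma expand_relabel_summands {X' : Type} [LinearOrder X'] [Finite X'] (e : X' ≃ X)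
    (f : isometriesOperad.Op S) (hf : f = isometriesOperad.act (Equiv.refl S) f)
    (g : ∀ s, isometriesOperad.Op (T s)) (P : ∀ x s, Y x s → T s → C.A.Ob)
    (hfg : isometriesOperad.comp f g =
      isometriesOperad.act (Equiv.refl _) (isometriesOperad.comp f g)) :
    relabel e (Equiv.refl S) hf (P := fun x s => C.sumProd (Y (e x) s) (g s) (P (e x) s))
        (P' := fun x s => C.sumProd (Y x s) (g s) (P x s)) (fun _ _ => rfl) ≫ expand f g P =
    expand f g (fun x => P (e x)) ≫ relabel (lexSigmaCongrLeft e fun x => Lex (∀ s, Y x s))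
      (Equiv.refl _) hfg (P' := fun d z =>
        P (lexFst d) (lexFst z) (lexApp (lexSnd d) (lexFst z)) (lexSnd z))
      fun _ _ => rfl := by
  refine SameArrow.eq ?_
  -- The factors are not moved, so the relabelling is a mere permutation of summands. The square is
  -- its naturality, and after expansion it becomes a block permutation.
  refine (SameArrow.comp (relabel_same_perm _ _ _ _ (OrderIso.refl S) fun _ => rfl)
    (expand_same f g P)).trans ?_
  refine (SameArrow.of_eq (perm_naturality e _).symm).trans ?_
  refine SameArrow.comp (expand_same f g _).symm ?_
  refine SameArrow.trans ?_ (relabel_same_perm _ _ _ _ (OrderIso.refl _) fun _ => rfl).symm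
  refine SameArrow.trans ?_ (perm_sigmaCongrLeft e _).symm
  exact perm_same e fun x => congrArg _ (funext fun y =>
    (C.mul.op_comp_obj f g fun s => P x s (lexApp y s)).symm)

end Expand

end LPermutativeCategory

end

/-! ### Associativity of expansion -/

noncomputable section

/-- The comparison of the index sets of the two ways of expanding a threefold sum of products. -/
def lexBindAssoc {X S : Type} {Y : X → S → Type} {T : S → Type} (W : ∀ x s, Y x s → T s → Type) :
    Lex (Σ x, Lex (∀ s, Lex (Σ y, Lex (∀ t, W x s y t)))) ≃
      Lex (Σ d : Lex (Σ x, Lex (∀ s, Y x s)), Lex (∀ z : Lex (Σ s, T s),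
        W (lexFst d) (lexFst z) (lexApp (lexSnd d) (lexFst z)) (lexSnd z))) :=
  -- Of the three bijections only this one can fail to be monotone; the other two induce identities.
  (lexSigmaCongrRight fun x => lexDistrib fun s y => Lex (∀ t, W x s y t)).trans
    ((lexSigmaAssoc fun x (y : Lex (∀ s, Y x s)) => Lex (∀ s, Lex (∀ t, W x s (lexApp y s) t))).trans
      (lexSigmaCongrRight fun d => lexPiCurry fun s t =>
        W (lexFst d) s (lexApp (lexSnd d) s) t))

/-- Both bracketings address the same entry of `P`. This supplies the compatibility hypothesis `hP`
of `expand_assoc`. -/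
lemma lexBindAssoc_apply {X S : Type} {Y : X → S → Type} {T : S → Type} {R : ∀ s, T s → Type}
    {W : ∀ x s, Y x s → T s → Type} {A : Type*} (P : ∀ x s y t, W x s y t → R s t → A)
    (d : Lex (Σ x, Lex (∀ s, Lex (Σ y, Lex (∀ t, W x s y t)))))
    (z : Lex (Σ x : Lex (Σ s, T s), R (lexFst x) (lexSnd x))) :
    P (lexFst (lexFst (lexBindAssoc W d))) (lexFst (lexFst z))
        (lexApp (lexSnd (lexFst (lexBindAssoc W d))) (lexFst (lexFst z))) (lexSnd (lexFst z))
        (lexApp (lexSnd (lexBindAssoc W d)) (lexFst z)) (lexSnd z) =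
      P (lexFst d) (lexFst ((lexSigmaAssoc R).symm z))
        (lexFst (lexApp (lexSnd d) (lexFst ((lexSigmaAssoc R).symm z))))
        (lexFst (lexSnd ((lexSigmaAssoc R).symm z)))
        (lexApp (lexSnd (lexApp (lexSnd d) (lexFst ((lexSigmaAssoc R).symm z))))
          (lexFst (lexSnd ((lexSigmaAssoc R).symm z))))
        (lexSnd (lexSnd ((lexSigmaAssoc R).symm z))) := rfl

namespace LPermutativeCategory

variable {C : LPermutativeCategory.{u}}

lemma δ_same {S : Type} {T : S → Type} [LinearOrder S] [Finite S] [∀ s, LinearOrder (T s)]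
    [∀ s, Finite (T s)] (f : isometriesOperad.Op S) {P Q : ∀ s, T s → C.A.Ob}
    (h : ∀ s t, P s t = Q s t) : C.δ f P ∼ₐ C.δ f Q := by
  obtain rfl : P = Q := funext fun s => funext (h s)
  exact SameArrow.refl _

section ExpandAssoc

variable {S : Type} [LinearOrder S] [Finite S] {T : S → Type} [∀ s, LinearOrder (T s)]
  [∀ s, Finite (T s)] {R : ∀ s, T s → Type} [∀ s t, LinearOrder (R s t)] [∀ s t, Finite (R s t)]

/-- The part of associativity that lies over one outer summand. Distributing over an iterated sum in
one go is distributing twice, by `δ_add_comp`, and naturality of `δ` moves the inner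
distributivities past the outer one. -/
lemma δ_expand {Y : S → Type} [∀ s, LinearOrder (Y s)] [∀ s, Finite (Y s)]
    {W : ∀ s, Y s → T s → Type} [∀ s y t, LinearOrder (W s y t)] [∀ s y t, Finite (W s y t)]
    (f : isometriesOperad.Op S) (g : ∀ s, isometriesOperad.Op (T s))
    (h : ∀ s t, isometriesOperad.Op (R s t)) (P : ∀ s y t, W s y t → R s t → C.A.Ob) :
    ((C.mul.op f).map (X := fun s => C.sumProd (Y s) (g s) fun y t =>
          C.sumProd (W s y t) (h s t) (P s y t))
        (Y := fun s => C.sumProd (Lex (Σ y, Lex (∀ t, W s y t)))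
          (isometriesOperad.comp (g s) (h s)) fun d z =>
            P s (lexFst d) (lexFst z) (lexApp (lexSnd d) (lexFst z)) (lexSnd z))
        (fun s => expand (g s) (h s) (P s)) ≫
      C.δ f fun s (d : Lex (Σ y, Lex (∀ t, W s y t))) =>
        (C.mul.op (isometriesOperad.comp (g s) (h s))).obj fun z =>
          P s (lexFst d) (lexFst z) (lexApp (lexSnd d) (lexFst z)) (lexSnd z)) ≫
      (C.add.perm (lexDistrib fun s y => Lex (∀ t, W s y t)) fun d =>
        (C.mul.op f).obj fun s => (C.mul.op (isometriesOperad.comp (g s) (h s))).obj fun z =>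
          P s (lexApp (lexFst d) s) (lexFst z) (lexApp (lexApp (lexSnd d) s) (lexFst z))
            (lexSnd z)).hom ∼ₐ
    C.δ f (fun s y => (C.mul.op (g s)).obj fun t => C.sumProd (W s y t) (h s t) (P s y t)) ≫
      (C.add.sum (Lex (∀ s, Y s))).map
        (X := fun y => (C.mul.op f).obj fun s => (C.mul.op (g s)).obj fun t =>
          C.sumProd (W s (lexApp y s) t) (h s t) (P s (lexApp y s) t))
        (Y := fun y => (C.add.sum (Lex (∀ s, Lex (∀ t, W s (lexApp y s) t)))).obj fun w =>
          (C.mul.op f).obj fun s => (C.mul.op (g s)).obj fun t => (C.mul.op (h s t)).obj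
            (P s (lexApp y s) t (lexApp (lexApp w s) t)))
        fun y => (C.mul.op f).map (X := fun s => (C.mul.op (g s)).obj fun t =>
            C.sumProd (W s (lexApp y s) t) (h s t) (P s (lexApp y s) t))
          (Y := fun s => (C.add.sum (Lex (∀ t, W s (lexApp y s) t))).obj fun w =>
            (C.mul.op (g s)).obj fun t => (C.mul.op (h s t)).obj
              (P s (lexApp y s) t (lexApp w t)))
          (fun s => C.δ (g s) fun t w => (C.mul.op (h s t)).obj (P s (lexApp y s) t w)) ≫
        C.δ f fun s (w : Lex (∀ t, W s (lexApp y s) t)) => (C.mul.op (g s)).obj fun t =>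
          (C.mul.op (h s t)).obj (P s (lexApp y s) t (lexApp w t)) := by
  have hQ : ∀ s (d : Lex (Σ y, Lex (∀ t, W s y t))),
      (C.mul.op (isometriesOperad.comp (g s) (h s))).obj (fun z =>
        P s (lexFst d) (lexFst z) (lexApp (lexSnd d) (lexFst z)) (lexSnd z)) =
      (C.mul.op (g s)).obj fun t => (C.mul.op (h s t)).obj
        (P s (lexFst d) t (lexApp (lexSnd d) t)) := fun s d =>
    C.mul.op_comp_obj (g s) (h s) fun t => P s (lexFst d) t (lexApp (lexSnd d) t)
  -- The products for `g⟨h⟩` are first replaced by the iterated products, to which they are strictly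
  -- equal.
  have key := (SameArrow.comp (δ_same f hQ) (perm_same (lexDistrib fun s y => Lex (∀ t, W s y t))
    fun d => congrArg (C.mul.op f).obj (funext fun s =>
      hQ s (toLex ⟨lexApp (lexFst d) s, lexApp (lexSnd d) s⟩)))).trans
    (C.δ_add_comp (R := fun s (y : Y s) => Lex (∀ t, W s y t)) f fun s y w =>
      (C.mul.op (g s)).obj fun t => (C.mul.op (h s t)).obj (P s y t (lexApp w t)))
  refine (SameArrow.of_eq (Category.assoc _ _ _)).trans ?_
  refine ((C.mul.op_map_same f fun s => expand_same (g s) (h s) (P s)).comp key).trans ?_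
  refine (SameArrow.of_eq (Category.assoc _ _ _).symm).trans ?_
  refine (SameArrow.of_eq (congrArg (· ≫ _) (C.δ_naturality f fun s y => C.δ (g s) fun t w =>
    (C.mul.op (h s t)).obj (P s y t w)))).trans ?_
  refine (SameArrow.of_eq (Category.assoc _ _ _)).trans ?_
  exact SameArrow.comp_right _ (SameArrow.of_eq (C.add.op_map_comp PUnit.unit _ _).symm)

variable {X : Type} [LinearOrder X] [Finite X] {Y : X → S → Type} [∀ x s, LinearOrder (Y x s)]
  [∀ x s, Finite (Y x s)] {W : ∀ x s, Y x s → T s → Type} [∀ x s y t, LinearOrder (W x s y t)]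
  [∀ x s y t, Finite (W x s y t)]

/-- Associativity of expansion. -/
lemma expand_assoc (f : isometriesOperad.Op S) (g : ∀ s, isometriesOperad.Op (T s))
    (h : ∀ s t, isometriesOperad.Op (R s t)) (P : ∀ x s y t, W x s y t → R s t → C.A.Ob)
    (hf : isometriesOperad.comp (isometriesOperad.comp f g)
        (fun x : Lex (Σ s, T s) => h (lexFst x) (lexSnd x)) =
      isometriesOperad.act (lexSigmaAssoc R).symm
        (isometriesOperad.comp f fun s => isometriesOperad.comp (g s) (h s)))
    (hP) :
    sumProdMap f (fun x s => expand (g s) (h s) (P x s)) ≫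
      expand f (fun s => isometriesOperad.comp (g s) (h s))
        (fun x s (d : Lex (Σ y, Lex (∀ t, W x s y t))) z =>
          P x s (lexFst d) (lexFst z) (lexApp (lexSnd d) (lexFst z)) (lexSnd z)) ≫
      relabel (lexBindAssoc W) (lexSigmaAssoc R).symm hf hP =
    expand f g (fun x s y t => C.sumProd (W x s y t) (h s t) (P x s y t)) ≫
      expand (isometriesOperad.comp f g)
        (fun x : Lex (Σ s, T s) => h (lexFst x) (lexSnd x))
        (Y := fun (d : Lex (Σ x, Lex (∀ s, Y x s))) z =>
          W (lexFst d) (lexFst z) (lexApp (lexSnd d) (lexFst z)) (lexSnd z))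
        (fun (d : Lex (Σ x, Lex (∀ s, Y x s))) z =>
          P (lexFst d) (lexFst z) (lexApp (lexSnd d) (lexFst z)) (lexSnd z)) := by
  -- The factors are renamed monotonically, and the summands are renamed monotonically except by
  -- distributivity. What remains of the relabelling is the permutation that occurs in `δ_add_comp`,
  -- one for each `x`.
  have hperm : relabel (lexBindAssoc W) (lexSigmaAssoc R).symm hf
      (P := fun d z => P (lexFst d) (lexFst z) (lexFst (lexApp (lexSnd d) (lexFst z)))
        (lexFst (lexSnd z)) (lexApp (lexSnd (lexApp (lexSnd d) (lexFst z)))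
          (lexFst (lexSnd z))) (lexSnd (lexSnd z)))
      (P' := fun d z => P (lexFst (lexFst d)) (lexFst (lexFst z))
        (lexApp (lexSnd (lexFst d)) (lexFst (lexFst z))) (lexSnd (lexFst z))
          (lexApp (lexSnd d) (lexFst z)) (lexSnd z)) hP ∼ₐ
      (C.add.sum X).map (X := fun x => (C.add.sum (Lex (∀ s, Lex (Σ y, Lex (∀ t, W x s y t))))).obj
          fun d => (C.mul.op f).obj fun s => (C.mul.op (isometriesOperad.comp (g s) (h s))).obj
            fun z => P x s (lexFst (lexApp d s)) (lexFst z) (lexApp (lexSnd (lexApp d s)) (lexFst z))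
              (lexSnd z))
        (Y := fun x => (C.add.sum (Lex (Σ y : Lex (∀ s, Y x s),
          Lex (∀ s, Lex (∀ t, W x s (lexApp y s) t))))).obj fun d =>
          (C.mul.op f).obj fun s => (C.mul.op (isometriesOperad.comp (g s) (h s))).obj fun z =>
          P x s (lexApp (lexFst d) s) (lexFst z) (lexApp (lexApp (lexSnd d) s) (lexFst z))
            (lexSnd z))
        fun x => (C.add.perm (lexDistrib fun s y => Lex (∀ t, W x s y t)) fun d =>
          (C.mul.op f).obj fun s => (C.mul.op (isometriesOperad.comp (g s) (h s))).obj fun z =>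
          P x s (lexApp (lexFst d) s) (lexFst z) (lexApp (lexApp (lexSnd d) s) (lexFst z))
            (lexSnd z)).hom := by
    refine (relabel_same_perm _ _ _ _
      (Equiv.orderIsoOfStrictMono _ (lexSigmaAssoc_strictMono R)).symm fun _ => rfl).trans ?_
    refine (SameArrow.of_eq (perm_trans _ _ _)).trans ?_
    refine (SameArrow.comp_id_right (perm_orderIso ((Equiv.orderIsoOfStrictMono _
      (lexSigmaAssoc_strictMono _)).trans (Equiv.orderIsoOfStrictMono _
        (lexSigmaCongrRight_strictMono _ fun _ => lexPiCurry_strictMono _))) _ fun _ => rfl)).trans ?_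
    refine SameArrow.trans (perm_same _ fun d => ?_) (perm_sigmaCongrRight
      (fun x => lexDistrib fun s y => Lex (∀ t, W x s y t)) fun d =>
        (C.mul.op f).obj fun s => (C.mul.op (isometriesOperad.comp (g s) (h s))).obj fun z =>
          P (lexFst d) s (lexApp (lexFst (lexSnd d)) s) (lexFst z)
            (lexApp (lexApp (lexSnd (lexSnd d)) s) (lexFst z)) (lexSnd z))
    refine (C.mul.op_comp_obj (isometriesOperad.comp f g)
      (fun x : Lex (Σ s, T s) => h (lexFst x) (lexSnd x)) fun x =>
        P (lexFst d) (lexFst x) (lexApp (lexFst (lexSnd d)) (lexFst x)) (lexSnd x)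
          (lexApp (lexApp (lexSnd (lexSnd d)) (lexFst x)) (lexSnd x))).trans ?_
    refine (C.mul.op_comp_obj f g fun s t => (C.mul.op (h s t)).obj
        (P (lexFst d) s (lexApp (lexFst (lexSnd d)) s) t
          (lexApp (lexApp (lexSnd (lexSnd d)) s) t))).trans ?_
    exact congrArg (C.mul.op f).obj (funext fun s => (C.mul.op_comp_obj (g s) (h s) fun t =>
        P (lexFst d) s (lexApp (lexFst (lexSnd d)) s) t
          (lexApp (lexApp (lexSnd (lexSnd d)) s) t)).symm)
  refine SameArrow.eq ?_
  refine (SameArrow.comp_right _ ((expand_same f (fun s => isometriesOperad.comp (g s) (h s))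
    fun x s (d : Lex (Σ y, Lex (∀ t, W x s y t))) z =>
      P x s (lexFst d) (lexFst z) (lexApp (lexSnd d) (lexFst z)) (lexSnd z)).comp hperm)).trans ?_
  refine (SameArrow.of_eq (Category.assoc _ _ _).symm).trans ?_
  refine (SameArrow.of_eq (congrArg (· ≫ _) (C.add.op_map_comp PUnit.unit _ _).symm)).trans ?_
  refine (SameArrow.of_eq (C.add.op_map_comp PUnit.unit _ _).symm).trans ?_
  refine (C.add.op_map_same _ fun x => δ_expand f g h (P x)).trans ?_
  refine (SameArrow.of_eq (C.add.op_map_comp PUnit.unit _ _)).trans ?_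
  refine SameArrow.comp (expand_same f g fun x s y t =>
    C.sumProd (W x s y t) (h s t) (P x s y t)).symm ?_
  refine SameArrow.trans ?_ ((sum_sigma_same _).symm.trans (expand_same _ _ _).symm)
  refine C.add.op_map_same _ fun x => C.add.op_map_same _ fun y => ?_
  -- The two successive distributivities, for `g` and then for `f`, make up the one for the
  -- composite operation.
  exact (C.δ_mul_comp f g fun s t (w : W x s (lexApp y s) t) =>
    (C.mul.op (h s t)).obj (P x s (lexApp y s) t w)).symm

end ExpandAssoc

end LPermutativeCategory

end

/-! ### The constraint of `ℱC`: naturality and associativity -/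

noncomputable section

namespace LPermutativeCategory

open RingIndex

variable {C : LPermutativeCategory.{u}}

/-- Naturality of expansion. -/
lemma expand_naturality {X S : Type} [LinearOrder X] [Finite X] [LinearOrder S] [Finite S]
    {Y : X → S → Type} [∀ x s, LinearOrder (Y x s)] [∀ x s, Finite (Y x s)]
    {T : S → Type} [∀ s, LinearOrder (T s)] [∀ s, Finite (T s)] (f : isometriesOperad.Op S)
    (g : ∀ s, isometriesOperad.Op (T s)) {P Q : ∀ x s, Y x s → T s → C.A.Ob}
    (U : ∀ x s y t, P x s y t ⟶ Q x s y t) :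
    sumProdMap f (fun x s => sumProdMap (g s) (U x s)) ≫ expand f g Q =
      expand f g P ≫ sumProdMap (isometriesOperad.comp f g)
        (P := fun (d : Lex (Σ x, Lex (∀ s, Y x s))) z =>
          P (lexFst d) (lexFst z) (lexApp (lexSnd d) (lexFst z)) (lexSnd z))
        (Q := fun d z => Q (lexFst d) (lexFst z) (lexApp (lexSnd d) (lexFst z)) (lexSnd z))
        fun d z => U (lexFst d) (lexFst z) (lexApp (lexSnd d) (lexFst z)) (lexSnd z) := by
  refine SameArrow.eq ?_
  refine (SameArrow.comp_right _ (expand_same f g Q)).trans ?_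
  refine (SameArrow.of_eq (C.add.op_map_comp PUnit.unit _ _).symm).trans ?_
  refine (C.add.op_map_same _ fun x => SameArrow.of_eq (C.δ_naturality f fun s y =>
    (C.mul.op (g s)).map (X := P x s y) (Y := Q x s y) (U x s y))).trans ?_
  refine (SameArrow.of_eq (C.add.op_map_comp PUnit.unit _ _)).trans ?_
  refine SameArrow.comp (expand_same f g P).symm ?_
  refine SameArrow.trans ?_ (sum_sigma_same _).symm
  exact C.add.op_map_same _ fun x => C.add.op_map_same _ fun y =>
    (C.mul.op_comp f g (P := fun s => P x s (lexApp y s)) (Q := fun s => Q x s (lexApp y s))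
      fun s => U x s (lexApp y s)).symm

/-- The lax structure is an expansion followed by a relabelling. -/
lemma laxComp_eq {X Y Z : RingIndex} (h₁ : X ⟶ Y) (h₂ : Y ⟶ Z) (P : Index X → C.A.Ob)
    (p : Index Z) : C.laxComp h₁ h₂ P p =
      expand (X := Preimage h₂ p) (S := Fibre h₂.ψ p.1)
        (Y := fun y j => Preimage h₁ ⟨j.1, ofLex y.1 j⟩) (T := fun j => Fibre h₁.ψ j.1)
        (h₂.f p.1) (fun j => h₁.f j.1) (fun _ _ x i => P ⟨i.1, ofLex x.1 i⟩) ≫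
      relabel (preimageEquiv h₁ h₂ p) (fibreEquiv h₁.ψ h₂.ψ p.1) rfl
        (P' := fun (x : Preimage (h₁ ≫ h₂) p) i => P ⟨i.1, ofLex x.1 i⟩) fun _ _ => rfl := by
  refine SameArrow.eq (SameArrow.trans ?_ (SameArrow.of_eq (Category.assoc _ _ _).symm))
  refine SameArrow.comp_right _ (SameArrow.comp_right _ (SameArrow.comp_left ?_ _))
  exact C.add.op_map_same _ fun d => (prodIso_same _ _ _ _ _ _ _).symm

lemma laxComp_naturality {X Y Z : RingIndex} (h₁ : X ⟶ Y) (h₂ : Y ⟶ Z) {P Q : Index X → C.A.Ob}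
    (U : ∀ p, P p ⟶ Q p) (p : Index Z) :
    (C.laxMap h₂).map (X := (C.laxMap h₁).obj P) (Y := (C.laxMap h₁).obj Q)
        ((C.laxMap h₁).map (X := P) (Y := Q) U) p ≫ C.laxComp h₁ h₂ Q p =
      C.laxComp h₁ h₂ P p ≫ (C.laxMap (h₁ ≫ h₂)).map (X := P) (Y := Q) U p := by
  rw [laxComp_eq, laxComp_eq]
  refine (Category.assoc _ _ _).symm.trans ?_
  refine (congrArg (· ≫ _) (expand_naturality (X := Preimage h₂ p) (S := Fibre h₂.ψ p.1)
    (Y := fun y j => Preimage h₁ ⟨j.1, ofLex y.1 j⟩) (T := fun j => Fibre h₁.ψ j.1)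
    (h₂.f p.1) (fun j => h₁.f j.1) (P := fun y j x i => P ⟨i.1, ofLex x.1 i⟩)
    (Q := fun y j x i => Q ⟨i.1, ofLex x.1 i⟩) fun _ _ x i => U ⟨i.1, ofLex x.1 i⟩)).trans ?_
  refine (Category.assoc _ _ _).trans (Eq.trans ?_ (Category.assoc _ _ _).symm)
  refine congrArg (_ ≫ ·) (relabel_naturality _ _ _ _ _ _ _ fun _ _ => ?_).symm
  exact SameArrow.refl _

/-- The outer indices are the images of the innermost one under the maps `ψ`, so the innermost one
determines them. -/
lemma sigma_fibre_ext₂ {k l m n : ℕ} {ψ₁ : Fin k → Option (Fin l)} {ψ₂ : Fin l → Option (Fin m)}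
    {ψ₃ : Fin m → Option (Fin n)} {r : Fin n}
    {x y : Lex (Σ j : Fibre ψ₃ r, Lex (Σ i : Fibre ψ₂ j, Fibre ψ₁ i))}
    (h : (lexSnd (lexSnd x)).1 = (lexSnd (lexSnd y)).1) : x = y := by
  obtain ⟨⟨j, hj⟩, ⟨⟨i, hi⟩, ⟨a, ha⟩⟩⟩ := x
  obtain ⟨⟨j', hj'⟩, ⟨⟨i', hi'⟩, ⟨a', ha'⟩⟩⟩ := y
  obtain rfl : a = a' := h
  obtain rfl : i = i' := Option.some_injective _ (ha.symm.trans ha')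
  obtain rfl : j = j' := Option.some_injective _ (hi.symm.trans hi')
  rfl

/-- Composition in the index category is associative only up to propositional equality. The
hypotheses compare the bijections on underlying indices, so they make sense before the two morphisms
are identified. -/
lemma relabel_eqToHom {X Z : RingIndex} {h h' : X ⟶ Z} (hh : h = h') {p : Index Z} {I S : Type}
    [LinearOrder I] [Finite I] [LinearOrder S] [Finite S] {f : isometriesOperad.Op S}
    {e : I ≃ Preimage h p} {e' : I ≃ Preimage h' p} {σ : Fibre h.ψ p.1 ≃ S}
    {σ' : Fibre h'.ψ p.1 ≃ S} {hf : h.f p.1 = isometriesOperad.act σ f}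
    {hf' : h'.f p.1 = isometriesOperad.act σ' f} {P₀ : I → S → C.A.Ob} {P : Index X → C.A.Ob} {hP}
    {hP'} (he : ∀ x i hi hi', ofLex (e x).1 ⟨i, hi⟩ = ofLex (e' x).1 ⟨i, hi'⟩)
    (hσ : ∀ i hi hi', σ ⟨i, hi⟩ = σ' ⟨i, hi'⟩) (hE) :
    relabel e σ hf (P := P₀) (P' := fun x i => P ⟨i.1, ofLex x.1 i⟩) hP =
      relabel e' σ' hf' (P := P₀) (P' := fun x i => P ⟨i.1, ofLex x.1 i⟩) hP' ≫ eqToHom hE := by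
  subst hh
  rw [eqToHom_refl, Category.comp_id]
  exact relabel_congr (fun x => Subtype.ext (funext fun i => he x i.1 i.2 i.2))
    fun i => hσ i.1 i.2 i.2

/-- The pasting diagram for associativity of `ω`. The equation `h₀` is associativity of expansion;
`h₁`, `h₂`, `h₃` move relabellings of inner sums, outer factors and outer summands across an
expansion; `h` compares the relabellings that have been collected at the end. -/
lemma _root_.CategoryTheory.comp_assoc_of_squares {D : Type*} [Category* D]
    {a b c d d' d'' e e' e'' v v' z z' : D} {m₁ : a ⟶ b} {m₂ : b ⟶ c} {e₁ : c ⟶ d} {r₁ : d ⟶ z}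
    {E₁ : b ⟶ d'} {R₁ : d' ⟶ d} {R₀ : d' ⟶ d''} {F₁ : a ⟶ e} {F₂ : e ⟶ d''} {ρ₁ : e ⟶ v}
    {ρ₂ : v ⟶ e'} {E₂ : v ⟶ v'} {F₃ : e' ⟶ e''} {R₂ : d'' ⟶ v'} {R₃ : v' ⟶ e''} {r₃ : e'' ⟶ z'}
    {q : z' ⟶ z} (h₁ : m₂ ≫ e₁ = E₁ ≫ R₁) (h₀ : m₁ ≫ E₁ ≫ R₀ = F₁ ≫ F₂)
    (h₂ : ρ₁ ≫ E₂ = F₂ ≫ R₂) (h₃ : ρ₂ ≫ F₃ = E₂ ≫ R₃)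
    (h : R₁ ≫ r₁ = R₀ ≫ R₂ ≫ R₃ ≫ r₃ ≫ q) :
    (m₁ ≫ m₂) ≫ e₁ ≫ r₁ = (F₁ ≫ ρ₁ ≫ ρ₂) ≫ (F₃ ≫ r₃) ≫ q := by
  simp only [Category.assoc]
  rw [reassoc_of% h₁, h, reassoc_of% h₃, reassoc_of% h₂, ← reassoc_of% h₀]

lemma relabel_trans₄ {X₀ X₁ X₂ X₃ X₄ S₀ S₁ S₂ S₃ S₄ : Type} [LinearOrder X₀] [Finite X₀]
    [LinearOrder X₁] [Finite X₁] [LinearOrder X₂] [Finite X₂] [LinearOrder X₃] [Finite X₃]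
    [LinearOrder X₄] [Finite X₄] [LinearOrder S₀] [Finite S₀] [LinearOrder S₁] [Finite S₁]
    [LinearOrder S₂] [Finite S₂] [LinearOrder S₃] [Finite S₃] [LinearOrder S₄] [Finite S₄]
    {f₀ : isometriesOperad.Op S₀} {f₁ : isometriesOperad.Op S₁} {f₂ : isometriesOperad.Op S₂}
    {f₃ : isometriesOperad.Op S₃} {f₄ : isometriesOperad.Op S₄} {e₁ : X₀ ≃ X₁} {σ₁ : S₁ ≃ S₀}
    {hf₁ : f₁ = isometriesOperad.act σ₁ f₀} {e₂ : X₁ ≃ X₂} {σ₂ : S₂ ≃ S₁}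
    {hf₂ : f₂ = isometriesOperad.act σ₂ f₁} {e₃ : X₂ ≃ X₃} {σ₃ : S₃ ≃ S₂}
    {hf₃ : f₃ = isometriesOperad.act σ₃ f₂} {e₄ : X₃ ≃ X₄} {σ₄ : S₄ ≃ S₃}
    {hf₄ : f₄ = isometriesOperad.act σ₄ f₃} {P₀ : X₀ → S₀ → C.A.Ob} {P₁ : X₁ → S₁ → C.A.Ob}
    {P₂ : X₂ → S₂ → C.A.Ob} {P₃ : X₃ → S₃ → C.A.Ob} {P₄ : X₄ → S₄ → C.A.Ob}
    {hP₁ : ∀ x s, P₁ (e₁ x) s = P₀ x (σ₁ s)} {hP₂ : ∀ x s, P₂ (e₂ x) s = P₁ x (σ₂ s)}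
    {hP₃ : ∀ x s, P₃ (e₃ x) s = P₂ x (σ₃ s)} {hP₄ : ∀ x s, P₄ (e₄ x) s = P₃ x (σ₄ s)}
    {a : C.A.Ob} (q : C.sumProd X₄ f₄ P₄ ⟶ a) :
    relabel e₁ σ₁ hf₁ hP₁ ≫ relabel e₂ σ₂ hf₂ hP₂ ≫ relabel e₃ σ₃ hf₃ hP₃ ≫ relabel e₄ σ₄ hf₄ hP₄ ≫ q =
        relabel (((e₁.trans e₂).trans e₃).trans e₄) (σ₄.trans (σ₃.trans (σ₂.trans σ₁)))
          (hf₄.trans ((congrArg _ (hf₃.trans ((congrArg _ (hf₂.trans ((congrArg _ hf₁).trans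
            (isometriesOperad.act_trans _ _ _)))).trans (isometriesOperad.act_trans _ _ _)))).trans
              (isometriesOperad.act_trans _ _ _)))
          (fun x s => (hP₄ _ s).trans ((hP₃ _ _).trans ((hP₂ _ _).trans (hP₁ x _)))) ≫ q := by
  refine Eq.trans (by simp only [Category.assoc]) (congrArg (· ≫ q)
    ((congrArg (· ≫ relabel e₄ σ₄ hf₄ hP₄) ((congrArg (· ≫ relabel e₃ σ₃ hf₃ hP₃)
      (relabel_trans e₁ σ₁ hf₁ e₂ σ₂ hf₂ hP₁ hP₂)).trans (relabel_trans _ _ _ _ _ _ _ _))).trans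
        (relabel_trans _ _ _ _ _ _ _ _)))

/-- Every `ω` is an expansion followed by a relabelling. Once all relabellings stand at the end,
both sides consist of the same double expansion followed by a relabelling, and only the bijections
have to be compared. -/
lemma laxComp_assoc {W X Y Z : RingIndex} (h₁ : W ⟶ X) (h₂ : X ⟶ Y) (h₃ : Y ⟶ Z)
    (P : Index W → C.A.Ob) (p : Index Z) (hE) :
    (C.laxMap h₃).map (X := (C.laxMap h₂).obj ((C.laxMap h₁).obj P))
        (Y := (C.laxMap (h₁ ≫ h₂)).obj P) (fun q => C.laxComp h₁ h₂ P q) p ≫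
      C.laxComp (h₁ ≫ h₂) h₃ P p =
    C.laxComp h₂ h₃ ((C.laxMap h₁).obj P) p ≫ C.laxComp h₁ (h₂ ≫ h₃) P p ≫ eqToHom hE := by
  have hAs := expand_assoc (C := C) (X := Preimage h₃ p) (S := Fibre h₃.ψ p.1)
    (Y := fun y k => Preimage h₂ ⟨k.1, ofLex y.1 k⟩) (T := fun k => Fibre h₂.ψ k.1)
    (R := fun _ j => Fibre h₁.ψ j.1) (W := fun _ _ y j => Preimage h₁ ⟨j.1, ofLex y.1 j⟩)
    (h₃.f p.1) (fun j => h₂.f j.1) (fun _ j => h₁.f j.1)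
    (fun _ _ _ _ x i => P ⟨i.1, ofLex x.1 i⟩)
    (isometriesOperad.comp_assoc (h₃.f p.1) (fun j => h₂.f j.1) fun _ j => h₁.f j.1)
    (lexBindAssoc_apply (X := Preimage h₃ p) (S := Fibre h₃.ψ p.1)
      (Y := fun y k => Preimage h₂ ⟨k.1, ofLex y.1 k⟩) (T := fun k => Fibre h₂.ψ k.1)
      (R := fun _ j => Fibre h₁.ψ j.1) (W := fun _ _ y j => Preimage h₁ ⟨j.1, ofLex y.1 j⟩)
      fun _ _ _ _ x i => P ⟨i.1, ofLex x.1 i⟩)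
  have hN1 := expand_relabel_inner (X := Preimage h₃ p) (S := Fibre h₃.ψ p.1)
    (Y := fun y k => DoublePreimage h₁ h₂ ⟨k.1, ofLex y.1 k⟩)
    (T := fun k => Lex (Σ j : Fibre h₂.ψ k.1, Fibre h₁.ψ j.1))
    (Y' := fun y j => Preimage (h₁ ≫ h₂) ⟨j.1, ofLex y.1 j⟩)
    (T' := fun j => Fibre (h₁ ≫ h₂).ψ j.1)
    (fun y k => preimageEquiv h₁ h₂ ⟨k.1, ofLex y.1 k⟩) (fun k => fibreEquiv h₁.ψ h₂.ψ k.1)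
    (h₃.f p.1) (fun k => isometriesOperad.comp (h₂.f k.1) fun j => h₁.f j.1)
    (fun j => (h₁ ≫ h₂).f j.1) (fun _ => rfl)
    (P := fun _ _ d z => P ⟨(lexSnd z).1, ofLex (lexApp (lexSnd d) (lexFst z)).1 (lexSnd z)⟩)
    (P' := fun _ _ x i => P ⟨i.1, ofLex x.1 i⟩) (fun _ _ _ _ => rfl)
    (isometriesOperad.comp_act_right _ _ _)
  have hN2 := expand_relabel_factors (X := DoublePreimage h₂ h₃ p) (fibreEquiv h₂.ψ h₃.ψ p.1)
    (isometriesOperad.comp (h₃.f p.1) fun j => h₂.f j.1) ((h₂ ≫ h₃).f p.1) rfl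
    (Y := fun d z => Preimage h₁ ⟨(lexSnd z).1,
          ofLex (lexApp (lexSnd d) (lexFst z)).1 (lexSnd z)⟩)
    (T := fun z => Fibre h₁.ψ (lexSnd z).1) (fun z => h₁.f (lexSnd z).1)
    (fun _ _ x i => P ⟨i.1, ofLex x.1 i⟩) (isometriesOperad.comp_act_left
      (fibreEquiv h₂.ψ h₃.ψ p.1) (isometriesOperad.comp (h₃.f p.1) fun j => h₂.f j.1) fun z => h₁.f (lexSnd z).1)
  have hN3 := expand_relabel_summands (X := Preimage (h₂ ≫ h₃) p)
    (S := Fibre (h₂ ≫ h₃).ψ p.1) (preimageEquiv h₂ h₃ p)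
    (Y := fun x j => Preimage h₁ ⟨j.1, ofLex x.1 j⟩)
    (T := fun j => Fibre h₁.ψ j.1) ((h₂ ≫ h₃).f p.1) (isometriesOperad.act_refl _).symm
    (fun j => h₁.f j.1) (fun _ _ x i => P ⟨i.1, ofLex x.1 i⟩) (isometriesOperad.act_refl _).symm
  have hE' : C.sumProd (Preimage (h₁ ≫ h₂ ≫ h₃) p) ((h₁ ≫ h₂ ≫ h₃).f p.1)
        (fun x i => P ⟨i.1, ofLex x.1 i⟩) =
      C.sumProd (Preimage ((h₁ ≫ h₂) ≫ h₃) p) (((h₁ ≫ h₂) ≫ h₃).f p.1)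
        (fun x i => P ⟨i.1, ofLex x.1 i⟩) := hE
  refine Eq.trans ?_ ((comp_assoc_of_squares hN1 hAs hN2 hN3
    (r₁ := relabel (preimageEquiv (h₁ ≫ h₂) h₃ p) (fibreEquiv (h₁ ≫ h₂).ψ h₃.ψ p.1) rfl
        (P' := fun (x : Preimage ((h₁ ≫ h₂) ≫ h₃) p) i => P ⟨i.1, ofLex x.1 i⟩) fun _ _ => rfl)
    (r₃ := relabel (preimageEquiv h₁ (h₂ ≫ h₃) p) (fibreEquiv h₁.ψ (h₂ ≫ h₃).ψ p.1) rfl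
        (P' := fun (x : Preimage (h₁ ≫ h₂ ≫ h₃) p) i => P ⟨i.1, ofLex x.1 i⟩) fun _ _ => rfl)
    (q := eqToHom hE') ?_).trans ?_)
  · refine congrArg₂ (· ≫ ·) ((congrArg (sumProdMap (h₃.f p.1)) (funext fun y => funext fun k =>
      laxComp_eq h₁ h₂ P _)).trans (sumProdMap_comp _ _)) (laxComp_eq (h₁ ≫ h₂) h₃ P p)
  · refine Eq.trans ?_ (relabel_trans₄ _).symm
    refine (relabel_trans _ _ _ _ _ _ _ _).trans ?_
    refine relabel_eqToHom (Category.assoc h₁ h₂ h₃) (P := P) ?_ ?_ hE'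
    · intro x i hi hi'
      -- The coordinate of `x` at a triple of indices, taken in `ℕ` because its type depends on the
      -- triple. Both bracketings split `i` into triples with the same innermost index, hence into
      -- equal triples.
      let V (t : Lex (Σ k : Fibre h₃.ψ p.1, Lex (Σ j : Fibre h₂.ψ k.1, Fibre h₁.ψ j.1))) : ℕ :=
        ofLex (lexApp (lexSnd (lexApp (lexSnd x) (lexFst t))) (lexFst (lexSnd t))).1
          (lexSnd (lexSnd t))
      let a := fibreEquiv (h₁ ≫ h₂).ψ h₃.ψ p.1 ⟨i, hi⟩
      let b := fibreEquiv h₁.ψ (h₂ ≫ h₃).ψ p.1 ⟨i, hi'⟩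
      let c := fibreEquiv h₂.ψ h₃.ψ p.1 (lexFst b)
      have h : (toLex ⟨lexFst a, fibreEquiv h₁.ψ h₂.ψ _ (lexSnd a)⟩ :
          Lex (Σ k : Fibre h₃.ψ p.1, Lex (Σ j : Fibre h₂.ψ k.1, Fibre h₁.ψ j.1))) =
        toLex ⟨lexFst c, toLex ⟨lexSnd c, lexSnd b⟩⟩ := sigma_fibre_ext₂ rfl
      exact Fin.ext (congrArg V h)
    · intro i hi hi'
      exact sigma_fibre_ext₂ rfl
  · refine congrArg₂ (· ≫ ·) ((congrArg (_ ≫ ·) (relabel_trans _ _ _ _ _ _ _ _)).trans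
      (laxComp_eq h₂ h₃ ((C.laxMap h₁).obj P) p).symm)
      (congrArg (· ≫ _) (laxComp_eq h₁ (h₂ ≫ h₃) P p).symm)

end LPermutativeCategory

end

/-! ### Unit laws, and morphisms that select factors -/

noncomputable section

lemma SameArrow.pi_eqToHom {I : Type*} {D : Type*} [Category* D] {P Q : I → D} (h : P = Q)
    (i : I) : (eqToHom h : P ⟶ Q) i ∼ₐ 𝟙 (P i) := by
  subst h
  exact SameArrow.refl _

lemma SameArrow.id_source {D : Type*} [Category* D] {a b c : D} {f : a ⟶ b} (h : f ∼ₐ 𝟙 c) :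
    f ∼ₐ 𝟙 a :=
  h.trans (SameArrow.id_of_eq h.left.symm)

namespace RingIndex

/-- A dependent sum over at most one index has the order of its only summand, and that is the order
of `Fin l`, as in the fibre of the composite. -/
lemma fibreEquiv_symm_strictMono {l m n : ℕ} (ψ₁ : Fin l → Option (Fin m))
    (ψ₂ : Fin m → Option (Fin n)) (k : Fin n) [Subsingleton (Fibre ψ₂ k)] :
    StrictMono (fibreEquiv ψ₁ ψ₂ k).symm := by
  rintro ⟨j, i⟩ ⟨j', i'⟩ h
  obtain rfl := Subsingleton.elim j j'
  rcases lexSigma_lt.1 h with h | ⟨_, h⟩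
  · exact (lt_irrefl _ h).elim
  · exact h

lemma fibreEquiv_some_strictMono {m n : ℕ} (ψ : Fin m → Option (Fin n)) (k : Fin n) :
    StrictMono (fibreEquiv some ψ k) :=
  fun _ _ h => lexSigma_lt.2 (Or.inl h)

end RingIndex

namespace LPermutativeCategory

open RingIndex

variable {C : LPermutativeCategory.{u}}

lemma preimageEquiv_apply {X Y Z : RingIndex} {h₁ : X ⟶ Y} {h₂ : Y ⟶ Z} {p : Index Z}
    (d : DoublePreimage h₁ h₂ p) (j : Fibre h₂.ψ p.1) (i : Fibre h₁.ψ j) :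
    ofLex (preimageEquiv h₁ h₂ p d).1 (fibreIncl j i) = ofLex (lexApp (lexSnd d) j).1 i :=
  assemble_fibreIncl d j i

/-- With at most one outer summand and at most one outer factor, both sides are ordered by the
coordinates in the single inner product. -/
lemma preimageEquiv_strictMono_of_subsingleton {X Y Z : RingIndex} (h₁ : X ⟶ Y) (h₂ : Y ⟶ Z)
    (p : Index Z) [Subsingleton (Fibre h₂.ψ p.1)] [Subsingleton (Preimage h₂ p)] :
    StrictMono (preimageEquiv h₁ h₂ p) := by
  rintro ⟨y, x⟩ ⟨y', x'⟩ h
  obtain rfl := Subsingleton.elim y y'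
  rcases lexSigma_lt.1 h with h | ⟨_, j, -, i, hi, hlt⟩
  · exact (lt_irrefl _ h).elim
  · refine ⟨fibreIncl j i, fun i' h' => ?_, ?_⟩
    · obtain ⟨⟨j', i'⟩, rfl⟩ := (fibreEquiv h₁.ψ h₂.ψ p.1).symm.surjective i'
      obtain rfl := Subsingleton.elim j j'
      exact (preimageEquiv_apply ⟨y, x⟩ j i').trans
        ((hi i' h').trans (preimageEquiv_apply ⟨y, x'⟩ j i').symm)
    · exact lt_of_eq_of_lt (preimageEquiv_apply ⟨y, x⟩ j i)
        (lt_of_lt_of_eq hlt (preimageEquiv_apply ⟨y, x'⟩ j i).symm)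

lemma preimage_id_subsingleton {X : RingIndex} (p : Index X) : Subsingleton (Preimage (𝟙 X) p) :=
  ⟨fun x y => Subtype.ext (funext fun i => by
    obtain rfl : i = ⟨p.1, rfl⟩ := Subtype.ext (Option.some_injective _ i.2)
    exact Option.some_injective _ (x.2.trans y.2.symm))⟩

/-- The inner preimages are points, and the assembled family has the same coordinates as the outer
one. -/
lemma preimageEquiv_id_strictMono {X Y : RingIndex} (h : X ⟶ Y) (p : Index Y) :
    StrictMono (preimageEquiv (𝟙 X) h p) := by
  have key (d : DoublePreimage (𝟙 X) h p) (i : Fibre h.ψ p.1) :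
      ofLex (preimageEquiv (𝟙 X) h p d).1 i = ofLex (lexFst d).1 i :=
    (preimageEquiv_apply d i ⟨i.1, rfl⟩).trans
      (Option.some_injective _ (lexApp (lexSnd d) i).2)
  rintro ⟨y, x⟩ ⟨y', x'⟩ h'
  rcases lexSigma_lt.1 h' with ⟨i, hi, hlt⟩ | ⟨rfl, i, hi, hlt⟩
  · exact ⟨i, fun i' hi' => (key ⟨y, x⟩ i').trans ((hi i' hi').trans (key ⟨y', x'⟩ i').symm),
      lt_of_eq_of_lt (key ⟨y, x⟩ i) (lt_of_lt_of_eq hlt (key ⟨y', x'⟩ i).symm)⟩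
  · exact (hlt.ne ((preimage_id_subsingleton _).elim _ _)).elim

/-- Morphisms of the index category that only select factors. -/
structure Pure {X Y : RingIndex} (π : X ⟶ Y) where
  fibre : ∀ j, Unique (Fibre π.ψ j)
  preimage : ∀ p : Index Y, Unique (Preimage π p)
  f_eq : ∀ j, π.f j = isometriesOperad.one _

/-- The factor that is selected. -/
def Pure.index {X Y : RingIndex} {π : X ⟶ Y} (hπ : Pure π) (p : Index Y) : Index X :=
  ⟨(hπ.fibre p.1).default.1, ofLex (hπ.preimage p).default.1 (hπ.fibre p.1).default⟩

lemma op_one_same {G : OperadData} {A : TopCategory.{u}} (M : OperadCategory G A) {S : Type}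
    [LinearOrder S] [Finite S] [Unique S] {f : G.Op S} (hf : f = G.one S) {P Q : S → A.Ob}
    (U : ∀ s, P s ⟶ Q s) : (M.op f).map (X := P) (Y := Q) U ∼ₐ U default := by
  subst hf
  exact M.op_one U

lemma δ_one_same {S : Type} {T : S → Type} [LinearOrder S] [Finite S] [Unique S]
    [∀ s, LinearOrder (T s)] [∀ s, Finite (T s)] {f : isometriesOperad.Op S}
    (hf : f = isometriesOperad.one S) (P : ∀ s, T s → C.A.Ob) :
    C.δ f P ∼ₐ 𝟙 ((C.add.sum (T default)).obj (P default)) := by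
  subst hf
  exact C.δ_mul_one P

lemma Pure.map_same {X Y : RingIndex} {π : X ⟶ Y} (hπ : Pure π) {P Q : Index X → C.A.Ob}
    (U : ∀ p, P p ⟶ Q p) (p : Index Y) :
    (C.laxMap π).map (X := P) (Y := Q) U p ∼ₐ U (hπ.index p) := by
  let := hπ.fibre p.1
  let := hπ.preimage p
  exact (op_one_same C.add rfl _).trans (op_one_same C.mul (hπ.f_eq p.1) _)

/-- Only `δ` for the unary product with the operation `one` occurs, which is an identity, and both
index bijections are monotone. For identities this is a unit law; for projections it makes
evaluation strictly natural. -/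
lemma Pure.laxComp_same {X Y Z : RingIndex} (φ : X ⟶ Y) {π : Y ⟶ Z} (hπ : Pure π)
    (P : Index X → C.A.Ob) (p : Index Z) : C.laxComp φ π P p ∼ₐ 𝟙 ((C.laxMap (φ ≫ π)).obj P p) := by
  let := hπ.fibre p.1
  let := hπ.preimage p
  rw [laxComp_eq]
  refine (SameArrow.comp_id_left ((expand_same _ _ _).trans (C.add.op_map_id _ fun x =>
    (δ_one_same (hπ.f_eq p.1) _).id_source))).trans ?_
  exact relabel_orderIso _ _ _ _
    (Equiv.orderIsoOfStrictMono _ (fibreEquiv_symm_strictMono φ.ψ π.ψ p.1)).symm (fun _ => rfl)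
    (Equiv.orderIsoOfStrictMono _ (preimageEquiv_strictMono_of_subsingleton φ π p)) fun _ => rfl

/-- Identities select all factors. -/
def pureId (X : RingIndex) : Pure (𝟙 X) where
  fibre j := ⟨⟨⟨j, rfl⟩⟩, fun i => Subtype.ext (Option.some_injective _ i.2)⟩
  preimage p := ⟨⟨⟨toLex fun i => Fin.cast (congrArg X.a (Option.some_injective _ i.2).symm) p.2,
    rfl⟩⟩, fun _ => (preimage_id_subsingleton p).elim _ _⟩
  f_eq _ := rfl

/-- Here every inner sum has one summand, so `δ` is an identity by `δ_add_one`. -/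
lemma laxComp_id_same {X Y : RingIndex} (h : X ⟶ Y) (P : Index X → C.A.Ob) (p : Index Y) :
    C.laxComp (𝟙 X) h P p ∼ₐ 𝟙 ((C.laxMap (𝟙 X ≫ h)).obj P p) := by
  have := fun q => (pureId X).preimage q
  rw [laxComp_eq]
  refine (SameArrow.comp_id_left ((expand_same _ _ _).trans (C.add.op_map_id _ fun x =>
    SameArrow.id_source (C.δ_add_one _ _)))).trans ?_
  exact relabel_orderIso _ _ _ _
    (Equiv.orderIsoOfStrictMono _ (fibreEquiv_some_strictMono h.ψ p.1)) (fun _ => rfl)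
    (Equiv.orderIsoOfStrictMono _ (preimageEquiv_id_strictMono h p)) fun _ => rfl

lemma mapId_same (X : RingIndex) (P : Index X → C.A.Ob) (p : Index X) :
    C.laxData.mapId X P p ∼ₐ 𝟙 (P p) :=
  SameArrow.eqToHom_id (C.laxMap_id_obj X P p)

/-- `ℱC` is a lax functor. -/
lemma isLax_laxData (C : LPermutativeCategory.{u}) : C.laxData.IsLax where
  mapComp_naturality h₁ h₂ P Q U := funext fun p => laxComp_naturality h₁ h₂ (P := P) (Q := Q) U p
  mapId_naturality X P Q U := funext fun p => SameArrow.eq <|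
    (SameArrow.comp_id_right (mapId_same X Q p)).trans
      (((pureId X).map_same (P := P) (Q := Q) U p).symm.trans
        (SameArrow.comp_id_left (mapId_same X P p)).symm)
  assoc h₁ h₂ h₃ P := funext fun p => by
    refine (laxComp_assoc h₁ h₂ h₃ P p (congrArg (fun h => (C.laxMap h).obj P p)
      (Category.assoc h₁ h₂ h₃).symm)).trans ?_
    refine congrArg (_ ≫ ·) (congrArg (_ ≫ ·) (SameArrow.eq ?_))
    exact (SameArrow.eqToHom_id _).trans (SameArrow.pi_eqToHom _ p).symm
  id_left h P := funext fun p => SameArrow.eq <| by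
    refine SameArrow.trans ?_ (SameArrow.pi_eqToHom _ p).symm
    exact (SameArrow.comp_id_right ((pureId _).laxComp_same h P p)).trans (mapId_same _ _ p)
  id_right h P := funext fun p => SameArrow.eq <| by
    refine SameArrow.trans ?_ (SameArrow.pi_eqToHom _ p).symm
    refine (SameArrow.comp_id_right (laxComp_id_same h P p)).trans ?_
    exact sumProdMap_id fun _ _ => mapId_same _ _ _

/-- The projection to a factor. -/
def pureProj (X : RingIndex) (i : Fin X.m) : Pure (X.proj i) where
  fibre j := ⟨⟨⟨i, delta_self i j⟩⟩, fun i' => Subtype.ext (eq_of_delta i'.2)⟩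
  preimage p := ⟨⟨⟨toLex fun i' => Fin.cast (congrArg X.a (eq_of_delta i'.2).symm) p.2, rfl⟩⟩, by
    rintro ⟨x, hx⟩
    refine Subtype.ext (funext fun i' => ?_)
    obtain rfl : i' = ⟨i, delta_self i p.1⟩ := Subtype.ext (eq_of_delta i'.2)
    exact Option.some_injective _ hx⟩
  f_eq _ := rfl

/-- The projection to a summand. -/
def pureAddProj (a : ℕ) (x : Fin a) : Pure (addProj a x) where
  fibre j := ⟨⟨⟨j, rfl⟩⟩, fun i => Subtype.ext (Option.some_injective _ i.2)⟩
  preimage p := ⟨⟨⟨toLex fun _ => x, delta_self x p.2⟩⟩, by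
    rintro ⟨y, hy⟩
    refine Subtype.ext (funext fun i => ?_)
    obtain rfl : i = ⟨p.1, rfl⟩ := Subtype.ext (Option.some_injective _ i.2)
    exact eq_of_delta hy⟩
  f_eq _ := rfl

end LPermutativeCategory

end

/-! ### The rectification as a topological category -/

noncomputable section

namespace TopCategory

variable {A B : TopCategory.{u}} {K : Type u} [TopologicalSpace K] [CompactSpace K] [T2Space K]

open Classical in
/-- Composition of arrows, with a junk value unless they are composable. -/
def arrowComp {D : Type*} [Category* D] (g₁ g₂ : Arrow D) : Arrow D :=
  if h : g₁.right = g₂.left then Arrow.mk (g₁.hom ≫ eqToHom h ≫ g₂.hom) else g₁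

lemma arrowComp_mk {D : Type*} [Category* D] {a b c : D} (f : a ⟶ b) (g : b ⟶ c) :
    arrowComp (Arrow.mk f) (Arrow.mk g) = Arrow.mk (f ≫ g) :=
  (dif_pos rfl).trans (by simp)

/-- With a total composition, families of arrows that are composable only propositionally can be
composed without transports in the statement. -/
lemma IsTopological.continuous_arrowComp (hA : A.IsTopological) {g₁ g₂ : K → Arrow A.Ob}
    (h₁ : Continuous g₁) (h₂ : Continuous g₂) (h : ∀ k, (g₁ k).right = (g₂ k).left) :
    Continuous fun k => arrowComp (g₁ k) (g₂ k) := by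
  have := hA.continuous_comp.comp_test
    (p := fun k => (⟨(g₁ k, g₂ k), h k⟩ : {p : Arrow A.Ob × Arrow A.Ob // p.1.right = p.2.left}))
    ((h₁.prodMk h₂).subtype_mk _)
  convert this using 2 with k
  rw [arrowComp, dif_pos (h k)]

lemma IsTopological.continuous_comp_mk (hA : A.IsTopological) {a b c : K → A.Ob}
    {f : ∀ k, a k ⟶ b k} {g : ∀ k, b k ⟶ c k} (hf : Continuous fun k => Arrow.mk (f k))
    (hg : Continuous fun k => Arrow.mk (g k)) : Continuous fun k => Arrow.mk (f k ≫ g k) := by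
  have := hA.continuous_arrowComp hf hg fun _ => rfl
  simpa only [arrowComp_mk] using this

lemma arrowComp_left {D : Type*} [Category* D] (g₁ g₂ : Arrow D) :
    (arrowComp g₁ g₂).left = g₁.left := by
  unfold arrowComp
  split_ifs <;> rfl

lemma homotopic_of_continuous_app (hA : A.IsTopological) (hB : B.IsTopological)
    {G H : A.Ob ⥤ B.Ob} (α : G ⟶ H)
    (hG : KContinuous fun g : Arrow A.Ob => G.mapArrow.obj g)
    (hH : KContinuous fun g : Arrow A.Ob => H.mapArrow.obj g)
    (hα : ∀ (K : Type u) [TopologicalSpace K] [CompactSpace K] [T2Space K] (a : K → A.Ob),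
      Continuous a → Continuous fun k => Arrow.mk (α.app (a k))) :
    ContinuousMap.Homotopic
      (⟨realizationMap G, Realization.continuous_realizationMap hG⟩ :
        C(A.Realization, B.Realization))
      ⟨realizationMap H, Realization.continuous_realizationMap hH⟩ :=
  homotopic_of_natTrans α hG hH <| kContinuous_iff.2 fun K _ _ _ _ hg =>
    hB.continuous_comp_mk (hα K _ (hA.continuous_source.comp hg)) (hH.comp_test hg)

end TopCategory

open TopCategory

namespace LaxData

variable {J : Type} [SmallCategory J] [∀ X Y : J, TopologicalSpace (X ⟶ Y)]

/-- Lax functors with continuous structure maps. -/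
structure IsContinuous (F : LaxData.{u} J) : Prop where
  kT2_hom : ∀ X Y : J, KT2.{u} (X ⟶ Y)
  continuous_comp : ∀ {K : Type u} [TopologicalSpace K] [CompactSpace K] [T2Space K] {X Y Z : J}
    {h₁ : K → (X ⟶ Y)} {h₂ : K → (Y ⟶ Z)}, Continuous h₁ → Continuous h₂ →
      Continuous fun k => h₁ k ≫ h₂ k
  isTopological : ∀ X, (F.obj X).IsTopological
  continuous_map : ∀ {K : Type u} [TopologicalSpace K] [CompactSpace K] [T2Space K] {X Y : J}
    {h : K → (X ⟶ Y)} {g : K → Arrow (F.obj X).Ob}, Continuous h → Continuous g →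
      Continuous fun k => (F.map (h k)).mapArrow.obj (g k)
  continuous_mapComp : ∀ {K : Type u} [TopologicalSpace K] [CompactSpace K] [T2Space K] {X Y Z : J}
    {h₁ : K → (X ⟶ Y)} {h₂ : K → (Y ⟶ Z)} {P : K → (F.obj X).Ob}, Continuous h₁ →
      Continuous h₂ → Continuous P → Continuous fun k => Arrow.mk (F.mapComp (h₁ k) (h₂ k) (P k))
  continuous_mapId : ∀ {K : Type u} [TopologicalSpace K] [CompactSpace K] [T2Space K] {X : J}
    {P : K → (F.obj X).Ob}, Continuous P → Continuous fun k => Arrow.mk (F.mapId X (P k))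

variable {F : LaxData.{u} J}

/-- The coordinates of an object of `F̄ X`. -/
def obCode {X : J} (a : F.StreetOb X) : Σ Y : J, (Y ⟶ X) × (F.obj Y).Ob := ⟨a.Y, (a.φ, a.P)⟩

lemma obCode_injective {X : J} : Function.Injective (obCode (F := F) (X := X)) := by
  rintro ⟨Y, φ, P⟩ ⟨Y', φ', P'⟩ h
  cases h
  rfl

variable (hF : F.IsLax)

/-- The coordinates of a morphism of `F̄ X`. -/
def homCode {X : J} (g : Arrow (street hF X).Ob) :
    Σ p : J × J, (p.1 ⟶ X) × (p.2 ⟶ p.1) × (F.obj p.2).Ob × Arrow (F.obj p.1).Ob :=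
  let h : F.StreetHom g.left g.right := g.hom
  ⟨(StreetOb.Y g.left, StreetOb.Y g.right),
    (StreetOb.φ g.left, h.ψ, StreetOb.P g.right, Arrow.mk h.U)⟩

lemma homCode_injective {X : J} : Function.Injective (homCode hF (X := X)) := by
  rintro ⟨⟨Y₁, φ₁, P₁⟩, ⟨Y₁', φ₁', P₁'⟩, ⟨ψ₁, w₁, U₁⟩⟩ ⟨⟨Y₂, φ₂, P₂⟩, ⟨Y₂', φ₂', P₂'⟩, ⟨ψ₂, w₂, U₂⟩⟩ h
  obtain rfl : Y₁ = Y₂ := congrArg (fun c => c.1.1) h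
  obtain rfl : Y₁' = Y₂' := congrArg (fun c => c.1.2) h
  have h' := eq_of_heq (Sigma.ext_iff.1 h).2
  obtain rfl : φ₁ = φ₂ := congrArg (fun c => c.1) h'
  obtain rfl : ψ₁ = ψ₂ := congrArg (fun c => c.2.1) h'
  obtain rfl : P₁' = P₂' := congrArg (fun c => c.2.2.1) h'
  have hU : Arrow.mk U₁ = Arrow.mk U₂ := congrArg (fun c => c.2.2.2) h'
  obtain rfl : P₁ = P₂ := congrArg (fun c : Arrow _ => c.left) hU
  obtain rfl : U₁ = U₂ := SameArrow.eq hU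
  obtain rfl : φ₁' = φ₂' := w₁.symm.trans w₂
  rfl

/-- Composition in coordinates. The two equalities of objects show that `arrowComp` takes no junk
value here, and the free coordinates in the hypotheses fit families over fixed objects of `J`. -/
lemma homCode_comp {X : J} {a b c : (street hF X).Ob} (f : a ⟶ b) (g : b ⟶ c) {Y Y' Y'' : J}
    {φ : Y ⟶ X} {ψ : Y' ⟶ Y} {P' V φ'} {ψ' : Y'' ⟶ Y'} {P'' V'}
    (hf : homCode hF (Arrow.mk f) = ⟨(Y, Y'), (φ, ψ, P', V)⟩)
    (hg : homCode hF (Arrow.mk g) = ⟨(Y', Y''), (φ', ψ', P'', V')⟩) :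
    V.right = ((F.map ψ).mapArrow.obj V').left ∧ V'.right = (F.map ψ').obj P'' ∧
      homCode hF (Arrow.mk (f ≫ g)) = ⟨(Y, Y''), (φ, ψ' ≫ ψ, P'',
        arrowComp V (arrowComp ((F.map ψ).mapArrow.obj V') (Arrow.mk (F.mapComp ψ' ψ P''))))⟩ := by
  obtain ⟨aY, aφ, aP⟩ := a
  obtain ⟨bY, bφ, bP⟩ := b
  obtain ⟨cY, cφ, cP⟩ := c
  obtain ⟨fψ, fw, fU⟩ := f
  obtain ⟨gψ, gw, gU⟩ := g
  cases hf
  cases hg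
  refine ⟨rfl, rfl, ?_⟩
  have : arrowComp (Arrow.mk fU) (arrowComp ((F.map fψ).mapArrow.obj (Arrow.mk gU))
      (Arrow.mk (F.mapComp gψ fψ cP))) =
      Arrow.mk (fU ≫ (F.map fψ).map gU ≫ F.mapComp gψ fψ cP) :=
    (congrArg _ (arrowComp_mk _ _)).trans (arrowComp_mk _ _)
  exact congrArg (fun V => (⟨(aY, cY), (aφ, gψ ≫ fψ, cP, V)⟩ :
    Σ p : J × J, (p.1 ⟶ X) × (p.2 ⟶ p.1) × (F.obj p.2).Ob × Arrow (F.obj p.1).Ob)) this.symm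

lemma homCode_arrowComp {X : J} {g₁ g₂ : Arrow (street hF X).Ob} (h : g₁.right = g₂.left)
    {Y Y' Y'' : J} {φ : Y ⟶ X} {ψ : Y' ⟶ Y} {P' V φ'} {ψ' : Y'' ⟶ Y'} {P'' V'}
    (hf : homCode hF g₁ = ⟨(Y, Y'), (φ, ψ, P', V)⟩)
    (hg : homCode hF g₂ = ⟨(Y', Y''), (φ', ψ', P'', V')⟩) :
    V.right = ((F.map ψ).mapArrow.obj V').left ∧ V'.right = (F.map ψ').obj P'' ∧
      homCode hF (Arrow.mk (g₁.hom ≫ eqToHom h ≫ g₂.hom)) = ⟨(Y, Y''), (φ, ψ' ≫ ψ, P'',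
        arrowComp V (arrowComp ((F.map ψ).mapArrow.obj V') (Arrow.mk (F.mapComp ψ' ψ P''))))⟩ := by
  obtain ⟨a, b, f⟩ := g₁
  obtain ⟨b', c, g⟩ := g₂
  obtain rfl : b = b' := h
  have := homCode_comp hF f g hf hg
  rw [← this.2.2]
  refine ⟨this.1, this.2.1, congrArg (homCode hF) (congrArg Arrow.mk ?_)⟩
  exact congrArg (f ≫ ·) (Category.id_comp g)

variable {K : Type u} [TopologicalSpace K] [CompactSpace K] [T2Space K] {X : J}

lemma continuous_streetOb {a : K → F.StreetOb X} :
    Continuous a ↔ Continuous fun k => obCode (a k) :=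
  (@continuous_to_compactlyGenerated _ (induced obCode inferInstance) K _ _ _ a).trans
    continuous_induced_rng

lemma continuous_streetHom {g : K → Arrow (street hF X).Ob} :
    Continuous g ↔ Continuous fun k => homCode hF (g k) :=
  (@continuous_to_compactlyGenerated _ (induced (homCode hF) inferInstance) K _ _ _ g).trans
    continuous_induced_rng

/-- Continuity can be tested on families of objects over a constant object of `J`. -/
lemma continuous_of_streetOb {Z : Type*} [TopologicalSpace Z] {f : K → Z} {a : K → F.StreetOb X}
    (ha : Continuous a)
    (h : ∀ (L : Type u) [TopologicalSpace L] [CompactSpace L] [T2Space L] (r : L → K) (Y : J)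
      (φ : L → (Y ⟶ X)) (P : L → (F.obj Y).Ob), Continuous r → Continuous φ → Continuous P →
        (∀ l, a (r l) = ⟨Y, φ l, P l⟩) → Continuous fun l => f (r l)) : Continuous f := by
  have hc := continuous_streetOb.1 ha
  have ho : ∀ Y, IsOpen {k | (a k).Y = Y} := fun Y => (isClopen_sigma_fst hc Y).2
  refine continuous_of_fibres (fun k => (a k).Y) ho fun Y => ?_
  have := compactSpace_fibre ho Y
  obtain ⟨r, hr, he⟩ := exists_sigma_lift (hc.comp continuous_subtype_val) Y
    fun k : {k // (a k).Y = Y} => k.2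
  exact h _ Subtype.val Y (fun l => (r l).1) (fun l => (r l).2) continuous_subtype_val hr.fst hr.snd
    fun l => obCode_injective (he l)

/-- Continuity can be tested on families of morphisms over constant objects of `J`. -/
lemma continuous_of_streetHom {Z : Type*} [TopologicalSpace Z] {f : K → Z}
    {g : K → Arrow (street hF X).Ob} (hg : Continuous g)
    (h : ∀ (L : Type u) [TopologicalSpace L] [CompactSpace L] [T2Space L] (r : L → K) (Y Y' : J)
      (φ : L → (Y ⟶ X)) (ψ : L → (Y' ⟶ Y)) (P : L → (F.obj Y').Ob) (V : L → Arrow (F.obj Y).Ob),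
        Continuous r → Continuous φ → Continuous ψ → Continuous P → Continuous V →
        (∀ l, homCode hF (g (r l)) = ⟨(Y, Y'), (φ l, ψ l, P l, V l)⟩) →
          Continuous fun l => f (r l)) : Continuous f := by
  have hc := (continuous_streetHom hF).1 hg
  have ho : ∀ p, IsOpen {k | (homCode hF (g k)).1 = p} := fun Y => (isClopen_sigma_fst hc Y).2
  refine continuous_of_fibres (fun k => (homCode hF (g k)).1) ho fun p => ?_
  have := compactSpace_fibre ho p
  obtain ⟨r, hr, he⟩ := exists_sigma_lift (hc.comp continuous_subtype_val) p
    fun k : {k // (homCode hF (g k)).1 = p} => k.2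
  exact h _ Subtype.val p.1 p.2 (fun l => (r l).1) (fun l => (r l).2.1) (fun l => (r l).2.2.1)
    (fun l => (r l).2.2.2) continuous_subtype_val hr.fst hr.snd.fst hr.snd.snd.fst hr.snd.snd.snd he

lemma continuous_sigma_mk {I : Type*} {Z : I → Type*} [∀ i, TopologicalSpace (Z i)] {L : Type*}
    [TopologicalSpace L] (i : I) {z : L → Z i} (hz : Continuous z) :
    Continuous fun l => (⟨i, z l⟩ : Σ i, Z i) :=
  continuous_sigmaMk.comp hz

/-- Every morphism is determined by its coordinates. -/
lemma source_target_of_homCode {g : Arrow (street hF X).Ob} {Y Y' : J}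
    {φ : Y ⟶ X} {ψ : Y' ⟶ Y} {P' V} (hg : homCode hF g = ⟨(Y, Y'), (φ, ψ, P', V)⟩) :
    g.left = (⟨Y, φ, V.left⟩ : F.StreetOb X) ∧ g.right = (⟨Y', ψ ≫ φ, P'⟩ : F.StreetOb X) ∧
      V.right = (F.map ψ).obj P' := by
  obtain ⟨⟨aY, aφ, aP⟩, ⟨bY, bφ, bP⟩, ⟨fψ, fw, fU⟩⟩ := g
  cases hg
  exact ⟨rfl, congrArg (fun φ => (⟨bY, φ, bP⟩ : F.StreetOb X)) fw.symm, rfl⟩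

lemma compactlyGeneratedSpace_street_mor (X : J) :
    CompactlyGeneratedSpace (Arrow (street hF X).Ob) :=
  @compactlyGeneratedSpace_compactlyGenerated _ (induced (homCode hF) inferInstance)

lemma compactlyGeneratedSpace_street_ob (X : J) : CompactlyGeneratedSpace (street hF X).Ob :=
  @compactlyGeneratedSpace_compactlyGenerated _ (induced obCode inferInstance)

/-- Objects and morphisms inject into disjoint unions of products of spaces with closed coincidence
sets, which gives separation. In these coordinates the structure maps are built from composition in
`J`, the functors `F h` and the constraints of `F`. -/
lemma isTopological_street (hc : F.IsContinuous) (X : J) : (street hF X).IsTopological where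
  cgwh_ob := @CGWHSpace.of_compactlyGenerated _ (induced obCode inferInstance) <|
    @kT2_of_injective _ _ (induced obCode inferInstance) _ (kT2_sigma fun Y =>
      kT2_prod (hc.kT2_hom Y X) (hc.isTopological Y).cgwh_ob.kT2) _ continuous_induced_dom
        obCode_injective
  cgwh_mor := @CGWHSpace.of_compactlyGenerated _ (induced (homCode hF) inferInstance) <|
    @kT2_of_injective _ _ (induced (homCode hF) inferInstance) _ (kT2_sigma fun p =>
      kT2_prod (hc.kT2_hom p.1 X) (kT2_prod (hc.kT2_hom p.2 p.1)
        (kT2_prod (hc.isTopological p.2).cgwh_ob.kT2 (hc.isTopological p.1).cgwh_mor.kT2))) _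
          continuous_induced_dom (homCode_injective hF)
  continuous_source := by
    have := compactlyGeneratedSpace_street_mor hF X
    refine continuous_of_test fun K _ _ _ g hg => continuous_of_streetHom hF hg ?_
    intro L _ _ _ r Y Y' φ ψ P V _ hφ hψ hP hV he
    simp only [fun l => (source_target_of_homCode hF (he l)).1]
    exact continuous_streetOb.2 (continuous_sigma_mk Y
      (hφ.prodMk ((hc.isTopological Y).continuous_source.comp hV)))
  continuous_target := by
    have := compactlyGeneratedSpace_street_mor hF X
    refine continuous_of_test fun K _ _ _ g hg => continuous_of_streetHom hF hg ?_
    intro L _ _ _ r Y Y' φ ψ P V _ hφ hψ hP hV he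
    simp only [fun l => (source_target_of_homCode hF (he l)).2.1]
    exact continuous_streetOb.2 (continuous_sigma_mk Y' ((hc.continuous_comp hψ hφ).prodMk hP))
  continuous_id := by
    have := compactlyGeneratedSpace_street_ob hF X
    refine continuous_of_test fun K _ _ _ a ha => continuous_of_streetOb ha ?_
    intro L _ _ _ r Y φ P _ hφ hP he
    refine (continuous_streetHom hF).2 (Continuous.congr (continuous_sigma_mk (Y, Y)
      (hφ.prodMk ((continuous_const (y := 𝟙 Y)).prodMk (hP.prodMk (hc.continuous_mapId hP))))) fun l => ?_)
    rw [he l]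
    rfl
  continuous_comp := by
    refine kContinuous_iff.2 fun K _ _ _ p hp => ?_
    have hp' := continuous_subtype_val.comp hp
    refine continuous_of_streetHom hF hp'.fst ?_
    intro L _ _ _ r Y₁ Y₂ φ ψ P V hr hφ hψ hP hV he
    refine continuous_of_streetHom hF (hp'.snd.comp hr) ?_
    intro M _ _ _ t Y₂' Y₃ φ' ψ' P' V' ht hφ' hψ' hP' hV' he'
    -- The middle objects of the two morphisms agree by composability at some point of `M`; without
    -- a point they need not agree, but then there is nothing to prove.
    by_cases hM : Nonempty M
    swap
    · have : IsEmpty M := not_nonempty_iff.1 hM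
      exact continuous_of_const fun m => isEmptyElim m
    obtain rfl : Y₂ = Y₂' := by
      obtain ⟨m⟩ := hM
      have := (p (r (t m))).2
      have h₁ := (source_target_of_homCode hF (he (t m))).2.1
      have h₂ := (source_target_of_homCode hF (he' m)).1
      exact congrArg StreetOb.Y (h₁.symm.trans (this.trans h₂))
    have key := fun m => homCode_arrowComp hF (p (r (t m))).2 (he (t m)) (he' m)
    refine (continuous_streetHom hF).2 ?_
    refine Continuous.congr ?_ fun m => (key m).2.2.symm
    refine continuous_sigma_mk (Y₁, Y₃) ((hφ.comp ht).prodMk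
      ((hc.continuous_comp hψ' (hψ.comp ht)).prodMk (hP'.prodMk ((hc.isTopological Y₁).continuous_arrowComp
        (hV.comp ht) ((hc.isTopological Y₁).continuous_arrowComp (hc.continuous_map (hψ.comp ht) hV')
          (hc.continuous_mapComp hψ' (hψ.comp ht) hP') fun m => ?_) fun m => ?_))))
    · exact congrArg ((F.map (ψ (t m))).obj) (key m).2.1
    · exact (key m).1.trans (arrowComp_left _ _).symm

end LaxData

end

/-! ### Functoriality of the rectification and its comparison with the lax functor -/

noncomputable section

namespace LaxData

open TopCategory

variable {J : Type} [SmallCategory J] [∀ X Y : J, TopologicalSpace (X ⟶ Y)]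
  {F : LaxData.{u} J} (hF : F.IsLax)

section Street

variable {K : Type u} [TopologicalSpace K] [CompactSpace K] [T2Space K]

lemma homCode_streetMap {X X' : J} (χ : X ⟶ X') {g : Arrow (street hF X).Ob} {Y Y' : J}
    {φ : Y ⟶ X} {ψ : Y' ⟶ Y} {P V} (hg : homCode hF g = ⟨(Y, Y'), (φ, ψ, P, V)⟩) :
    homCode hF ((streetMap hF χ).mapArrow.obj g) = ⟨(Y, Y'), (φ ≫ χ, ψ, P, V)⟩ := by
  cases hg
  rfl

lemma continuous_streetMap (hc : F.IsContinuous) {X X' : J} {χ : K → (X ⟶ X')}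
    {g : K → Arrow (street hF X).Ob} (hχ : Continuous χ) (hg : Continuous g) :
    Continuous fun k => (streetMap hF (χ k)).mapArrow.obj (g k) := by
  refine continuous_of_streetHom hF hg ?_
  intro L _ _ _ r Y Y' φ ψ P V hr hφ hψ hP hV he
  exact (continuous_streetHom hF).2 (Continuous.congr (continuous_sigma_mk (Y, Y')
    ((hc.continuous_comp hφ (hχ.comp hr)).prodMk (hψ.prodMk (hP.prodMk hV))))
    fun l => (homCode_streetMap hF _ (he l)).symm)

/-- The functor laws hold strictly because a morphism of the index category changes only the
coordinate `φ`. For joint continuity the acting morphism is carried as the parameter `w` of a family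
of simplices. -/
lemma isContinuousFunctor_classifyingDiagram (hc : F.IsContinuous) :
    (classifyingDiagram hF).IsContinuousFunctor where
  cgwh X := Realization.cgwh (isTopological_street hF hc X).cgwh_mor.kT2
  map_id X z := (Realization.realizationMap_congr (G' := 𝟭 _) (fun g => homCode_injective hF <|
    (homCode_streetMap hF (𝟙 X) rfl).trans (by rw [Category.comp_id]; rfl)) z).trans
      (Realization.realizationMap_id z)
  map_comp {X Y W} h₁ h₂ z := (Realization.realizationMap_congr
    (G' := streetMap hF h₁ ⋙ streetMap hF h₂) (fun g => homCode_injective hF <|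
      (homCode_streetMap hF (h₁ ≫ h₂) rfl).trans (by rw [← Category.assoc]; rfl)) z).trans
      (Realization.realizationMap_comp _ _ z)
  continuous_map X Y := by
    refine kContinuous_iff.2 fun K _ _ _ p hp => ?_
    refine Realization.continuous_of_simplices (I := PUnit.{1}) (A := fun _ => street hF X)
      (W := X ⟶ Y) (fun w z => (realizationMap (streetMap hF w) (z PUnit.unit) :
        (street hF Y).Realization)) ?_ (w := fun k => (p k).1) hp.fst
      (z := fun _ k => (p k).2) fun _ => hp.snd
    intro K _ _ _ w p x τ hw hx hτ
    exact Realization.continuous_mk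
      (x := fun k => (x PUnit.unit k ⋙ streetMap hF (w k) : ComposableArrows (street hF Y).Ob p))
      (fun i j h => continuous_streetMap hF hc hw (hx PUnit.unit i j h)) hτ

end Street

/-- The functor `F̄ X ⥤ F X`, `(φ, P) ↦ F φ P`. -/
def evaluation (X : J) : (street hF X).Ob ⥤ (F.obj X).Ob where
  obj a := (F.map (StreetOb.φ a)).obj (StreetOb.P a)
  map {a b} g :=
    let h : F.StreetHom a b := g
    (F.map (StreetOb.φ a)).map h.U ≫ F.mapComp h.ψ (StreetOb.φ a) (StreetOb.P b) ≫
      eqToHom (eqToHom_map_obj h.w _)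
  map_id a := by
    have h := hF.id_right (StreetOb.φ a) (StreetOb.P a)
    refine (Category.assoc _ _ _).symm.trans ((congrArg (· ≫ _) h).trans ?_)
    exact (eqToHom_trans _ _).trans (eqToHom_refl _ _)
  map_comp {a b c} f g := by
    obtain ⟨aY, aφ, aP⟩ := a
    obtain ⟨bY, bφ, bP⟩ := b
    obtain ⟨cY, cφ, cP⟩ := c
    obtain ⟨fψ, fw, fU⟩ := f
    obtain ⟨gψ, gw, gU⟩ := g
    change bY ⟶ aY at fψ
    change cY ⟶ bY at gψ
    change aP ⟶ (F.map fψ).obj bP at fU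
    change bP ⟶ (F.map gψ).obj cP at gU
    change fψ ≫ aφ = bφ at fw
    subst fw
    change gψ ≫ fψ ≫ aφ = cφ at gw
    subst gw
    have h₁ := hF.assoc gψ fψ aφ cP
    have h₂ := hF.mapComp_naturality fψ aφ gU
    refine Eq.trans (b := (F.map aφ).map (fU ≫ (F.map fψ).map gU ≫ F.mapComp gψ fψ cP) ≫
      F.mapComp (gψ ≫ fψ) aφ cP ≫ eqToHom (eqToHom_map_obj (Category.assoc _ _ _) _)) rfl ?_
    refine Eq.trans ?_ (b := ((F.map aφ).map fU ≫ F.mapComp fψ aφ bP ≫ 𝟙 _) ≫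
      (F.map (fψ ≫ aφ)).map gU ≫ F.mapComp gψ (fψ ≫ aφ) cP ≫ 𝟙 _) rfl
    simp only [Functor.map_comp, Category.assoc, Category.comp_id]
    rw [reassoc_of% h₁, ← reassoc_of% h₂]
    simp

/-- The functor `F X ⥤ F̄ X`, `P ↦ (id, P)`. -/
def coevaluation (X : J) : (F.obj X).Ob ⥤ (street hF X).Ob where
  obj P := (⟨X, 𝟙 X, P⟩ : F.StreetOb X)
  map {P Q} U := (⟨𝟙 X, Category.id_comp _, U ≫ F.mapId X Q⟩ :
    F.StreetHom ⟨X, 𝟙 X, P⟩ ⟨X, 𝟙 X, Q⟩)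
  map_id P := StreetHom.ext (a := (⟨X, 𝟙 X, P⟩ : F.StreetOb X)) rfl
    (heq_of_eq (Category.id_comp (F.mapId X P)))
  map_comp {P Q R} U V := by
    refine StreetHom.ext' (a := (⟨X, 𝟙 X, P⟩ : F.StreetOb X)) (b := (⟨X, 𝟙 X, R⟩ : F.StreetOb X))
      (Category.comp_id (𝟙 X)).symm ?_
    refine Eq.trans ?_ (b := (U ≫ F.mapId X Q) ≫ (F.map (𝟙 X)).map (V ≫ F.mapId X R) ≫
      F.mapComp (𝟙 X) (𝟙 X) R) rfl
    refine Eq.trans (b := ((U ≫ V) ≫ F.mapId X R) ≫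
      eqToHom (eqToHom_map_obj (Category.comp_id (𝟙 X)).symm R)) rfl ?_
    simp only [Functor.map_comp, Category.assoc]
    rw [hF.id_right, ← reassoc_of% hF.mapId_naturality X V]

/-- The unit `id ⟶ F id` as a natural transformation. -/
def evaluationUnit (X : J) : 𝟭 (F.obj X).Ob ⟶ coevaluation hF X ⋙ evaluation hF X where
  app P := F.mapId X P
  naturality P Q U := by
    refine (hF.mapId_naturality X U).trans (congrArg (F.mapId X P ≫ ·) ?_)
    refine Eq.trans ?_ (b := (F.map (𝟙 X)).map (U ≫ F.mapId X Q) ≫ F.mapComp (𝟙 X) (𝟙 X) Q ≫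
      eqToHom (eqToHom_map_obj (Category.comp_id (𝟙 X)) _)) rfl
    rw [Functor.map_comp, Category.assoc, reassoc_of% hF.id_right (𝟙 X) Q]
    simp

/-- The morphisms `(φ, id) : (id, F φ P) ⟶ (φ, P)`. -/
def evaluationCounit (X : J) : evaluation hF X ⋙ coevaluation hF X ⟶ 𝟭 (street hF X).Ob where
  app a := (⟨StreetOb.φ a, Category.comp_id _, 𝟙 _⟩ :
    F.StreetHom ⟨X, 𝟙 X, (F.map (StreetOb.φ a)).obj (StreetOb.P a)⟩ a)
  naturality a b g := by
    obtain ⟨aY, aφ, aP⟩ := a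
    obtain ⟨bY, bφ, bP⟩ := b
    obtain ⟨ψ, w, U⟩ := g
    change bY ⟶ aY at ψ
    change aP ⟶ (F.map ψ).obj bP at U
    change ψ ≫ aφ = bφ at w
    subst w
    refine StreetHom.ext' (a := (⟨X, 𝟙 X, (F.map aφ).obj aP⟩ : F.StreetOb X))
      (b := (⟨bY, ψ ≫ aφ, bP⟩ : F.StreetOb X)) (Category.comp_id (ψ ≫ aφ)) ?_
    refine Eq.trans (b := (((F.map aφ).map U ≫ F.mapComp ψ aφ bP ≫ 𝟙 _) ≫ F.mapId X _) ≫
      ((F.map (𝟙 X)).map (𝟙 ((F.map (ψ ≫ aφ)).obj bP)) ≫ F.mapComp (ψ ≫ aφ) (𝟙 X) bP) ≫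
        eqToHom (eqToHom_map_obj (Category.comp_id (ψ ≫ aφ)) _)) (Category.assoc _ _ _) ?_
    refine Eq.trans ?_ (b := 𝟙 _ ≫ (F.map aφ).map U ≫ F.mapComp ψ aφ bP) rfl
    simp only [CategoryTheory.Functor.map_id, Category.assoc, Category.id_comp]
    rw [reassoc_of% hF.id_left (ψ ≫ aφ) bP]
    simp

variable {K : Type u} [TopologicalSpace K] [CompactSpace K] [T2Space K]

lemma IsContinuous.continuous_map_obj (hc : F.IsContinuous) {X Y : J} {h : K → (X ⟶ Y)}
    {P : K → (F.obj X).Ob} (hh : Continuous h) (hP : Continuous P) :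
    Continuous fun k => (F.map (h k)).obj (P k) :=
  (hc.isTopological Y).continuous_source.comp
    (hc.continuous_map hh ((hc.isTopological X).continuous_id.comp hP))

lemma kContinuous_evaluation (hc : F.IsContinuous) (X : J) :
    KContinuous fun g : Arrow (street hF X).Ob => (evaluation hF X).mapArrow.obj g := by
  refine kContinuous_iff.2 fun K _ _ _ g hg => continuous_of_streetHom hF hg ?_
  intro L _ _ _ r Y Y' φ ψ P V hr hφ hψ hP hV he
  have key : ∀ (g : Arrow (street hF X).Ob) (φ : Y ⟶ X) (ψ : Y' ⟶ Y) (P V),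
      homCode hF g = ⟨(Y, Y'), (φ, ψ, P, V)⟩ → V.right = (F.map ψ).obj P ∧
        (evaluation hF X).mapArrow.obj g = arrowComp ((F.map φ).mapArrow.obj V)
          (Arrow.mk (F.mapComp ψ φ P)) := by
    rintro ⟨⟨aY, aφ, aP⟩, ⟨bY, bφ, bP⟩, ⟨ψ, w, U⟩⟩ φ ψ' P V h
    cases h
    refine ⟨rfl, Eq.trans ?_ (arrowComp_mk _ _).symm⟩
    exact SameArrow.comp_right _ (SameArrow.comp_eqToHom _ _)
  refine Continuous.congr ?_ fun l => (key _ _ _ _ _ (he l)).2.symm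
  exact (hc.isTopological X).continuous_arrowComp (hc.continuous_map hφ hV)
    (hc.continuous_mapComp hψ hφ hP) fun l =>
      congrArg (F.map (φ l)).obj (key _ _ _ _ _ (he l)).1

lemma kContinuous_coevaluation (hc : F.IsContinuous) (X : J) :
    KContinuous fun g : Arrow (F.obj X).Ob => (coevaluation hF X).mapArrow.obj g := by
  refine kContinuous_iff.2 fun K _ _ _ g hg => (continuous_streetHom hF).2 ?_
  exact continuous_sigma_mk (X, X) ((continuous_const (y := 𝟙 X)).prodMk
    ((continuous_const (y := 𝟙 X)).prodMk
      (((hc.isTopological X).continuous_target.comp hg).prodMk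
        ((hc.isTopological X).continuous_comp_mk hg
          (hc.continuous_mapId ((hc.isTopological X).continuous_target.comp hg))))))

/-- `F̄ X` and `F X` have homotopy equivalent realizations. -/
lemma isHomotopyEquivalence_evaluation (hc : F.IsContinuous) (X : J) :
    IsHomotopyEquivalence (realizationMap (evaluation hF X) :
      (street hF X).Realization → (F.obj X).Realization) := by
  have h₁ := kContinuous_evaluation hF hc X
  have h₂ := kContinuous_coevaluation hF hc X
  have h₁₂ : KContinuous fun g : Arrow (street hF X).Ob =>
      (evaluation hF X ⋙ coevaluation hF X).mapArrow.obj g :=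
    kContinuous_iff.2 fun K _ _ _ g hg => h₂.comp_test (h₁.comp_test hg)
  have h₂₁ : KContinuous fun g : Arrow (F.obj X).Ob =>
      (coevaluation hF X ⋙ evaluation hF X).mapArrow.obj g :=
    kContinuous_iff.2 fun K _ _ _ g hg => h₁.comp_test (h₂.comp_test hg)
  have hid : ∀ A : TopCategory.{u}, KContinuous fun g : Arrow A.Ob => (𝟭 A.Ob).mapArrow.obj g :=
    fun A => kContinuous_iff.2 fun _ _ _ _ _ hg => hg
  -- One continuous natural transformation on each side is enough for a homotopy equivalence; the
  -- triangle identities play no role.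
  have e₁ := homotopic_of_continuous_app (isTopological_street hF hc X)
    (isTopological_street hF hc X) (evaluationCounit hF X) h₁₂ (hid _) fun K _ _ _ a ha => by
      refine continuous_of_streetOb ha ?_
      intro L _ _ _ r Y φ P _ hφ hP he
      refine (continuous_streetHom hF).2 (Continuous.congr (continuous_sigma_mk (X, Y)
        ((continuous_const (y := 𝟙 X)).prodMk (hφ.prodMk (hP.prodMk
          ((hc.isTopological X).continuous_id.comp (hc.continuous_map_obj hφ hP)))))) fun l => ?_)
      rw [he l]
      rfl
  have e₂ := homotopic_of_continuous_app (hc.isTopological X) (hc.isTopological X)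
    (evaluationUnit hF X) (hid _) h₂₁ fun K _ _ _ a ha => hc.continuous_mapId ha
  refine isHomotopyEquivalence_of_homotopic
    (f := ⟨realizationMap (evaluation hF X), Realization.continuous_realizationMap h₁⟩)
    (g := ⟨realizationMap (coevaluation hF X), Realization.continuous_realizationMap h₂⟩) ?_ ?_
  · convert e₁ using 1
    · exact ContinuousMap.ext fun z => (Realization.realizationMap_comp _ _ z).symm
    · exact ContinuousMap.ext fun z => (Realization.realizationMap_id z).symm
  · convert e₂.symm using 1
    · exact ContinuousMap.ext fun z => (Realization.realizationMap_comp _ _ z).symm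
    · exact ContinuousMap.ext fun z => (Realization.realizationMap_id z).symm

end LaxData

end

/-! ### Powers of topological categories and continuity of `ℱC` -/

noncomputable section

namespace TopCategory

variable {A : TopCategory.{u}} {I : Type} {K : Type u} [TopologicalSpace K] [CompactSpace K]
  [T2Space K]

/-- The components of a morphism of a power. -/
def powArrow (g : Arrow (A.pow I).Ob) (i : I) : Arrow A.Ob :=
  Arrow.mk ((show ∀ i, (show I → A.Ob from g.left) i ⟶ (show I → A.Ob from g.right) i from g.hom) i)

lemma powArrow_injective : Function.Injective (powArrow (A := A) (I := I)) := by
  rintro ⟨P, Q, U⟩ ⟨P', Q', U'⟩ h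
  have h' : ∀ i, powArrow (Arrow.mk U) i = powArrow (Arrow.mk U') i := congrFun h
  obtain rfl : P = P' := funext fun i => congrArg (fun a : Arrow A.Ob => a.left) (h' i)
  obtain rfl : Q = Q' := funext fun i => congrArg (fun a : Arrow A.Ob => a.right) (h' i)
  obtain rfl : U = U' := funext fun i => SameArrow.eq (h' i)
  rfl

lemma continuous_pow_ob {a : K → (A.pow I).Ob} :
    Continuous a ↔ ∀ i : I, Continuous fun k => (a k : I → A.Ob) i :=
  (@continuous_to_compactlyGenerated (I → A.Ob) _ K _ _ _ a).trans continuous_pi_iff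

lemma continuous_pow_mor {g : K → Arrow (A.pow I).Ob} :
    Continuous g ↔ ∀ i : I, Continuous fun k => powArrow (g k) i :=
  (@continuous_to_compactlyGenerated _ (induced powArrow inferInstance) K _ _ _ g).trans
    (continuous_induced_rng.trans continuous_pi_iff)

lemma powArrow_arrowComp {g₁ g₂ : Arrow (A.pow I).Ob} (h : g₁.right = g₂.left) (i : I) :
    (powArrow g₁ i).right = (powArrow g₂ i).left ∧
      powArrow (Arrow.mk (g₁.hom ≫ eqToHom h ≫ g₂.hom)) i =
        arrowComp (powArrow g₁ i) (powArrow g₂ i) := by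
  obtain ⟨a, b, f⟩ := g₁
  obtain ⟨b', c, g⟩ := g₂
  obtain rfl : b = b' := h
  refine ⟨rfl, Eq.trans ?_ (arrowComp_mk _ _).symm⟩
  exact congrArg (fun g : b ⟶ c => powArrow (Arrow.mk (f ≫ g)) i) (Category.id_comp g)

lemma IsTopological.pow (hA : A.IsTopological) (I : Type) : (A.pow I).IsTopological where
  cgwh_ob := @CGWHSpace.of_compactlyGenerated (I → A.Ob) Pi.topologicalSpace (kT2_pi fun _ : I => hA.cgwh_ob.kT2)
  cgwh_mor := @CGWHSpace.of_compactlyGenerated _ (induced powArrow inferInstance) <|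
    @kT2_of_injective _ _ (induced powArrow inferInstance) _
      (kT2_pi fun _ : I => hA.cgwh_mor.kT2) _ continuous_induced_dom powArrow_injective
  continuous_source := by
    have : CompactlyGeneratedSpace (Arrow (A.pow I).Ob) :=
      @compactlyGeneratedSpace_compactlyGenerated _ (induced powArrow inferInstance)
    exact continuous_of_test fun K _ _ _ g hg => continuous_pow_ob.2 fun i =>
      hA.continuous_source.comp (continuous_pow_mor.1 hg i)
  continuous_target := by
    have : CompactlyGeneratedSpace (Arrow (A.pow I).Ob) :=
      @compactlyGeneratedSpace_compactlyGenerated _ (induced powArrow inferInstance)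
    exact continuous_of_test fun K _ _ _ g hg => continuous_pow_ob.2 fun i =>
      hA.continuous_target.comp (continuous_pow_mor.1 hg i)
  continuous_id := by
    have : CompactlyGeneratedSpace (A.pow I).Ob :=
      compactlyGeneratedSpace_compactlyGenerated (I → A.Ob)
    exact continuous_of_test fun K _ _ _ a ha => continuous_pow_mor.2 fun i =>
      hA.continuous_id.comp (continuous_pow_ob.1 ha i)
  continuous_comp := by
    refine kContinuous_iff.2 fun K _ _ _ p hp => continuous_pow_mor.2 fun i => ?_
    have hp' := continuous_subtype_val.comp hp
    exact (hA.continuous_arrowComp (continuous_pow_mor.1 hp'.fst i)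
      (continuous_pow_mor.1 hp'.snd i) fun k => (powArrow_arrowComp (p k).2 i).1).congr
        fun k => (powArrow_arrowComp (p k).2 i).2.symm

end TopCategory

open TopCategory

lemma SameArrow.inv_of_comp_id {D : Type*} [Category* D] {a b c d : D} {f : a ⟶ b} {e : b ≅ c}
    (h : f ≫ e.hom ∼ₐ 𝟙 d) : f ∼ₐ e.inv := by
  obtain rfl := h.left
  obtain rfl := h.right
  exact SameArrow.of_eq ((Iso.comp_hom_eq_id e).1 h.eq)

namespace OperadCategory

variable {G : OperadData} {A : TopCategory.{u}} (M : OperadCategory G A) {S T : Type}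
  [LinearOrder S] [Finite S] [LinearOrder T] [Finite T] {K : Type u} [TopologicalSpace K]
  [CompactSpace K] [T2Space K]

lemma continuous_op_obj {f : K → G.Op S} {P : K → S → A.Ob} (hf : Continuous f)
    (hP : ∀ s, Continuous fun k => P k s) : Continuous fun k => (M.op (f k)).obj (P k) :=
  (M.continuous_obj S).comp_test (hf.prodMk (continuous_pi hP))

lemma continuous_op_map {f : K → G.Op S} {P Q : K → S → A.Ob} {U : ∀ k s, P k s ⟶ Q k s}
    (hf : Continuous f) (hU : ∀ s, Continuous fun k => Arrow.mk (U k s)) :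
    Continuous fun k => Arrow.mk ((M.op (f k)).map (X := P k) (Y := Q k) (U k)) :=
  (M.continuous_map S).comp_test (p := fun k => (f k, fun s => Arrow.mk (U k s)))
    (hf.prodMk (continuous_pi hU))

/-- By `τ_trans` the symmetries for `σ` and for its inverse compose to the symmetry of an identity.
So continuity of the inverse of `τ` follows from that of `τ`. -/
lemma τ_inv_same (σ : S ≃ T) (f : G.Op T) (P : T → A.Ob) :
    (M.τ σ f P).inv ∼ₐ (M.τ σ.symm (G.act σ f) fun s => P (σ s)).hom := by
  have h := M.τ_trans σ.symm σ f P
  have h' := M.τ_orderIso (OrderIso.refl T) f P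
  rw [show σ.symm.trans σ = (OrderIso.refl T).toEquiv from σ.symm_trans_self, h'] at h
  exact (SameArrow.inv_of_comp_id (SameArrow.symm h)).symm

lemma continuous_τ_hom (σ : S ≃ T) {f : K → G.Op T} {P : K → T → A.Ob} (hf : Continuous f)
    (hP : ∀ t, Continuous fun k => P k t) : Continuous fun k => Arrow.mk (M.τ σ (f k) (P k)).hom :=
  (M.continuous_τ σ).comp_test (hf.prodMk (continuous_pi hP))

lemma continuous_τ_inv (σ : S ≃ T) {f : K → G.Op T} {P : K → T → A.Ob}
    (hf : Continuous fun k => G.act σ (f k)) (hP : ∀ t, Continuous fun k => P k t) :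
    Continuous fun k => Arrow.mk (M.τ σ (f k) (P k)).inv :=
  (M.continuous_τ_hom σ.symm hf fun s => hP (σ s)).congr fun _ => (M.τ_inv_same σ _ _).symm

end OperadCategory

namespace LPermutativeCategory

open RingIndex

variable {C : LPermutativeCategory.{u}} {K : Type u} [TopologicalSpace K] [CompactSpace K]
  [T2Space K]

lemma continuous_δ_mk {S : Type} {T : S → Type} [LinearOrder S] [Finite S]
    [∀ s, LinearOrder (T s)] [∀ s, Finite (T s)] {f : K → isometriesOperad.Op S}
    {P : K → ∀ s, T s → C.A.Ob} (hf : Continuous f) (hP : ∀ s t, Continuous fun k => P k s t) :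
    Continuous fun k => Arrow.mk (C.δ (f k) (P k)) :=
  C.continuous_δ.comp_test (hf.prodMk (continuous_pi fun s => continuous_pi (hP s)))

lemma continuous_expand {X S : Type} [LinearOrder X] [Finite X] [LinearOrder S] [Finite S]
    {Y : X → S → Type} [∀ x s, LinearOrder (Y x s)] [∀ x s, Finite (Y x s)]
    {T : S → Type} [∀ s, LinearOrder (T s)] [∀ s, Finite (T s)] {f : K → isometriesOperad.Op S}
    {g : K → ∀ s, isometriesOperad.Op (T s)} {P : K → ∀ x s, Y x s → T s → C.A.Ob}
    (hf : Continuous f) (hg : ∀ s, Continuous fun k => g k s)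
    (hP : ∀ x s y t, Continuous fun k => P k x s y t) :
    Continuous fun k => Arrow.mk (expand (f k) (g k) (P k)) :=
  (C.add.continuous_op_map continuous_const fun x => continuous_δ_mk hf fun s y =>
    C.mul.continuous_op_obj (hg s) (hP x s y)).congr fun _ => (expand_same _ _ _).symm

lemma continuous_relabel {X X' S S' : Type} [LinearOrder X] [Finite X] [LinearOrder X'] [Finite X']
    [LinearOrder S] [Finite S] [LinearOrder S'] [Finite S'] (e : X ≃ X') (σ : S' ≃ S)
    {f : K → isometriesOperad.Op S} {f' : K → isometriesOperad.Op S'}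
    (hf : ∀ k, f' k = isometriesOperad.act σ (f k)) {P : K → X → S → C.A.Ob}
    {P' : K → X' → S' → C.A.Ob} (hP : ∀ k x s, P' k (e x) s = P k x (σ s)) (hfc : Continuous f)
    (hPc : ∀ x s, Continuous fun k => P k x s) :
    Continuous fun k => Arrow.mk (relabel e σ (hf k) (hP k)) := by
  have hf' : Continuous f' := by
    simp only [funext hf]
    exact isometriesOperad.continuous_act σ hfc
  have hPc' : ∀ x s, Continuous fun k => P' k x s := by
    intro x s
    obtain ⟨x, rfl⟩ := e.surjective x
    simp only [hP]
    exact hPc _ _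
  refine C.isTopological.continuous_comp_mk (C.add.continuous_op_map continuous_const fun x => ?_)
    (C.add.continuous_τ_hom e continuous_const fun x => C.mul.continuous_op_obj hf' (hPc' x))
  exact (C.mul.continuous_τ_inv σ (isometriesOperad.continuous_act σ hfc) (hPc x)).congr
    fun k => (prodIso_same _ _ _ _ _ _ _).symm

/-- On the open pieces where `(ψ, κ)` is constant the index sets of sums and products are fixed, and
continuity is that of the operations. -/
lemma continuous_laxMap {X Y : RingIndex} {h : K → (X ⟶ Y)}
    {g : K → Arrow (C.laxData.obj X).Ob} (hh : Continuous h) (hg : Continuous g) :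
    Continuous fun k => (C.laxData.map (h k)).mapArrow.obj (g k) := by
  refine continuous_of_fibres (fun k => Hom.shape (h k)) (isOpen_shape hh) fun d => ?_
  have := compactSpace_fibre (isOpen_shape hh) d
  obtain ⟨f, hf, he⟩ := exists_hom_lift (hh.comp continuous_subtype_val) d
    fun k : {k // Hom.shape (h k) = d} => k.2
  have hg' := hg.comp (continuous_subtype_val (p := fun k => Hom.shape (h k) = d))
  refine Continuous.congr (f := fun k => (C.laxData.map
    (⟨d.1, fun j => f j k, d.2⟩ : Hom X Y)).mapArrow.obj (g k.1)) ?_ fun k =>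
      congrArg (fun h : X ⟶ Y => (C.laxData.map h).mapArrow.obj (g k.1)) (he k).symm
  refine continuous_pow_mor.2 fun p => ?_
  exact C.add.continuous_op_map
    (S := {x : Lex (Smash X.a d.1 p.1) // d.2 p.1 (ofLex x) = some p.2}) continuous_const fun x =>
      C.mul.continuous_op_map (hf p.1) fun i => continuous_pow_mor.1 hg' ⟨i.1, ofLex x.1 i⟩

lemma continuous_laxComp_mk {X Y Z : RingIndex} {ψ₁ : Fin X.m → Option (Fin Y.m)}
    {κ₁ : ∀ j, Smash X.a ψ₁ j → Option (Fin (Y.a j))} {ψ₂ : Fin Y.m → Option (Fin Z.m)}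
    {κ₂ : ∀ j, Smash Y.a ψ₂ j → Option (Fin (Z.a j))}
    {f₁ : ∀ j, K → isometriesOperad.Op (Fibre ψ₁ j)}
    {f₂ : ∀ j, K → isometriesOperad.Op (Fibre ψ₂ j)} {P : K → Index X → C.A.Ob}
    (hf₁ : ∀ j, Continuous (f₁ j)) (hf₂ : ∀ j, Continuous (f₂ j))
    (hP : ∀ i, Continuous fun k => P k i) (p : Index Z) :
    Continuous fun k => Arrow.mk (C.laxComp (⟨ψ₁, fun j => f₁ j k, κ₁⟩ : Hom X Y)
      (⟨ψ₂, fun j => f₂ j k, κ₂⟩ : Hom Y Z) (P k) p) := by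
  simp only [laxComp_eq]
  -- The bijection `preimageEquiv` depends only on the fixed discrete parts, but is formed from
  -- whole morphisms; `k₀` supplies their operations.
  rcases isEmpty_or_nonempty K with _ | ⟨⟨k₀⟩⟩
  · exact continuous_of_const fun k => isEmptyElim k
  refine C.isTopological.continuous_comp_mk
    (continuous_expand (X := {x : Lex (Smash Y.a ψ₂ p.1) // κ₂ p.1 (ofLex x) = some p.2})
      (S := Fibre ψ₂ p.1) (T := fun j => Fibre ψ₁ j.1) (Y := fun y j =>
        {x : Lex (Smash X.a ψ₁ j.1) // κ₁ j.1 (ofLex x) = some (ofLex y.1 j)})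
      (P := fun k _ _ x i => P k ⟨i.1, ofLex x.1 i⟩)
      (hf₂ p.1) (fun j => hf₁ j.1) fun _ _ _ _ => hP _) ?_
  exact continuous_relabel (P' := fun k x i => P k ⟨i.1, ofLex x.1 i⟩)
    (preimageEquiv (⟨ψ₁, fun j => f₁ j k₀, κ₁⟩ : Hom X Y)
      (⟨ψ₂, fun j => f₂ j k₀, κ₂⟩ : Hom Y Z) p) (fibreEquiv ψ₁ ψ₂ p.1) (fun _ => rfl)
    (fun _ _ _ => rfl) (isometriesOperad.continuous_comp (hf₂ p.1) fun j => hf₁ j.1)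
    fun d z => hP ⟨(lexSnd z).1, ofLex (lexApp (lexSnd d) (lexFst z)).1 (lexSnd z)⟩

lemma continuous_laxComp {X Y Z : RingIndex} {h₁ : K → (X ⟶ Y)} {h₂ : K → (Y ⟶ Z)}
    {P : K → Index X → C.A.Ob} (hh₁ : Continuous h₁) (hh₂ : Continuous h₂)
    (hP : ∀ i, Continuous fun k => P k i) (p : Index Z) :
    Continuous fun k => Arrow.mk (C.laxComp (h₁ k) (h₂ k) (P k) p) := by
  have ho : ∀ d, IsOpen {k | (Hom.shape (h₁ k), Hom.shape (h₂ k)) = d} := fun d => by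
    simp only [Prod.ext_iff]
    exact (isOpen_shape hh₁ d.1).inter (isOpen_shape hh₂ d.2)
  refine continuous_of_fibres (fun k => (Hom.shape (h₁ k), Hom.shape (h₂ k))) ho fun d => ?_
  have := compactSpace_fibre ho d
  obtain ⟨f₁, hf₁, he₁⟩ := exists_hom_lift (hh₁.comp continuous_subtype_val) d.1
    fun k : {k // (Hom.shape (h₁ k), Hom.shape (h₂ k)) = d} => congrArg Prod.fst k.2
  obtain ⟨f₂, hf₂, he₂⟩ := exists_hom_lift (hh₂.comp continuous_subtype_val) d.2
    fun k : {k // (Hom.shape (h₁ k), Hom.shape (h₂ k)) = d} => congrArg Prod.snd k.2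
  have hP' := fun i => (hP i).comp
    (continuous_subtype_val (p := fun k => (Hom.shape (h₁ k), Hom.shape (h₂ k)) = d))
  have key : ∀ {h₁ h₁' : X ⟶ Y} {h₂ h₂' : Y ⟶ Z} (P : Index X → C.A.Ob), h₁ = h₁' → h₂ = h₂' →
      Arrow.mk (C.laxComp h₁' h₂' P p) = Arrow.mk (C.laxComp h₁ h₂ P p) := by
    rintro h₁ _ h₂ _ P rfl rfl
    rfl
  exact (continuous_laxComp_mk hf₁ hf₂ hP' p).congr fun k => key (P k.1) (he₁ k) (he₂ k)

lemma isContinuous_laxData (C : LPermutativeCategory.{u}) : C.laxData.IsContinuous where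
  kT2_hom := kT2_hom
  continuous_comp := RingIndex.continuous_comp
  isTopological X := C.isTopological.pow (Index X)
  continuous_map := continuous_laxMap
  continuous_mapComp hh₁ hh₂ hP := continuous_pow_mor.2 fun p =>
    continuous_laxComp hh₁ hh₂ (continuous_pow_ob.1 hP) p
  -- As an arrow, each component of the unit constraint is an identity.
  continuous_mapId hP := continuous_pow_mor.2 fun p =>
    (C.isTopological.continuous_id.comp (continuous_pow_ob.1 hP p)).congr
      fun _ => (mapId_same _ _ p).symm

end LPermutativeCategory

end

/-! ### Specialness -/

noncomputable section

namespace LaxData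

open TopCategory

variable {J : Type} [SmallCategory J] [∀ X Y : J, TopologicalSpace (X ⟶ Y)]
  {F : LaxData.{u} J} (hF : F.IsLax)

/-- If the constraints with outer morphism `π` are identities, naturality of `ω` says that `F π`
after `F φ` agrees with `F (φ ≫ π)` on morphisms, and associativity says that `F π` carries `ω` to
`ω`. These are the two ingredients of evaluation. -/
lemma evaluation_naturality {X W : J} (π : X ⟶ W)
    (hπ : ∀ {Y : J} (φ : Y ⟶ X) (P : (F.obj Y).Ob),
      F.mapComp φ π P ∼ₐ 𝟙 ((F.map (φ ≫ π)).obj P)) (g : Arrow (street hF X).Ob) :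
    (streetMap hF π ⋙ evaluation hF W).mapArrow.obj g =
      (evaluation hF X ⋙ F.map π).mapArrow.obj g := by
  obtain ⟨⟨Y, φ, P⟩, ⟨Y', φ', P'⟩, ⟨ψ, w, U⟩⟩ := g
  change Y' ⟶ Y at ψ
  change P ⟶ (F.map ψ).obj P' at U
  change ψ ≫ φ = φ' at w
  subst w
  have h₁ : (F.map π).map ((F.map φ).map U) ∼ₐ (F.map (φ ≫ π)).map U :=
    ((SameArrow.comp_id_right (hπ φ _)).symm.trans
      (SameArrow.of_eq (hF.mapComp_naturality φ π U))).trans (SameArrow.comp_id_left (hπ φ _))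
  have h₂ : (F.map π).map (F.mapComp ψ φ P') ∼ₐ F.mapComp ψ (φ ≫ π) P' :=
    ((SameArrow.comp_id_right (hπ (ψ ≫ φ) _)).symm.trans
      (SameArrow.of_eq (hF.assoc ψ φ π P'))).trans ((SameArrow.comp_id_left (hπ φ _)).trans
        (SameArrow.comp_eqToHom _ _))
  have e₁ : (streetMap hF π ⋙ evaluation hF W).mapArrow.obj (Arrow.mk
      (⟨ψ, rfl, U⟩ : F.StreetHom ⟨Y, φ, P⟩ ⟨Y', ψ ≫ φ, P'⟩)) =
      Arrow.mk ((F.map (φ ≫ π)).map U ≫ F.mapComp ψ (φ ≫ π) P') :=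
    SameArrow.comp_right _ (SameArrow.comp_eqToHom _ _)
  refine e₁.trans (SameArrow.trans (SameArrow.comp h₁.symm h₂.symm) ?_)
  refine (SameArrow.of_eq ((F.map π).map_comp _ _).symm).trans ?_
  exact SameArrow.of_eq (congrArg (F.map π).map
    (congrArg ((F.map φ).map U ≫ ·) (Category.comp_id (F.mapComp ψ φ P')).symm))

end LaxData

namespace LPermutativeCategory

open RingIndex TopCategory LaxData

variable (C : LPermutativeCategory.{u}) {X : RingIndex} {I : Type}
  {W : I → RingIndex} {π : ∀ i, X ⟶ W i} (hπ : ∀ i, Pure (π i))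
  (e : (Σ i, Index (W i)) ≃ Index X)

/-- A morphism of a power from a family of morphisms of powers. -/
def joinArrow (g : ∀ i, Arrow (C.laxData.obj (W i)).Ob) : Arrow (C.laxData.obj X).Ob :=
  Arrow.mk (T := Index X → C.A.Ob)
    (X := fun q => (powArrow (g (e.symm q).1) (e.symm q).2).left)
    (Y := fun q => (powArrow (g (e.symm q).1) (e.symm q).2).right)
    fun q => (powArrow (g (e.symm q).1) (e.symm q).2).hom

lemma powArrow_joinArrow (g : ∀ i, Arrow (C.laxData.obj (W i)).Ob) (q : Index X) :
    powArrow (C.joinArrow e g) q = powArrow (g (e.symm q).1) (e.symm q).2 := rfl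

lemma isMultifunctor_joinArrow : Realization.IsMultifunctor (A := fun i => C.laxData.obj (W i)) (B := C.laxData.obj X)
    (C.joinArrow e) := fun p x =>
  ⟨({ obj a q := (show Index (W (e.symm q).1) → C.A.Ob from (x (e.symm q).1).obj a) (e.symm q).2
      map f q := (show ∀ _, _ from (x (e.symm q).1).map f) (e.symm q).2
      map_id a := funext fun q => congrFun ((x (e.symm q).1).map_id a) (e.symm q).2
      map_comp f g := funext fun q => congrFun ((x (e.symm q).1).map_comp f g) (e.symm q).2 } :
    Fin (p + 1) ⥤ (Index X → C.A.Ob)), fun _ _ _ => rfl⟩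

lemma kContinuous_joinArrow : KContinuous (C.joinArrow e) :=
  kContinuous_iff.2 fun _ _ _ _ _ hg => continuous_pow_mor.2 fun q =>
    continuous_pow_mor.1 ((continuous_apply (e.symm q).1).comp hg) (e.symm q).2

variable {C e}

lemma powArrow_map {V : RingIndex} {π : X ⟶ V} (hπ : Pure π) (g : Arrow (C.laxData.obj X).Ob)
    (p : Index V) : powArrow ((C.laxData.map π).mapArrow.obj g) p = powArrow g (hπ.index p) :=
  hπ.map_same _ p

variable [Finite I]

include hπ in
/-- Morphisms that jointly select all factors identify a power with a product. -/
lemma exists_homeomorph_of_index (he : ∀ i p, e ⟨i, p⟩ = (hπ i).index p) :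
    ∃ E : (C.laxData.obj X).Realization ≃ₜ KSpace (∀ i, (C.laxData.obj (W i)).Realization),
      ∀ z, E z = fun i => realizationMap (C.laxData.map (π i)) z := by
  refine Realization.exists_homeomorph_prod (fun i => C.laxData.map (π i)) (fun i =>
    kContinuous_iff.2 fun K _ _ _ g hg => C.isContinuous_laxData.continuous_map continuous_const hg)
    (C.isMultifunctor_joinArrow e) (C.kContinuous_joinArrow e) (fun g i => ?_) fun g => ?_
  · refine powArrow_injective (funext fun p => ?_)
    rw [powArrow_map (hπ i), powArrow_joinArrow, ← he, Equiv.symm_apply_apply]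
  · refine powArrow_injective (funext fun q => ?_)
    rw [powArrow_joinArrow, powArrow_map (hπ _), ← he, Sigma.eta, Equiv.apply_symm_apply]

include hπ in
-- Followed by the product of the evaluations, the map in question becomes the evaluation at `X`
-- followed by the homeomorphism `E`. All other sides of this square are homotopy equivalences.
lemma isHomotopyEquivalence_of_index (h : C.laxData.IsLax)
    (he : ∀ i p, e ⟨i, p⟩ = (hπ i).index p) :
    IsHomotopyEquivalence (X := (street h X).Realization)
      (Y := KSpace (∀ i, (street h (W i)).Realization))
      fun z i => realizationMap (streetMap h (π i)) z := by
  have hc := C.isContinuous_laxData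
  obtain ⟨E, hE⟩ := exists_homeomorph_of_index hπ he
  have hf : Continuous (X := (street h X).Realization)
      (Y := KSpace (∀ i, (street h (W i)).Realization))
      fun z i => realizationMap (streetMap h (π i)) z :=
    continuous_of_test fun K _ _ _ z hz => continuous_to_kSpace.2 (continuous_pi fun i =>
      (Realization.continuous_realizationMap (kContinuous_iff.2 fun K _ _ _ g hg =>
        continuous_streetMap h hc continuous_const hg)).comp hz)
  refine IsHomotopyEquivalence.of_comp hf (IsHomotopyEquivalence.kSpace_pi fun i =>
    isHomotopyEquivalence_evaluation h hc (W i)) ?_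
  convert (IsHomotopyEquivalence.of_homeomorph E).comp
    (isHomotopyEquivalence_evaluation h hc X) using 1
  funext z
  refine Eq.trans ?_ (hE _).symm
  funext i
  refine (Realization.realizationMap_comp _ _ z).symm.trans (Eq.trans ?_
    (Realization.realizationMap_comp _ _ z))
  exact Realization.realizationMap_congr (evaluation_naturality h (π i) fun φ P =>
    powArrow_injective (funext fun p => (hπ i).laxComp_same φ P p)) z

/-- The empty family of projections already selects all factors, and the empty product is a point.
-/
lemma contractibleSpace_of_isEmpty (h : C.laxData.IsLax) [IsEmpty (Index X)] :
    ContractibleSpace (street h X).Realization := by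
  obtain ⟨e, -⟩ := isHomotopyEquivalence_of_index (C := C) (X := X) (I := Fin 0)
    (W := fun i => i.elim0) (π := fun i => i.elim0) (fun i => i.elim0)
    (e := Equiv.equivOfIsEmpty _ _) h fun i => i.elim0
  have : Unique (KSpace (∀ i : Fin 0, (street h (i.elim0 : RingIndex)).Realization)) :=
    Pi.uniqueOfIsEmpty _
  exact e.contractibleSpace

/-- The realization of the rectification of `ℱC` is special. -/
lemma isSpecial_classifyingDiagram (h : C.laxData.IsLax) : IsSpecial (classifyingDiagram h) where
  contractible_empty :=
    have : IsEmpty (Index RingIndex.empty) := ⟨fun q => q.1.elim0⟩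
    contractibleSpace_of_isEmpty h
  mul_equivalence X := isHomotopyEquivalence_of_index (pureProj X) h
    -- The target of each projection has the single multiplicative index `0`, which this bijection
    -- drops.
    (e := ⟨fun q => ⟨q.1, q.2.2⟩, fun q => ⟨q.1, ⟨0, q.2⟩⟩, fun ⟨i, p, y⟩ => by
      obtain rfl := Subsingleton.elim p 0
      rfl, fun _ => rfl⟩) fun _ _ => rfl
  contractible_zero :=
    have : IsEmpty (Index (single 0)) := ⟨fun q => q.2.elim0⟩
    contractibleSpace_of_isEmpty h
  add_equivalence a := isHomotopyEquivalence_of_index (pureAddProj a) h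
    -- The target of each projection has a single additive index, which is replaced by the selected
    -- summand `x`.
    (e := ⟨fun q => ⟨q.2.1, q.1⟩, fun q => ⟨q.2, ⟨q.1, 0⟩⟩, fun ⟨x, p, q⟩ => by
      obtain rfl := Subsingleton.elim q 0
      rfl, fun _ => rfl⟩) fun _ _ => rfl

end LPermutativeCategory

theorem mainTheorem4 (C : LPermutativeCategory.{u}) :
    ∃ h : C.laxData.IsLax,
      (∀ X : RingIndex, (LaxData.street h X).IsTopological) ∧
      (LaxData.classifyingDiagram h).IsContinuousFunctor ∧
      IsSpecial (LaxData.classifyingDiagram h) :=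
  ⟨C.isLax_laxData, fun X => LaxData.isTopological_street _ C.isContinuous_laxData X,
    LaxData.isContinuousFunctor_classifyingDiagram _ C.isContinuous_laxData,
    LPermutativeCategory.isSpecial_classifyingDiagram _⟩

end
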